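/- There is a combinatorial approximation algorithm for Max-Cut which, given a connected simple graph $G$ with $n$ vertices and $m \le 2n$ edges, runs in time $O(n)$ and outputs a cut whose size is at least $$\min\Bigl\{1,\ \frac12+\frac{n}{2m}\Bigr\}\cdot mc(G),$$ where $mc(G)$ is the maximum size of a cut of $G$. (Thus the approximation ratio is $\frac12+\frac{n}{2m}$ when $m\ge n$, and the output is a maximum cut when $G$ is a tree.) Precisely: there are one fixed program $P$ of a unit-cost random access machine, whose only operations on numbers are copying, adding or subtracting $1$ and comparing, and a constant $C$, such that for every such $G$ with vertices $0,\dots,n-1$, given as a list of its edges in any order, $P$ halts after at most $Cn$ steps with such a cut. -/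

import Mathlib

/-! ### Cuts of a graph -/

/-- The size `|E_G(A, B)|` of the cut given by the partition `V = A ∪ B`, `B = Aᶜ`: the number of
edges with one end in `A` and the other end outside `A` (an edge of the cut is counted once, as the
pair whose first component lies in `A`). -/
def cutSize {V : Type*} [Fintype V] [DecidableEq V] (G : SimpleGraph V) [DecidableRel G.Adj]
    (A : Finset V) : ℕ :=
  (G.interedges A Aᶜ).card

/-- `mc(G)`, the largest size of a cut of `G`. -/
def maxCut {V : Type*} [Fintype V] [DecidableEq V] (G : SimpleGraph V) [DecidableRel G.Adj] : ℕ :=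
  (Finset.univ : Finset (Finset V)).sup (cutSize G)

/-! ### A random access machine with a step count

The machine has registers `R 0, R 1, …` and arrays `M 0, M 1, …` (a program mentions only finitely
many of them), all holding natural numbers, and indirect addressing `M a [R i]`.
The only operations on numbers are copying, adding one, subtracting one and comparing.
In particular there are no numerical subroutines, and after `t` steps no stored number exceeds
the largest number in the input or in the program by more than `t`,
so unit cost per instruction is unit cost on words of logarithmic length in linear-time runs. -/

namespace RAM

/-- The memory of the machine. -/
structure State where
  /-- contents of the registers -/
  reg : ℕ → ℕ
  /-- contents of the arrays: `arr a i` is the cell `M a [i]` -/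
  arr : ℕ → ℕ → ℕ

/-- Write `x` into the register `r`. -/
def State.setReg (s : State) (r x : ℕ) : State :=
  { s with reg := Function.update s.reg r x }

/-- Write `x` into the cell `M a [i]`. -/
def State.setArr (s : State) (a i x : ℕ) : State :=
  { s with arr := Function.update s.arr a (Function.update (s.arr a) i x) }

/-- Elementary tests: comparison of two registers. -/
inductive Test where
  /-- `R r < R q` -/
  | lt (r q : ℕ)
  /-- `R r = R q` -/
  | eq (r q : ℕ)

/-- The truth of a test in a state. -/
def Test.Holds : Test → State → Prop
  | .lt r q, s => s.reg r < s.reg q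
  | .eq r q, s => s.reg r = s.reg q

/-- Elementary instructions. -/
inductive Instr where
  /-- `R r := c` for a constant `c` of the program -/
  | const (r c : ℕ)
  /-- `R r := R q` -/
  | copy (r q : ℕ)
  /-- `R r := R r + 1` -/
  | succ (r : ℕ)
  /-- `R r := R r - 1`, and `0` stays `0` -/
  | pred (r : ℕ)
  /-- `R r := M a [R i]` -/
  | load (r a i : ℕ)
  /-- `M a [R i] := R r` -/
  | store (a i r : ℕ)

/-- The effect of an elementary instruction. -/
def Instr.apply : Instr → State → State
  | .const r c, s => s.setReg r c
  | .copy r q, s => s.setReg r (s.reg q)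
  | .succ r, s => s.setReg r (s.reg r + 1)
  | .pred r, s => s.setReg r (s.reg r - 1)
  | .load r a i, s => s.setReg r (s.arr a (s.reg i))
  | .store a i r, s => s.setArr a (s.reg i) (s.reg r)

/-- Programs. -/
inductive Program where
  /-- do nothing -/
  | skip
  /-- execute one elementary instruction -/
  | instr (c : Instr)
  /-- execute `p`, then `q` -/
  | seq (p q : Program)
  /-- if `b` then `p` else `q` -/
  | ite (b : Test) (p q : Program)
  /-- while `b` do `p` -/
  | loop (b : Test) (p : Program)

/-- `Exec p s t s'`: the program `p`, started in the state `s`, halts in the state `s'` after exactly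
`t` steps. Every executed elementary instruction and every evaluated test is one step. -/
inductive Exec : Program → State → ℕ → State → Prop
  | skip (s : State) : Exec .skip s 0 s
  | instr (c : Instr) (s : State) : Exec (.instr c) s 1 (c.apply s)
  | seq {p q : Program} {s₁ s₂ s₃ : State} {t₁ t₂ : ℕ} :
      Exec p s₁ t₁ s₂ → Exec q s₂ t₂ s₃ → Exec (.seq p q) s₁ (t₁ + t₂) s₃
  | ite_true {b : Test} {p q : Program} {s s' : State} {t : ℕ} :
      b.Holds s → Exec p s t s' → Exec (.ite b p q) s (t + 1) s'
  | ite_false {b : Test} {p q : Program} {s s' : State} {t : ℕ} :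
      ¬ b.Holds s → Exec q s t s' → Exec (.ite b p q) s (t + 1) s'
  | loop_true {b : Test} {p : Program} {s₁ s₂ s₃ : State} {t₁ t₂ : ℕ} :
      b.Holds s₁ → Exec p s₁ t₁ s₂ → Exec (.loop b p) s₂ t₂ s₃ →
        Exec (.loop b p) s₁ (t₁ + t₂ + 1) s₃
  | loop_false {b : Test} {p : Program} {s : State} :
      ¬ b.Holds s → Exec (.loop b p) s 1 s

end RAM

/-! ### Input and output -/

/-- The list `es` of pairs of vertices is an edge list of `G`: it lists every edge of `G` exactly
once, in an arbitrary order and with the two ends in an arbitrary order, and nothing else. -/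
def IsEdgeList {V : Type*} (G : SimpleGraph V) (es : List (V × V)) : Prop :=
  (es.map fun e => s(e.1, e.2)).Nodup ∧
    ∀ e : Sym2 V, e ∈ es.map (fun e => s(e.1, e.2)) ↔ e ∈ G.edgeSet

/-- The initial state for a graph with the vertices `0, …, n - 1` and the edge list `es`:
`R 0` holds the number of vertices, `R 1` the number of edges, and `M 0 [i]` and `M 1 [i]` hold the
two ends of the `i`-th edge; everything else is zero. -/
def inputState (n : ℕ) (es : List (Fin n × Fin n)) : RAM.State where
  reg := fun r => if r = 0 then n else if r = 1 then es.length else 0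
  arr := fun a i =>
    if a = 0 then (es.map fun e => (e.1 : ℕ)).getD i 0
    else if a = 1 then (es.map fun e => (e.2 : ℕ)).getD i 0
    else 0

/-- The output of a halted machine, read as the side `A` of a cut `(A, Aᶜ)`:
`v ∈ A` if and only if `M 2 [v] ≠ 0`. -/
def outputSide (n : ℕ) (s : RAM.State) : Finset (Fin n) :=
  Finset.univ.filter fun v => s.arr 2 v ≠ 0

/-!
The algorithm builds a depth-first search tree, so that every edge of the graph joins a vertex to
one of its ancestors, and cuts the tree from the bottom up into subtrees ("pieces"). A piece is cut
off as soon as it contains at least four edges outside the tree; hence the part of a piece below a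
child of its top (a "branch") contains at most three of them. A best colouring of a piece with two
colours, that is, one with the fewest "bad" edges between vertices of the same colour, is found
exactly: the colour of the top may be prescribed by symmetry, and if the colours of the at most
three upper ends of the edges of a branch outside the tree are prescribed as well, which can be done
in eight ways, then a forest with external fields remains, for which a greedy rule from the leaves
upwards followed by a pass downwards is optimal (`forest_energy_le`, `IsPass.badIn_le`). Finally the
colours in every piece are exchanged, from the top down, if this helps the edges that leave it
upwards, so that at most half of the edges between different pieces are bad (`merge_run`).

Let `b` be the number of bad edges of the result and `τ` the least possible number. If there is only
one piece, then `b = τ`. Otherwise let `P ≥ 2` be the number of pieces and `k` the number of edges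
outside the tree inside pieces. The `n - P` tree edges inside pieces and these `k` edges are all the
edges inside pieces. The number of bad ones among them is at most `τ`, and at most `k` because a
proper colouring of the tree is a competitor, so it is at most `(3 τ + k) / 4`. Therefore
`b ≤ (3 τ + k) / 4 + (m - (n - P) - k) / 2`, and `k ≥ 4 (P - 1) ≥ 2 P` since all pieces but one have
at least four edges outside the tree. This gives `b ≤ (m - n) / 2 + 3 τ / 4`
(`IsSolution.card_badEdges_le`), and as `n / (2 m) ≥ 1 / 4`, the cut has at least
`(1 / 2 + n / (2 m)) (m - τ)` edges (`ratio_le`).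

The program is written in a small imperative language with named variables and arrays, which is
compiled to the random access machine with exact step counts (`Cmd.Run.exec`). Loops are analysed by
invariants, for the time bounds with a potential (`Cmd.forUp_run_amortized`, `Cmd.walk_run`).
-/

set_option linter.constructorNameAsVariable false

namespace SparseMaxCut

/-! ### A small imperative language and its compilation to the random access machine -/

/-- The variables of the source language. The first two are the input registers. -/
inductive Var
  | n | m | i | j | arcs | u | v | w | cur | cnt | go | acc | top | aux | same | diff
  deriving DecidableEq

/-- The arrays of the source language. The first two hold the input and the third the output. -/
inductive Arr
  | eu | ev | out
  | src | dst | head | next | pos | ord | par | up | lo | uhead | unext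
  | rt | kk | stack
  | root | sub | idx | count
  | mask | fav0 | fav1 | col | cost | best | bcol
  | key | khead | knext | flip
  deriving DecidableEq

/-- A memory for the source language: the values of the variables and of the array cells. -/
@[ext] structure Store where
  /-- the values of the variables -/
  reg : Var → ℕ
  /-- the values of the array cells -/
  arr : Arr → ℕ → ℕ

/-- Assign `c` to the variable `x`. -/
def Store.setVar (h : Store) (x : Var) (c : ℕ) : Store :=
  { h with reg := Function.update h.reg x c }

/-- Write `c` into the cell `k` of the array `a`. -/
def Store.setCell (h : Store) (a : Arr) (k c : ℕ) : Store :=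
  { h with arr := Function.update h.arr a (Function.update (h.arr a) k c) }

@[simp] theorem Store.setVar_arr (h : Store) (x : Var) (c : ℕ) : (h.setVar x c).arr = h.arr := rfl

@[simp] theorem Store.setCell_reg (h : Store) (a : Arr) (k c : ℕ) :
    (h.setCell a k c).reg = h.reg := rfl

@[simp] theorem Store.setVar_reg (h : Store) (x y : Var) (c : ℕ) :
    (h.setVar x c).reg y = if y = x then c else h.reg y := by
  simp [Store.setVar, Function.update_apply]

@[simp] theorem Store.setCell_arr (h : Store) (a b : Arr) (k c : ℕ) :
    (h.setCell a k c).arr b = if b = a then Function.update (h.arr a) k c else h.arr b := by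
  simp [Store.setCell, Function.update_apply]

/-- Arithmetic expressions; each has at most one operand, so that one register suffices to
evaluate them. -/
inductive Expr
  | var (x : Var)
  | const (c : ℕ)
  | get (a : Arr) (e : Expr)
  | succ (e : Expr)
  | pred (e : Expr)

namespace Expr

/-- The value of an expression. -/
def eval : Expr → Store → ℕ
  | var x, h => h.reg x
  | const c, _ => c
  | get a e, h => h.arr a (e.eval h)
  | succ e, h => e.eval h + 1
  | pred e, h => e.eval h - 1

/-- The number of machine steps that the evaluation of an expression takes. -/
def size : Expr → ℕ
  | var _ => 1
  | const _ => 1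
  | get _ e => e.size + 1
  | succ e => e.size + 1
  | pred e => e.size + 1

/-- The machine program that evaluates an expression into the register `t`. -/
def compile (t : ℕ) : Expr → RAM.Program
  | var x => .instr (.copy t x.ctorIdx)
  | const c => .instr (.const t c)
  | get a e => .seq (e.compile t) (.instr (.load t a.ctorIdx t))
  | succ e => .seq (e.compile t) (.instr (.succ t))
  | pred e => .seq (e.compile t) (.instr (.pred t))

end Expr

/-- Comparisons of expressions. -/
inductive Cond
  | lt (e f : Expr)
  | eq (e f : Expr)

namespace Cond

/-- The truth of a comparison. -/
def Holds : Cond → Store → Prop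
  | lt e f, h => e.eval h < f.eval h
  | eq e f, h => e.eval h = f.eval h

instance (b : Cond) (h : Store) : Decidable (b.Holds h) := by
  cases b <;> unfold Holds <;> infer_instance

/-- The number of machine steps that the evaluation of both sides takes. -/
def size : Cond → ℕ
  | lt e f => e.size + f.size
  | eq e f => e.size + f.size

/-- The machine program that evaluates both sides into the registers `100` and `101`. -/
def prep : Cond → RAM.Program
  | lt e f => .seq (e.compile 100) (f.compile 101)
  | eq e f => .seq (e.compile 100) (f.compile 101)

/-- The machine test on the registers `100` and `101`. -/
def test : Cond → RAM.Test
  | lt _ _ => .lt 100 101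
  | eq _ _ => .eq 100 101

end Cond

/-- The commands of the source language. -/
inductive Cmd
  | skip
  | set (x : Var) (e : Expr)
  | put (a : Arr) (e f : Expr)
  | seq (p q : Cmd)
  | ite (b : Cond) (p q : Cmd)
  | loop (b : Cond) (p : Cmd)

namespace Cmd

/-- Translation of a command into a machine program. -/
def compile : Cmd → RAM.Program
  | skip => .skip
  | set x e => .seq (e.compile 100) (.instr (.copy x.ctorIdx 100))
  | put a e f => .seq (.seq (e.compile 100) (f.compile 101)) (.instr (.store a.ctorIdx 100 101))
  | seq p q => .seq p.compile q.compile
  | ite b p q => .seq b.prep (.ite b.test p.compile q.compile)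
  | loop b p => .seq b.prep (.loop b.test (.seq p.compile b.prep))

/-- `Run c h t h'`: the command `c`, started in `h`, ends in `h'`, and its translation takes
`t` machine steps for that. -/
inductive Run : Cmd → Store → ℕ → Store → Prop
  | skip (h : Store) : Run .skip h 0 h
  | set (x : Var) (e : Expr) (h : Store) : Run (.set x e) h (e.size + 1) (h.setVar x (e.eval h))
  | put (a : Arr) (e f : Expr) (h : Store) :
      Run (.put a e f) h (e.size + f.size + 1) (h.setCell a (e.eval h) (f.eval h))
  | seq {p q : Cmd} {h₁ h₂ h₃ : Store} {t₁ t₂ : ℕ} :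
      Run p h₁ t₁ h₂ → Run q h₂ t₂ h₃ → Run (.seq p q) h₁ (t₁ + t₂) h₃
  | ite_true {b : Cond} {p q : Cmd} {h h' : Store} {t : ℕ} :
      b.Holds h → Run p h t h' → Run (.ite b p q) h (b.size + (t + 1)) h'
  | ite_false {b : Cond} {p q : Cmd} {h h' : Store} {t : ℕ} :
      ¬ b.Holds h → Run q h t h' → Run (.ite b p q) h (b.size + (t + 1)) h'
  | loop_true {b : Cond} {p : Cmd} {h₁ h₂ h₃ : Store} {t₁ t₂ : ℕ} :
      b.Holds h₁ → Run p h₁ t₁ h₂ → Run (.loop b p) h₂ t₂ h₃ →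
        Run (.loop b p) h₁ (b.size + (t₁ + t₂ + 1)) h₃
  | loop_false {b : Cond} {p : Cmd} {h : Store} :
      ¬ b.Holds h → Run (.loop b p) h (b.size + 1) h

end Cmd

/-- The memory of the source language that a machine state represents. -/
def view (s : RAM.State) : Store where
  reg := fun x => s.reg x.ctorIdx
  arr := fun a => s.arr a.ctorIdx

theorem Var.ctorIdx_lt (x : Var) : x.ctorIdx < 100 := by
  cases x <;> decide

theorem Var.ctorIdx_injective : Function.Injective Var.ctorIdx :=
  Function.LeftInverse.injective Var.ofNat_ctorIdx

theorem Arr.ctorIdx_injective : Function.Injective Arr.ctorIdx :=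
  Function.LeftInverse.injective Arr.ofNat_ctorIdx

theorem view_setReg_temp (s : RAM.State) {t : ℕ} (ht : 100 ≤ t) (c : ℕ) :
    view (s.setReg t c) = view s := by
  ext x
  · have := x.ctorIdx_lt
    simp only [view, RAM.State.setReg]
    rw [Function.update_of_ne (by omega)]
  · rfl

theorem view_setReg (s : RAM.State) (x : Var) (c : ℕ) :
    view (s.setReg x.ctorIdx c) = (view s).setVar x c := by
  ext y
  · simp [view, RAM.State.setReg, Function.update_apply, Var.ctorIdx_injective.eq_iff]
  · rfl

theorem view_setArr (s : RAM.State) (a : Arr) (k c : ℕ) :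
    view (s.setArr a.ctorIdx k c) = (view s).setCell a k c := by
  ext b l
  · rfl
  · simp only [view, RAM.State.setArr, Store.setCell, Function.update_apply,
      Arr.ctorIdx_injective.eq_iff]

theorem Expr.exec_compile (e : Expr) (t : ℕ) (s : RAM.State) :
    RAM.Exec (e.compile t) s e.size (s.setReg t (e.eval (view s))) := by
  induction e with
  | var x => exact RAM.Exec.instr _ _
  | const c => exact RAM.Exec.instr _ _
  | get a e ih =>
    have h := RAM.Exec.seq ih (.instr (.load t a.ctorIdx t) _)
    simpa [RAM.Instr.apply, RAM.State.setReg, Expr.eval, Expr.compile, Expr.size, view] using h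
  | succ e ih =>
    have h := RAM.Exec.seq ih (.instr (.succ t) _)
    simpa [RAM.Instr.apply, RAM.State.setReg, Expr.eval, Expr.compile, Expr.size, view] using h
  | pred e ih =>
    have h := RAM.Exec.seq ih (.instr (.pred t) _)
    simpa [RAM.Instr.apply, RAM.State.setReg, Expr.eval, Expr.compile, Expr.size, view] using h

/-- The state after the two operands of an instruction have been evaluated. -/
theorem exec_operands (e f : Expr) (s : RAM.State) :
    RAM.Exec (.seq (e.compile 100) (f.compile 101)) s (e.size + f.size)
      ((s.setReg 100 (e.eval (view s))).setReg 101 (f.eval (view s))) := by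
  have h2 := f.exec_compile 101 (s.setReg 100 (e.eval (view s)))
  rw [view_setReg_temp _ (by norm_num)] at h2
  exact RAM.Exec.seq (e.exec_compile 100 s) h2

theorem Cond.exec_prep (b : Cond) (s : RAM.State) :
    ∃ s', RAM.Exec b.prep s b.size s' ∧ view s' = view s ∧ (b.test.Holds s' ↔ b.Holds (view s)) := by
  cases b <;>
  · refine ⟨_, exec_operands _ _ s, ?_, ?_⟩
    · rw [view_setReg_temp _ (by norm_num), view_setReg_temp _ (by norm_num)]
    · simp [Cond.test, RAM.Test.Holds, Cond.Holds, RAM.State.setReg]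

/-- The translation is correct, with the exact number of steps. -/
theorem Cmd.Run.exec {c : Cmd} {h h' : Store} {t : ℕ} (hc : c.Run h t h') :
    ∀ s, view s = h → ∃ s', RAM.Exec c.compile s t s' ∧ view s' = h' := by
  induction hc with
  | skip h => exact fun s hs => ⟨s, .skip s, hs⟩
  | set x e h =>
    rintro s rfl
    refine ⟨_, .seq (e.exec_compile 100 s) (.instr _ _), ?_⟩
    simp only [RAM.Instr.apply]
    rw [view_setReg, view_setReg_temp _ (by norm_num)]
    simp [RAM.State.setReg]
  | put a e f h =>
    rintro s rfl
    refine ⟨_, .seq (exec_operands e f s) (.instr _ _), ?_⟩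
    simp only [RAM.Instr.apply]
    rw [view_setArr, view_setReg_temp _ (by norm_num), view_setReg_temp _ (by norm_num)]
    simp [RAM.State.setReg]
  | seq _ _ ih1 ih2 =>
    intro s hs
    obtain ⟨s1, e1, v1⟩ := ih1 s hs
    obtain ⟨s2, e2, v2⟩ := ih2 s1 v1
    exact ⟨s2, .seq e1 e2, v2⟩
  | ite_true hb _ ih =>
    rintro s rfl
    obtain ⟨s1, e1, v1, t1⟩ := Cond.exec_prep _ s
    obtain ⟨s2, e2, v2⟩ := ih s1 v1
    exact ⟨s2, .seq e1 (.ite_true (t1.2 hb) e2), v2⟩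
  | ite_false hb _ ih =>
    rintro s rfl
    obtain ⟨s1, e1, v1, t1⟩ := Cond.exec_prep _ s
    obtain ⟨s2, e2, v2⟩ := ih s1 v1
    exact ⟨s2, .seq e1 (.ite_false (mt t1.1 hb) e2), v2⟩
  | loop_true hb _ _ ih1 ih2 =>
    rintro s rfl
    obtain ⟨s1, e1, v1, t1⟩ := Cond.exec_prep _ s
    obtain ⟨s2, e2, v2⟩ := ih1 s1 v1
    obtain ⟨s3, e3, v3⟩ := ih2 s2 v2
    cases e3 with
    | seq e4 e5 =>
      have := RAM.Exec.seq e1 (.loop_true (t1.2 hb) (.seq e2 e4) e5)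
      refine ⟨s3, ?_, v3⟩
      rw [← add_assoc, ← add_assoc] at this ⊢
      rwa [← add_assoc] at this ⊢
  | loop_false hb =>
    rintro s rfl
    obtain ⟨s1, e1, v1, t1⟩ := Cond.exec_prep _ s
    exact ⟨s1, .seq e1 (.loop_false (mt t1.1 hb)), v1⟩

/-! ### Frames, straight-line code and loops -/

namespace Cmd

/-- Whether a command contains an assignment to the variable `x`. -/
def modVar (x : Var) : Cmd → Bool
  | skip => false
  | set y _ => decide (y = x)
  | put _ _ _ => false
  | seq p q => p.modVar x || q.modVar x
  | ite _ p q => p.modVar x || q.modVar x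
  | loop _ p => p.modVar x

/-- Whether a command contains a write to the array `a`. -/
def modArr (a : Arr) : Cmd → Bool
  | skip => false
  | set _ _ => false
  | put b _ _ => decide (b = a)
  | seq p q => p.modArr a || q.modArr a
  | ite _ p q => p.modArr a || q.modArr a
  | loop _ p => p.modArr a

/-- `h'` differs from `h` at most in the variables and arrays that `c` writes to. -/
structure Frame (c : Cmd) (h h' : Store) : Prop where
  reg : ∀ x, c.modVar x = false → h'.reg x = h.reg x
  arr : ∀ a, c.modArr a = false → h'.arr a = h.arr a

theorem Frame.refl (c : Cmd) (h : Store) : Frame c h h := ⟨fun _ _ => rfl, fun _ _ => rfl⟩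

theorem Frame.trans {c : Cmd} {h₁ h₂ h₃ : Store} (h12 : Frame c h₁ h₂) (h23 : Frame c h₂ h₃) :
    Frame c h₁ h₃ :=
  ⟨fun x hx => (h23.reg x hx).trans (h12.reg x hx), fun a ha => (h23.arr a ha).trans (h12.arr a ha)⟩

theorem Frame.mono {c d : Cmd} {h h' : Store} (hc : Frame c h h')
    (hv : ∀ x, d.modVar x = false → c.modVar x = false)
    (ha : ∀ a, d.modArr a = false → c.modArr a = false) : Frame d h h' :=
  ⟨fun x hx => hc.reg x (hv x hx), fun a hx => hc.arr a (ha a hx)⟩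

theorem Run.frame {c : Cmd} {h h' : Store} {t : ℕ} (hc : c.Run h t h') : Frame c h h' := by
  induction hc with
  | skip h => exact Frame.refl _ _
  | set x e h =>
    refine ⟨fun y hy => ?_, fun _ _ => rfl⟩
    have : y ≠ x := fun e => by simp [modVar, e] at hy
    simp [this]
  | put a e f h =>
    refine ⟨fun _ _ => rfl, fun b hb => ?_⟩
    have : b ≠ a := fun e => by simp [modArr, e] at hb
    simp [this]
  | seq _ _ ih1 ih2 =>
    exact (ih1.mono (by simp +contextual [modVar]) (by simp +contextual [modArr])).trans
      (ih2.mono (by simp +contextual [modVar]) (by simp +contextual [modArr]))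
  | ite_true hb _ ih => exact ih.mono (by simp +contextual [modVar]) (by simp +contextual [modArr])
  | ite_false hb _ ih => exact ih.mono (by simp +contextual [modVar]) (by simp +contextual [modArr])
  | loop_true hb _ _ ih1 ih2 =>
    exact (ih1.mono (by simp [modVar]) (by simp [modArr])).trans ih2
  | loop_false hb => exact Frame.refl _ _

/-- Whether a command is free of loops. -/
def flat : Cmd → Bool
  | skip => true
  | set _ _ => true
  | put _ _ _ => true
  | seq p q => p.flat && q.flat
  | ite _ p q => p.flat && q.flat
  | loop _ _ => false

/-- The effect of a loop-free command (a loop is treated as doing nothing). -/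
def den : Cmd → Store → Store
  | skip, h => h
  | set x e, h => h.setVar x (e.eval h)
  | put a e f, h => h.setCell a (e.eval h) (f.eval h)
  | seq p q, h => q.den (p.den h)
  | ite b p q, h => if b.Holds h then p.den h else q.den h
  | loop _ _, h => h

/-- An upper bound for the number of steps of a loop-free command. -/
def time : Cmd → ℕ
  | skip => 0
  | set _ e => e.size + 1
  | put _ e f => e.size + f.size + 1
  | seq p q => p.time + q.time
  | ite b p q => b.size + (p.time + q.time + 1)
  | loop _ _ => 0

theorem run_den (c : Cmd) (hc : c.flat = true) (h : Store) :
    ∃ t, c.Run h t (c.den h) ∧ t ≤ c.time := by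
  induction c generalizing h with
  | skip => exact ⟨_, .skip h, le_rfl⟩
  | set x e => exact ⟨_, .set x e h, le_rfl⟩
  | put a e f => exact ⟨_, .put a e f h, le_rfl⟩
  | seq p q ihp ihq =>
    simp only [flat, Bool.and_eq_true] at hc
    obtain ⟨t1, r1, l1⟩ := ihp hc.1 h
    obtain ⟨t2, r2, l2⟩ := ihq hc.2 (p.den h)
    exact ⟨_, .seq r1 r2, by simp only [time]; omega⟩
  | ite b p q ihp ihq =>
    simp only [flat, Bool.and_eq_true] at hc
    by_cases hb : b.Holds h
    · obtain ⟨t1, r1, l1⟩ := ihp hc.1 h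
      simp only [den, if_pos hb]
      exact ⟨_, .ite_true hb r1, by simp only [time]; omega⟩
    · obtain ⟨t1, r1, l1⟩ := ihq hc.2 h
      simp only [den, if_neg hb]
      exact ⟨_, .ite_false hb r1, by simp only [time]; omega⟩
  | loop b p ih => simp [flat] at hc

/-- Commands executed one after the other. -/
def block : List Cmd → Cmd
  | [] => skip
  | c :: l => seq c (block l)

/-- The rule for loops, with an invariant that carries a potential: the time that one round takes
is paid for by the decrease of the potential. -/
theorem loop_run {b : Cond} {p : Cmd} (I : ℕ → Store → Prop) {h₀ : Store} {φ₀ : ℕ}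
    (step : ∀ φ h, Frame p h₀ h → I φ h → b.Holds h →
      ∃ t h' φ', p.Run h t h' ∧ I φ' h' ∧ b.size + (t + 1) + φ' ≤ φ)
    (init : I φ₀ h₀) :
    ∃ t h' φ', (Cmd.loop b p).Run h₀ t h' ∧ I φ' h' ∧ ¬ b.Holds h' ∧
      t + φ' ≤ φ₀ + (b.size + 1) := by
  suffices H : ∀ φ h, Frame p h₀ h → I φ h →
      ∃ t h' φ', (Cmd.loop b p).Run h t h' ∧ I φ' h' ∧ ¬ b.Holds h' ∧
        t + φ' ≤ φ + (b.size + 1) from H φ₀ h₀ (Frame.refl _ _) init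
  intro φ
  induction φ using Nat.strong_induction_on with
  | _ φ ih =>
    intro h hf hI
    by_cases hb : b.Holds h
    · obtain ⟨t, h', φ', r, hI', ht⟩ := step φ h hf hI hb
      obtain ⟨t', h'', φ'', r', hI'', hb'', ht'⟩ := ih φ' (by omega) h' (hf.trans r.frame) hI'
      exact ⟨_, h'', φ'', .loop_true hb r r', hI'', hb'', by omega⟩
    · exact ⟨_, h, φ, .loop_false hb, hI, hb, by omega⟩

/-- `for x = 0, …, N - 1 do p`. -/
def forUp (x N : Var) (p : Cmd) : Cmd :=
  seq (set x (.const 0)) (loop (.lt (.var x) (.var N)) (seq p (set x (.succ (.var x)))))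

/-- `for x = N - 1, …, 0 do p`. -/
def forDown (x N : Var) (p : Cmd) : Cmd :=
  seq (set x (.var N)) (loop (.lt (.const 0) (.var x)) (seq (set x (.pred (.var x))) p))

theorem forUp_run_amortized {x N : Var} {p : Cmd} (I : ℕ → ℕ → Store → Prop) (T : ℕ)
    {h₀ : Store} {φ₀ : ℕ} (hx : p.modVar x = false) (hN : p.modVar N = false) (hxN : N ≠ x)
    (stable : ∀ k φ h c, I k φ h → I k φ (h.setVar x c))
    (init : I 0 φ₀ h₀)
    (step : ∀ k φ h, k < h₀.reg N → h.reg x = k → Frame (forUp x N p) h₀ h → I k φ h →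
      ∃ t h' φ', p.Run h t h' ∧ I (k + 1) φ' h' ∧ t + φ' ≤ T + φ) :
    ∃ t h' φ', (forUp x N p).Run h₀ t h' ∧ I (h₀.reg N) φ' h' ∧
      t + φ' ≤ φ₀ + (T + 6) * h₀.reg N + 5 := by
  let J : ℕ → Store → Prop := fun ψ h => ∃ k φ, k ≤ h₀.reg N ∧ h.reg x = k ∧ I k φ h ∧
    ψ = φ + (T + 6) * (h₀.reg N - k)
  have key := loop_run (b := .lt (.var x) (.var N)) (p := seq p (set x (.succ (.var x)))) J
    (h₀ := h₀.setVar x 0) (φ₀ := φ₀ + (T + 6) * h₀.reg N) ?_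
    ⟨0, φ₀, Nat.zero_le _, by simp, stable _ _ _ _ init, by simp⟩
  · obtain ⟨t, h', ψ, r, ⟨k, φ, hk, hxk, hI, hψ⟩, hb, ht⟩ := key
    have hfr : h'.reg N = h₀.reg N := by
      have := r.frame.reg N (by simp [modVar, hN, hxN.symm])
      simpa [hxN] using this
    have hkN : k = h₀.reg N := by
      simp only [Cond.Holds, Expr.eval, hxk, hfr] at hb
      omega
    subst hkN
    refine ⟨_, h', φ, .seq (.set _ _ _) r, hI, ?_⟩
    simp only [Cond.size, Expr.size] at ht ⊢
    omega
  · rintro ψ h hf ⟨k, φ, hk, hxk, hI, rfl⟩ hb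
    have hfr : h.reg N = h₀.reg N := by
      have := hf.reg N (by simp [modVar, hN, hxN.symm])
      simpa [hxN] using this
    have hkN : k < h₀.reg N := by simpa [Cond.Holds, Expr.eval, hxk, hfr] using hb
    have hf' : Frame (forUp x N p) h₀ h := by
      refine Frame.trans (h₂ := h₀.setVar x 0) ?_ (hf.mono ?_ ?_)
      · refine ⟨fun y hy => ?_, fun _ _ => rfl⟩
        have : y ≠ x := fun e => by simp [forUp, modVar, e] at hy
        simp [this]
      · simp +contextual [forUp, modVar]
      · simp +contextual [forUp, modArr]
    obtain ⟨t, h', φ', r, hI', ht⟩ := step k φ h hkN hxk hf' hI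
    refine ⟨_, _, φ' + (T + 6) * (h₀.reg N - (k + 1)), .seq r (.set _ _ _),
      ⟨k + 1, φ', hkN, ?_, stable _ _ _ _ hI', rfl⟩, ?_⟩
    · simp [Expr.eval, r.frame.reg x hx, hxk]
    · obtain ⟨d, hd⟩ := Nat.exists_eq_add_of_lt hkN
      have e1 : h₀.reg N - k = d + 1 := by omega
      have e2 : h₀.reg N - (k + 1) = d := by omega
      rw [e1, e2, Nat.mul_succ]
      simp only [Cond.size, Expr.size]
      omega

theorem forUp_run {x N : Var} {p : Cmd} (I : ℕ → Store → Prop)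
    {h₀ : Store} (hp : p.flat = true) (hx : p.modVar x = false) (hN : p.modVar N = false)
    (hxN : N ≠ x) (stable : ∀ k h c, I k h → I k (h.setVar x c))
    (init : I 0 h₀)
    (step : ∀ k h, k < h₀.reg N → h.reg x = k → Frame (forUp x N p) h₀ h → I k h →
      I (k + 1) (p.den h)) :
    ∃ t h', (forUp x N p).Run h₀ t h' ∧ I (h₀.reg N) h' ∧ t ≤ (p.time + 6) * h₀.reg N + 5 := by
  obtain ⟨t, h', φ', r, hI, ht⟩ := forUp_run_amortized (x := x) (N := N) (p := p)
    (fun k _ h => I k h) p.time (h₀ := h₀) (φ₀ := 0) hx hN hxN (fun k _ h c => stable k h c) init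
    (fun k φ h hk hxk hf hI => by
      obtain ⟨t, r, ht⟩ := p.run_den hp h
      exact ⟨t, _, 0, r, step k h hk hxk hf hI, by omega⟩)
  exact ⟨t, h', r, hI, by omega⟩

theorem forDown_run_amortized {x N : Var} {p : Cmd} (I : ℕ → ℕ → Store → Prop) (T : ℕ)
    {h₀ : Store} {φ₀ : ℕ} (hx : p.modVar x = false)
    (stable : ∀ k φ h c, I k φ h → I k φ (h.setVar x c))
    (init : I (h₀.reg N) φ₀ h₀)
    (step : ∀ k φ h, k < h₀.reg N → h.reg x = k → Frame (forDown x N p) h₀ h → I (k + 1) φ h →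
      ∃ t h' φ', p.Run h t h' ∧ I k φ' h' ∧ t + φ' ≤ T + φ) :
    ∃ t h' φ', (forDown x N p).Run h₀ t h' ∧ I 0 φ' h' ∧
      t + φ' ≤ φ₀ + (T + 6) * h₀.reg N + 5 := by
  let J : ℕ → Store → Prop := fun ψ h => ∃ k φ, k ≤ h₀.reg N ∧ h.reg x = k ∧ I k φ h ∧
    ψ = φ + (T + 6) * k
  have key := loop_run (b := .lt (.const 0) (.var x)) (p := seq (set x (.pred (.var x))) p) J
    (h₀ := h₀.setVar x (h₀.reg N)) (φ₀ := φ₀ + (T + 6) * h₀.reg N) ?_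
    ⟨_, φ₀, le_rfl, by simp, stable _ _ _ _ init, rfl⟩
  · obtain ⟨t, h', ψ, r, ⟨k, φ, hk, hxk, hI, hψ⟩, hb, ht⟩ := key
    have hk0 : k = 0 := by
      simp only [Cond.Holds, Expr.eval, hxk] at hb
      omega
    subst hk0
    refine ⟨_, h', φ, .seq (.set _ _ _) r, hI, ?_⟩
    simp only [Cond.size, Expr.size] at ht ⊢
    omega
  · rintro ψ h hf ⟨k, φ, hk, hxk, hI, rfl⟩ hb
    simp only [Cond.Holds, Expr.eval, hxk] at hb
    obtain ⟨k, rfl⟩ : ∃ l, k = l + 1 := ⟨k - 1, by omega⟩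
    have hf' : Frame (forDown x N p) h₀ (h.setVar x k) := by
      refine Frame.trans (h₂ := h) (Frame.trans (h₂ := h₀.setVar x (h₀.reg N)) ?_ (hf.mono ?_ ?_)) ?_
      · refine ⟨fun y hy => ?_, fun _ _ => rfl⟩
        have : y ≠ x := fun e => by simp [forDown, modVar, e] at hy
        simp [this]
      · simp +contextual [forDown, modVar]
      · simp +contextual [forDown, modArr]
      · refine ⟨fun y hy => ?_, fun _ _ => rfl⟩
        have : y ≠ x := fun e => by simp [forDown, modVar, e] at hy
        simp [this]
    obtain ⟨t, h', φ', r, hI', ht⟩ :=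
      step k φ (h.setVar x k) (by omega) (by simp) hf' (stable _ _ _ _ hI)
    have r0 : (set x (.pred (.var x))).Run h _ _ := .set x (.pred (.var x)) h
    simp only [Expr.eval, hxk, Nat.add_sub_cancel] at r0
    refine ⟨_, _, φ' + (T + 6) * k, .seq r0 r,
      ⟨k, φ', by omega, ?_, hI', rfl⟩, ?_⟩
    · simp [r.frame.reg x hx]
    · rw [Nat.mul_succ]
      simp only [Cond.size, Expr.size]
      omega

theorem forDown_run {x N : Var} {p : Cmd} (I : ℕ → Store → Prop)
    {h₀ : Store} (hp : p.flat = true) (hx : p.modVar x = false)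
    (stable : ∀ k h c, I k h → I k (h.setVar x c))
    (init : I (h₀.reg N) h₀)
    (step : ∀ k h, k < h₀.reg N → h.reg x = k → Frame (forDown x N p) h₀ h → I (k + 1) h →
      I k (p.den h)) :
    ∃ t h', (forDown x N p).Run h₀ t h' ∧ I 0 h' ∧ t ≤ (p.time + 6) * h₀.reg N + 5 := by
  obtain ⟨t, h', φ', r, hI, ht⟩ := forDown_run_amortized (x := x) (N := N) (p := p)
    (fun k _ h => I k h) p.time (h₀ := h₀) (φ₀ := 0) hx (fun k _ h c => stable k h c) init
    (fun k φ h hk hxk hf hI => by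
      obtain ⟨t, r, ht⟩ := p.run_den hp h
      exact ⟨t, _, 0, r, step k h hk hxk hf hI, by omega⟩)
  exact ⟨t, h', r, hI, by omega⟩

end Cmd

/-! ### Linked lists -/

/-- The pointer `c` starts the linked list `l`: list members are stored with offset one, `0` ends
the list, and the cell `next k` holds the pointer that follows the member `k`. -/
def IsChain (next : ℕ → ℕ) : ℕ → List ℕ → Prop
  | c, [] => c = 0
  | c, k :: l => c = k + 1 ∧ IsChain next (next k) l

theorem IsChain.congr {f g : ℕ → ℕ} {l : List ℕ} {c : ℕ} (h : IsChain f c l)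
    (hfg : ∀ k ∈ l, f k = g k) : IsChain g c l := by
  induction l generalizing c with
  | nil => exact h
  | cons k l ih =>
    refine ⟨h.1, ?_⟩
    rw [← hfg k (by simp)]
    exact ih h.2 fun x hx => hfg x (by simp [hx])

namespace Cmd

/-- Execute `p` for every member `i` of the linked list that starts at `e`; the variable `j` is
the running pointer. -/
def walk (i j : Var) (e : Expr) (next : Arr) (p : Cmd) : Cmd :=
  seq (set j e) (loop (.lt (.const 0) (.var j))
    (seq (set i (.pred (.var j))) (seq p (set j (.get next (.var i))))))

theorem walk_run {i j : Var} {e : Expr} {next : Arr} {p : Cmd} (I : List ℕ → Store → Prop)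
    {h₀ : Store} {l₀ : List ℕ} (hp : p.flat = true) (hi : p.modVar i = false)
    (hnext : p.modArr next = false)
    (stable : ∀ k h c, I k h → I k (h.setVar i c) ∧ I k (h.setVar j c))
    (hl : IsChain (h₀.arr next) (e.eval h₀) l₀)
    (init : I l₀ h₀)
    (step : ∀ k l h, h.reg i = k → Frame (walk i j e next p) h₀ h → k :: l <:+ l₀ →
      I (k :: l) h → I l (p.den h)) :
    ∃ t h', (walk i j e next p).Run h₀ t h' ∧ I [] h' ∧
      t ≤ (p.time + 9) * l₀.length + (e.size + 5) := by
  let J : ℕ → Store → Prop := fun ψ h => ∃ l, IsChain (h₀.arr next) (h.reg j) l ∧ I l h ∧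
    l <:+ l₀ ∧ ψ = (p.time + 9) * l.length
  have key := loop_run (b := .lt (.const 0) (.var j))
    (p := seq (set i (.pred (.var j))) (seq p (set j (.get next (.var i))))) J
    (h₀ := h₀.setVar j (e.eval h₀)) (φ₀ := (p.time + 9) * l₀.length) ?_
    ⟨l₀, by simpa using hl, (stable _ _ _ init).2, List.suffix_rfl, rfl⟩
  · obtain ⟨t, h', ψ, r, ⟨l, hl', hI, -, hψ⟩, hb, ht⟩ := key
    have : l = [] := by
      cases l with
      | nil => rfl
      | cons k l =>
        have := hl'.1
        simp [Cond.Holds, Expr.eval, this] at hb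
    subst this
    refine ⟨_, h', .seq (.set _ _ _) r, hI, ?_⟩
    simp only [Cond.size, Expr.size] at ht ⊢
    omega
  · rintro ψ h hf ⟨l, hl', hI, hsuf, rfl⟩ hb
    simp only [Cond.Holds, Expr.eval] at hb
    cases l with
    | nil => have : h.reg j = 0 := hl'; omega
    | cons k l =>
      obtain ⟨hj, hl''⟩ := hl'
      have hf' : Frame (walk i j e next p) h₀ (h.setVar i k) := by
        refine Frame.trans (h₂ := h) (Frame.trans (h₂ := h₀.setVar j (e.eval h₀)) ?_
          (hf.mono ?_ ?_)) ?_
        · refine ⟨fun y hy => ?_, fun _ _ => rfl⟩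
          have : y ≠ j := fun e => by simp [walk, modVar, e] at hy
          simp [this]
        · simp +contextual [walk, modVar]
        · simp +contextual [walk, modArr]
        · refine ⟨fun y hy => ?_, fun _ _ => rfl⟩
          have : y ≠ i := fun e => by simp [walk, modVar, e] at hy
          simp [this]
      have hI' := step k l (h.setVar i k) (by simp) hf' hsuf (stable _ _ _ hI).1
      obtain ⟨t, r, ht⟩ := p.run_den hp (h.setVar i k)
      have r0 : (set i (.pred (.var j))).Run h _ _ := .set i (.pred (.var j)) h
      simp only [Expr.eval, hj, Nat.add_sub_cancel] at r0
      refine ⟨_, _, (p.time + 9) * l.length, .seq r0 (.seq r (.set _ _ _)),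
        ⟨l, ?_, (stable _ _ _ hI').2, (List.suffix_cons k l).trans hsuf, rfl⟩, ?_⟩
      · have e1 : (p.den (h.setVar i k)).reg i = k := by
          rw [r.frame.reg i hi]; simp
        have e2 : (p.den (h.setVar i k)).arr next = h₀.arr next := by
          rw [r.frame.arr next hnext]
          simpa using hf.arr next (by simp [modArr, hnext])
        simpa [Expr.eval, e1, e2] using hl''
      · rw [List.length_cons, Nat.mul_succ]
        simp only [Cond.size, Expr.size]
        omega

/-- Sort the indices below `N` into one linked list for every value of `key`. -/
def buildLists (key head next : Arr) (N : Var) : Cmd :=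
  forUp .i N (seq (put next (.var .i) (.get head (.get key (.var .i))))
    (put head (.get key (.var .i)) (.succ (.var .i))))

end Cmd

/-- The indices below `N` with the key `x`, in decreasing order. -/
def bucket (key : ℕ → ℕ) : ℕ → ℕ → List ℕ
  | 0, _ => []
  | N + 1, x => if key N = x then N :: bucket key N x else bucket key N x

theorem mem_bucket {key : ℕ → ℕ} {N x i : ℕ} : i ∈ bucket key N x ↔ i < N ∧ key i = x := by
  induction N with
  | zero => simp [bucket]
  | succ N ih =>
    by_cases h : key N = x
    · simp only [bucket, if_pos h, List.mem_cons, ih]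
      constructor
      · rintro (rfl | h') <;> [exact ⟨by omega, h⟩; exact ⟨by omega, h'.2⟩]
      · rintro ⟨h1, h2⟩
        by_cases e : i = N <;> [exact .inl e; exact .inr ⟨by omega, h2⟩]
    · simp only [bucket, if_neg h, ih]
      constructor
      · exact fun h' => ⟨by omega, h'.2⟩
      · rintro ⟨h1, h2⟩
        refine ⟨?_, h2⟩
        rcases Nat.lt_succ_iff_lt_or_eq.1 h1 with h1 | rfl <;> [exact h1; exact absurd h2 h]

theorem sum_bucket (key f : ℕ → ℕ) (N x : ℕ) :
    ((bucket key N x).map f).sum = ∑ i ∈ (Finset.range N).filter (fun i => key i = x), f i := by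
  induction N with
  | zero => simp [bucket]
  | succ N ih =>
    rw [Finset.range_add_one, Finset.filter_insert]
    by_cases h : key N = x
    · simp [bucket, h, ih]
    · simp [bucket, h, ih]

theorem sum_length_bucket {key : ℕ → ℕ} {N n : ℕ} (hkey : ∀ i < N, key i < n) :
    ∑ x ∈ Finset.range n, (bucket key N x).length = N := by
  have h1 : ∀ x, (bucket key N x).length
      = ((Finset.range N).filter (fun i => key i = x)).card := by
    intro x
    have := sum_bucket key (fun _ => 1) N x
    simpa using this
  simp only [h1]
  rw [← Finset.card_eq_sum_card_fiberwise (f := key) (t := Finset.range n)]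
  · simp
  · intro i hi
    simpa using hkey i (by simpa using hi)

theorem Cmd.buildLists_run {key head next : Arr} {N : Var} (h1 : key ≠ head) (h2 : key ≠ next)
    (h3 : head ≠ next) (hN : N ≠ .i) (h₀ : Store) (hz : h₀.arr head = fun _ => 0) :
    ∃ t h', (buildLists key head next N).Run h₀ t h' ∧
      (∀ x, IsChain (h'.arr next) (h'.arr head x) (bucket (h₀.arr key) (h₀.reg N) x)) ∧
      t ≤ 16 * h₀.reg N + 5 := by
  have := forUp_run (x := .i) (N := N) (p := seq (put next (.var .i) (.get head (.get key (.var .i))))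
    (put head (.get key (.var .i)) (.succ (.var .i))))
    (fun k h => ∀ x, IsChain (h.arr next) (h.arr head x) (bucket (h₀.arr key) k x)) (h₀ := h₀)
    rfl rfl rfl hN (fun k h c => by simp) (by simp [hz, bucket, IsChain]) ?_
  · simpa [time, Expr.size, buildLists] using this
  · intro k h hk hxk hf hI x
    have hkey : h.arr key = h₀.arr key := by
      exact hf.arr key (by simp [forUp, modArr, h1.symm, h2.symm])
    simp only [den, Expr.eval, Store.setCell_arr, hxk, hkey, Store.setCell_reg, h2, h3,
      h3.symm, if_true, if_false]
    have hc : ∀ x, IsChain (Function.update (h.arr next) k (h.arr head (h₀.arr key k)))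
        (h.arr head x) (bucket (h₀.arr key) k x) := by
      intro x
      refine (hI x).congr fun i hi => ?_
      rw [Function.update_of_ne]
      have := (mem_bucket.1 hi).1
      omega
    by_cases hx : h₀.arr key k = x
    · simp only [bucket, hx, if_true, Function.update_self]
      refine ⟨rfl, ?_⟩
      have := hc x
      rw [hx] at this
      simpa using this
    · simp only [bucket, hx, if_false]
      rw [Function.update_of_ne (Ne.symm hx)]
      exact hc x

/-! ### Ancestors in a tree that is given by a parent function -/

/-- `u` is an ancestor of `w` (or equal to it) for the parent function `par`; the root is its own
parent. -/
def Anc (par : ℕ → ℕ) (u w : ℕ) : Prop := ∃ k, par^[k] w = u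

noncomputable instance (par : ℕ → ℕ) (u w : ℕ) : Decidable (Anc par u w) := Classical.dec _

theorem Anc.refl (par : ℕ → ℕ) (u : ℕ) : Anc par u u := ⟨0, rfl⟩

theorem anc_iff {par : ℕ → ℕ} {u w : ℕ} : Anc par u w ↔ u = w ∨ Anc par u (par w) := by
  constructor
  · rintro ⟨k, hk⟩
    cases k with
    | zero => exact .inl hk.symm
    | succ k => exact .inr ⟨k, by rwa [Function.iterate_succ_apply] at hk⟩
  · rintro (rfl | ⟨k, hk⟩)
    · exact Anc.refl _ _
    · exact ⟨k + 1, by rwa [Function.iterate_succ_apply]⟩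

theorem Anc.of_par {par : ℕ → ℕ} {u w : ℕ} (h : Anc par u (par w)) : Anc par u w :=
  anc_iff.2 (.inr h)

theorem Anc.trans {par : ℕ → ℕ} {u v w : ℕ} (h1 : Anc par u v) (h2 : Anc par v w) :
    Anc par u w := by
  obtain ⟨k, rfl⟩ := h1
  obtain ⟨l, rfl⟩ := h2
  exact ⟨k + l, by rw [Function.iterate_add_apply]⟩

theorem Anc.total {par : ℕ → ℕ} {u v w : ℕ} (h1 : Anc par u w) (h2 : Anc par v w) :
    Anc par u v ∨ Anc par v u := by
  obtain ⟨k, rfl⟩ := h1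
  obtain ⟨l, rfl⟩ := h2
  rcases le_total k l with h | h
  · obtain ⟨d, rfl⟩ := Nat.exists_eq_add_of_le' h
    exact .inr ⟨d, by rw [Function.iterate_add_apply]⟩
  · obtain ⟨d, rfl⟩ := Nat.exists_eq_add_of_le' h
    exact .inl ⟨d, by rw [Function.iterate_add_apply]⟩

/-- `par` is a parent function on the labels below `c`: the root is `0`, and the parent of every
other label is smaller than the label. -/
structure IsParent (par : ℕ → ℕ) (c : ℕ) : Prop where
  zero : par 0 = 0
  lt : ∀ k, 0 < k → k < c → par k < k

theorem IsParent.le {par : ℕ → ℕ} {c k : ℕ} (hp : IsParent par c) (hk : k < c) : par k ≤ k := by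
  rcases Nat.eq_zero_or_pos k with rfl | h
  · exact hp.zero.le
  · exact (hp.lt k h hk).le

theorem IsParent.iterate_le {par : ℕ → ℕ} {c k : ℕ} (hp : IsParent par c) (hk : k < c) (j : ℕ) :
    par^[j] k ≤ k := by
  induction j with
  | zero => exact le_rfl
  | succ j ih =>
    rw [Function.iterate_succ_apply']
    exact (hp.le (ih.trans_lt hk)).trans ih

theorem IsParent.anc_le {par : ℕ → ℕ} {c u w : ℕ} (hp : IsParent par c) (hw : w < c)
    (h : Anc par u w) : u ≤ w := by
  obtain ⟨k, rfl⟩ := h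
  exact hp.iterate_le hw k

theorem Anc.par_of_ne {par : ℕ → ℕ} {u w : ℕ} (h : Anc par u w)
    (hne : u ≠ w) : Anc par u (par w) :=
  (anc_iff.1 h).resolve_left hne

theorem IsParent.anc_congr {par par' : ℕ → ℕ} {c u w : ℕ} (hp : IsParent par c)
    (h : ∀ x < c, par' x = par x) (hw : w < c) : Anc par' u w ↔ Anc par u w := by
  have key : ∀ k, par'^[k] w = par^[k] w := by
    intro k
    induction k with
    | zero => rfl
    | succ k ih =>
      rw [Function.iterate_succ_apply', Function.iterate_succ_apply', ih,
        h _ ((hp.iterate_le hw k).trans_lt hw)]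
  simp only [Anc, key]

/-! ### Depth-first search -/

/-- The state of a depth-first search. The visited vertices are labelled `0, …, c - 1` in the order
of their discovery: `pos x` is one more than the label of `x`, and `0` if `x` has not been visited;
`ord` maps labels to vertices, and `par` labels to the labels of their parents. The label `l` is
the current one, so that the open vertices are its ancestors; `rem x` lists the arcs from `x` that
have not been scanned. -/
structure DfsInv (n N : ℕ) (src dst pos ord par : ℕ → ℕ) (rem : ℕ → List ℕ) (c l : ℕ) : Prop where
  l_lt : l < c
  c_le : c ≤ n
  ord_lt : ∀ k < c, ord k < n
  pos_ord : ∀ k < c, pos (ord k) = k + 1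
  pos_le : ∀ w < n, pos w ≤ c
  ord_pos : ∀ w < n, pos w ≠ 0 → ord (pos w - 1) = w
  parent : IsParent par c
  par_arc : ∀ k, 0 < k → k < c → ∃ a < N, src a = ord (par k) ∧ dst a = ord k
  pos_zero : pos 0 ≠ 0
  mem_rem : ∀ x, ∀ a ∈ rem x, a < N ∧ src a = x
  scanned : ∀ a < N, a ∈ rem (src a) ∨ pos (dst a) ≠ 0
  closed : ∀ k < c, ¬ Anc par k l → rem (ord k) = []
  anc : ∀ a < N, pos (src a) ≠ 0 → pos (dst a) ≠ 0 →
    Anc par (pos (src a) - 1) (pos (dst a) - 1) ∨ Anc par (pos (dst a) - 1) (pos (src a) - 1)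
  open_anc : ∀ u w, Anc par u l → u ≤ w → w < c → Anc par u w
  interval : ∀ u w x, x < c → Anc par u x → u ≤ w → w ≤ x → Anc par u w

/-- The outcome of a depth-first search: a labelling of the vertices and a spanning tree such that
all arcs connect ancestors with descendants and such that the descendants of a label form an
interval. -/
structure DfsTree (n N : ℕ) (src dst pos ord par : ℕ → ℕ) : Prop where
  ord_lt : ∀ k < n, ord k < n
  pos_ord : ∀ k < n, pos (ord k) = k + 1
  pos_le : ∀ w < n, pos w ≤ n
  pos_ne : ∀ w < n, pos w ≠ 0
  ord_pos : ∀ w < n, ord (pos w - 1) = w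
  parent : IsParent par n
  par_arc : ∀ k, 0 < k → k < n → ∃ a < N, src a = ord (par k) ∧ dst a = ord k
  anc : ∀ a < N, Anc par (pos (src a) - 1) (pos (dst a) - 1) ∨
    Anc par (pos (dst a) - 1) (pos (src a) - 1)
  interval : ∀ u w x, x < n → Anc par u x → u ≤ w → w ≤ x → Anc par u w

namespace DfsInv

variable {n N : ℕ} {src dst pos ord par : ℕ → ℕ} {rem : ℕ → List ℕ} {c l : ℕ}

theorem backtrack (H : DfsInv n N src dst pos ord par rem c l) (h0 : rem (ord l) = []) :
    DfsInv n N src dst pos ord par rem c (par l) := by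
  refine { H with l_lt := (H.parent.le H.l_lt).trans_lt H.l_lt, closed := fun k hk h => ?_,
                  open_anc := fun u w h => H.open_anc u w h.of_par }
  by_cases e : k = l
  · rw [e, h0]
  · exact H.closed k hk fun h' => h ((anc_iff.1 h').resolve_left e)

theorem scan (H : DfsInv n N src dst pos ord par rem c l) {x a : ℕ} {t : List ℕ}
    (hx : rem x = a :: t) (ha : pos (dst a) ≠ 0) :
    DfsInv n N src dst pos ord par (Function.update rem x t) c l := by
  refine { H with mem_rem := fun y b hb => ?_, scanned := fun b hb => ?_,
                  closed := fun k hk h => ?_ }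
  · by_cases e : y = x
    · subst e
      rw [Function.update_self] at hb
      exact H.mem_rem y b (by simp [hx, hb])
    · rw [Function.update_of_ne e] at hb
      exact H.mem_rem y b hb
  · by_cases e : b = a
    · exact .inr (e ▸ ha)
    · refine (H.scanned b hb).imp_left fun h => ?_
      by_cases e' : src b = x
      · rw [e', hx] at h
        rw [e', Function.update_self]
        exact (List.mem_cons.1 h).resolve_left e
      · rwa [Function.update_of_ne e']
  · have := H.closed k hk h
    by_cases e : ord k = x
    · rw [e, hx] at this
      cases this
    · rwa [Function.update_of_ne e]

theorem count_lt (H : DfsInv n N src dst pos ord par rem c l) {w : ℕ} (hw : w < n)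
    (h0 : pos w = 0) : c < n := by
  have h1 : ((Finset.range c).image ord).card = c := by
    rw [Finset.card_image_of_injOn, Finset.card_range]
    intro x hx y hy hxy
    have e1 := H.pos_ord x (by simpa using hx)
    have e2 := H.pos_ord y (by simpa using hy)
    simp only [hxy] at e1
    omega
  have h2 : (Finset.range c).image ord ⊆ (Finset.range n).erase w := by
    intro x hx
    obtain ⟨k, hk, rfl⟩ := Finset.mem_image.1 hx
    rw [Finset.mem_range] at hk
    refine Finset.mem_erase.2 ⟨fun e => ?_, Finset.mem_range.2 (H.ord_lt k hk)⟩
    have := H.pos_ord k hk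
    rw [e] at this
    omega
  have h3 := Finset.card_le_card h2
  rw [h1, Finset.card_erase_of_mem (Finset.mem_range.2 hw), Finset.card_range] at h3
  omega

theorem visit (H : DfsInv n N src dst pos ord par rem c l)
    (sym : ∀ a < N, ∃ b < N, src b = dst a ∧ dst b = src a) (hsrc : ∀ a < N, src a < n)
    {a : ℕ} (ha : a < N) (hs : src a = ord l) (hw : pos (dst a) = 0) (hwn : dst a < n) :
    DfsInv n N src dst (Function.update pos (dst a) (c + 1)) (Function.update ord c (dst a))
      (Function.update par c l) rem (c + 1) c := by
  set w := dst a with hwdef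
  have hlc := H.l_lt
  have hcn : c < n := H.count_lt hwn hw
  have hparc : ∀ x < c, Function.update par c l x = par x := fun x hx =>
    Function.update_of_ne (by omega) _ _
  have hordc : ∀ x < c, Function.update ord c w x = ord x := fun x hx =>
    Function.update_of_ne (by omega) _ _
  have hA : ∀ {u x}, x < c → (Anc (Function.update par c l) u x ↔ Anc par u x) :=
    fun hx => H.parent.anc_congr hparc hx
  have hAc : ∀ {u}, Anc (Function.update par c l) u c ↔ u = c ∨ Anc par u l := by
    intro u
    rw [anc_iff, Function.update_self, hA hlc]
  have hordw : ∀ k < c, ord k ≠ w := fun k hk e => by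
    have := H.pos_ord k hk
    rw [e] at this
    omega
  have hposc : ∀ x < n, pos x ≠ 0 → pos x - 1 < c := fun x hx h => by
    have := H.pos_le x hx
    omega
  -- a visited neighbour of the new vertex has an arc that has not been scanned, so it is open
  have hnew : ∀ b < N, dst b = w → pos (src b) ≠ 0 → Anc par (pos (src b) - 1) l := by
    intro b hb hbw hbs
    by_contra hno
    have h1 := H.closed _ (hposc _ (hsrc b hb) hbs) hno
    rw [H.ord_pos _ (hsrc b hb) hbs] at h1
    rcases H.scanned b hb with h2 | h2
    · rw [h1] at h2
      cases h2
    · exact h2 (hbw ▸ hw)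
  refine { l_lt := by omega, c_le := by omega, ord_lt := fun k hk => ?_, pos_ord := fun k hk => ?_,
           pos_le := fun x hx => ?_, ord_pos := fun x hx h => ?_, parent := ⟨?_, fun k hk hk' => ?_⟩,
           par_arc := fun k hk hk' => ?_, pos_zero := ?_, mem_rem := H.mem_rem,
           scanned := fun b hb => ?_, closed := fun k hk h => ?_, anc := fun b hb h1 h2 => ?_,
           open_anc := fun u x h1 h2 h3 => ?_, interval := fun u x y h1 h2 h3 h4 => ?_ }
  · rcases Nat.lt_succ_iff_lt_or_eq.1 hk with hk | rfl
    · rw [hordc k hk]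
      exact H.ord_lt k hk
    · rwa [Function.update_self]
  · rcases Nat.lt_succ_iff_lt_or_eq.1 hk with hk | rfl
    · rw [hordc k hk, Function.update_of_ne (hordw k hk)]
      exact H.pos_ord k hk
    · rw [Function.update_self, Function.update_self]
  · by_cases e : x = w
    · rw [e, Function.update_self]
    · rw [Function.update_of_ne e]
      have := H.pos_le x hx
      omega
  · by_cases e : x = w
    · rw [e, Function.update_self, Nat.add_sub_cancel, Function.update_self]
    · rw [Function.update_of_ne e] at h ⊢
      rw [hordc _ (hposc x hx h)]
      exact H.ord_pos x hx h
  · rw [hparc 0 (by omega)]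
    exact H.parent.zero
  · rcases Nat.lt_succ_iff_lt_or_eq.1 hk' with hk' | rfl
    · rw [hparc k hk']
      exact H.parent.lt k hk hk'
    · rwa [Function.update_self]
  · rcases Nat.lt_succ_iff_lt_or_eq.1 hk' with hk' | rfl
    · rw [hparc k hk', hordc k hk', hordc _ ((H.parent.le hk').trans_lt hk')]
      exact H.par_arc k hk hk'
    · exact ⟨a, ha, by rw [Function.update_self, hordc l hlc, hs], by rw [Function.update_self]⟩
  · by_cases e : 0 = w
    · rw [← e, Function.update_self]
      omega
    · rw [Function.update_of_ne e]
      exact H.pos_zero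
  · refine (H.scanned b hb).imp_right fun h => ?_
    by_cases e : dst b = w
    · rw [e, Function.update_self]
      omega
    · rwa [Function.update_of_ne e]
  · rcases Nat.lt_succ_iff_lt_or_eq.1 hk with hk | rfl
    · rw [hordc k hk]
      exact H.closed k hk fun h' => h (hAc.2 (.inr h'))
    · exact absurd (Anc.refl _ _) h
  · obtain ⟨b', hb', e1, e2⟩ := sym b hb
    have hdn : dst b < n := e1 ▸ hsrc b' hb'
    by_cases es : src b = w
    · by_cases ed : dst b = w
      · rw [es, ed]
        exact .inl (Anc.refl _ _)
      · rw [Function.update_of_ne ed] at h2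
        rw [es, Function.update_self, Function.update_of_ne ed, Nat.add_sub_cancel]
        refine .inr (hAc.2 (.inr ?_))
        rw [← e1]
        exact hnew b' hb' (e2.trans es) (by rwa [e1])
    · rw [Function.update_of_ne es] at h1 ⊢
      by_cases ed : dst b = w
      · rw [ed, Function.update_self, Nat.add_sub_cancel]
        exact .inl (hAc.2 (.inr (hnew b hb ed h1)))
      · rw [Function.update_of_ne ed] at h2 ⊢
        rw [hA (hposc _ hdn h2), hA (hposc _ (hsrc b hb) h1)]
        exact H.anc b hb h1 h2
  · rcases Nat.lt_succ_iff_lt_or_eq.1 h3 with h3 | rfl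
    · rw [hA h3]
      rcases hAc.1 h1 with rfl | h1
      · omega
      · exact H.open_anc u x h1 h2 h3
    · exact h1
  · rcases Nat.lt_succ_iff_lt_or_eq.1 h1 with h1 | rfl
    · rw [hA (by omega)]
      exact H.interval u x y h1 ((hA h1).1 h2) h3 h4
    · rcases Nat.lt_or_eq_of_le h4 with h4 | rfl
      · rw [hA h4]
        rcases hAc.1 h2 with rfl | h2
        · omega
        · exact H.open_anc u x h2 h3 h4
      · exact h2

/-- When the root has been scanned completely, every vertex has been visited: the visited vertices
are closed under adjacency. -/
theorem finish (H : DfsInv n N src dst pos ord par rem c 0)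
    (hsrc : ∀ a < N, src a < n) (h0 : rem (ord 0) = [])
    (conn : ∀ S : ℕ → Prop, S 0 → (∀ a < N, S (src a) → S (dst a)) → ∀ w < n, S w) :
    DfsTree n N src dst pos ord par := by
  have hall : ∀ w < n, pos w ≠ 0 := by
    refine conn _ H.pos_zero fun a ha hs => (H.scanned a ha).resolve_left fun h => ?_
    have hlt : pos (src a) - 1 < c := by
      have := H.pos_le _ (hsrc a ha)
      omega
    have hnil : rem (ord (pos (src a) - 1)) = [] := by
      by_cases e : pos (src a) - 1 = 0
      · rw [e, h0]
      · refine H.closed _ hlt fun h' => e ?_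
        exact Nat.le_zero.1 (H.parent.anc_le H.l_lt h')
    rw [H.ord_pos _ (hsrc a ha) hs] at hnil
    rw [hnil] at h
    cases h
  have hc : c = n := by
    have h1 : ((Finset.range n).image pos).card = n := by
      rw [Finset.card_image_of_injOn, Finset.card_range]
      intro x hx y hy hxy
      have hx' : x < n := by simpa using hx
      have hy' : y < n := by simpa using hy
      have e1 := H.ord_pos x hx' (hall x hx')
      have e2 := H.ord_pos y hy' (hall y hy')
      rw [← e1, ← e2, hxy]
    have h2 : (Finset.range n).image pos ⊆ Finset.Icc 1 c := by
      intro y hy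
      obtain ⟨x, hx, rfl⟩ := Finset.mem_image.1 hy
      rw [Finset.mem_range] at hx
      exact Finset.mem_Icc.2 ⟨Nat.one_le_iff_ne_zero.2 (hall x hx), H.pos_le x hx⟩
    have h3 := Finset.card_le_card h2
    rw [h1, Nat.card_Icc] at h3
    have := H.c_le
    omega
  subst hc
  have hord : ∀ w < c, ord (pos w - 1) = w := fun w hw => H.ord_pos w hw (hall w hw)
  refine ⟨H.ord_lt, H.pos_ord, H.pos_le, hall, hord, H.parent, H.par_arc, fun a ha => ?_,
    H.interval⟩
  have hd : pos (dst a) ≠ 0 := by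
    rcases H.scanned a ha with h | h
    · have e : ord (pos (src a) - 1) = src a := hord _ (hsrc a ha)
      have hlt : pos (src a) - 1 < c := by
        have := H.pos_le _ (hsrc a ha)
        have := H.l_lt
        omega
      by_cases e0 : pos (src a) - 1 = 0
      · rw [e0] at e
        rw [← e, h0] at h
        cases h
      · have := H.closed _ hlt fun h' => e0 (Nat.le_zero.1 (H.parent.anc_le H.l_lt h'))
        rw [e] at this
        rw [this] at h
        cases h
    · exact h
  exact H.anc a ha (hall _ (hsrc a ha)) hd

end DfsInv

namespace Cmd

/-- One step of the depth-first search: scan the next arc from the current vertex, or go back to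
the parent if there is none. -/
def dfsStep : Cmd :=
  block [set .v (.get .ord (.var .cur)), set .j (.get .head (.var .v)),
    ite (.eq (.var .j) (.const 0))
      (ite (.eq (.var .cur) (.const 0)) (set .go (.const 0)) (set .cur (.get .par (.var .cur))))
      (block [put .head (.var .v) (.get .next (.pred (.var .j))),
        set .w (.get .dst (.pred (.var .j))),
        ite (.eq (.get .pos (.var .w)) (.const 0))
          (block [put .pos (.var .w) (.succ (.var .cnt)), put .ord (.var .cnt) (.var .w),
            put .par (.var .cnt) (.var .cur), set .cur (.var .cnt), set .cnt (.succ (.var .cnt))])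
          skip])]

/-- Depth-first search from the vertex `0`. -/
def dfs : Cmd :=
  block [put .pos (.const 0) (.const 1), set .cnt (.const 1), set .go (.const 1),
    loop (.lt (.const 0) (.var .go)) dfsStep]

end Cmd

theorem sum_update_tail {n x a : ℕ} {t : List ℕ} {rem : ℕ → List ℕ} (hx : x < n)
    (h : rem x = a :: t) :
    ∑ y ∈ Finset.range n, (Function.update rem x t y).length + 1
      = ∑ y ∈ Finset.range n, (rem y).length := by
  have hx' := Finset.mem_range.2 hx
  rw [← Finset.add_sum_erase _ _ hx', ← Finset.add_sum_erase _ _ hx', Function.update_self, h,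
    List.length_cons]
  have : ∑ y ∈ (Finset.range n).erase x, (Function.update rem x t y).length
      = ∑ y ∈ (Finset.range n).erase x, (rem y).length := by
    refine Finset.sum_congr rfl fun y hy => ?_
    rw [Function.update_of_ne (Finset.ne_of_mem_erase hy)]
  omega

/-- The invariant of the search loop. The potential counts the arcs that have not been scanned, the
vertices that have not been visited and the vertices on the path to the root. -/
def DfsLoop (K n N : ℕ) (src dst next : ℕ → ℕ) (φ : ℕ) (h : Store) : Prop :=
  ∃ rem D, DfsInv n N src dst (h.arr .pos) (h.arr .ord) (h.arr .par) rem (h.reg .cnt) (h.reg .cur) ∧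
    (∀ x, IsChain next (h.arr .head x) (rem x)) ∧
    (h.arr .par)^[D] (h.reg .cur) = 0 ∧
    (h.reg .go = 0 → h.reg .cur = 0 ∧ rem (h.arr .ord 0) = []) ∧ h.reg .go ≤ 1 ∧
    φ = K * (∑ x ∈ Finset.range n, (rem x).length + (n - h.reg .cnt) + D + h.reg .go)

theorem dfsLoop_step {K n N : ℕ} {src dst next : ℕ → ℕ}
    (sym : ∀ a < N, ∃ b < N, src b = dst a ∧ dst b = src a) (hsrc : ∀ a < N, src a < n)
    {φ : ℕ} {h : Store} (hnext : h.arr .next = next) (hdst : h.arr .dst = dst)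
    (H : DfsLoop K n N src dst next φ h) (hgo : 0 < h.reg .go) :
    ∃ φ', DfsLoop K n N src dst next φ' (Cmd.dfsStep.den h) ∧ K + φ' ≤ φ := by
  obtain ⟨rem, D, H, hch, hD, -, hgo1, rfl⟩ := H
  have hgo1 : h.reg .go = 1 := by omega
  have hpay : ∀ a b, a + 1 ≤ b → K + K * a ≤ K * b := fun a b hab => by
    calc K + K * a = K * (a + 1) := by ring
      _ ≤ K * b := Nat.mul_le_mul_left _ hab
  have hv := H.ord_lt _ H.l_lt
  have hcv := hch (h.arr .ord (h.reg .cur))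
  cases hr : rem (h.arr .ord (h.reg .cur)) with
  | nil =>
    rw [hr] at hcv
    have h0 : h.arr .head (h.arr .ord (h.reg .cur)) = 0 := hcv
    by_cases hl : h.reg .cur = 0
    · refine ⟨K * (∑ x ∈ Finset.range n, (rem x).length + (n - h.reg .cnt) + D + 0),
        ⟨rem, D, ?_⟩, hpay _ _ (by omega)⟩
      have h0' : h.arr .head (h.arr .ord 0) = 0 := by rwa [hl] at h0
      rw [hl] at H hD hr
      simpa [Cmd.dfsStep, Cmd.block, Cmd.den, Cond.Holds, Expr.eval, hl, h0', hr, hD] using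
        ⟨H, hch⟩
    · obtain ⟨D, rfl⟩ : ∃ E, D = E + 1 := by
        cases D with
        | zero => exact absurd hD hl
        | succ E => exact ⟨E, rfl⟩
      rw [Function.iterate_succ_apply] at hD
      refine ⟨K * (∑ x ∈ Finset.range n, (rem x).length + (n - h.reg .cnt) + D + 1),
        ⟨rem, D, ?_⟩, hpay _ _ (by omega)⟩
      simpa [Cmd.dfsStep, Cmd.block, Cmd.den, Cond.Holds, Expr.eval, hl, h0, hD, hgo1] using
        ⟨H.backtrack hr, hch⟩
  | cons a t =>
    rw [hr] at hcv
    obtain ⟨h0, hcv⟩ := hcv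
    obtain ⟨haN, hsa⟩ := H.mem_rem _ a (by rw [hr]; simp)
    have hdn : dst a < n := by
      obtain ⟨b, hb, e, -⟩ := sym a haN
      exact e ▸ hsrc b hb
    have hsum := sum_update_tail hv hr
    have hch' : ∀ x, IsChain next
        (Function.update (h.arr .head) (h.arr .ord (h.reg .cur)) (next a) x)
        (Function.update rem (h.arr .ord (h.reg .cur)) t x) := by
      intro x
      by_cases e : x = h.arr .ord (h.reg .cur)
      · subst e
        simpa using hcv
      · rw [Function.update_of_ne e, Function.update_of_ne e]
        exact hch x
    by_cases hp : h.arr .pos (dst a) = 0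
    · have hlc := H.l_lt
      have hcn := H.count_lt hdn hp
      have hDn : (Function.update (h.arr .par) (h.reg .cnt) (h.reg .cur))^[D + 1] (h.reg .cnt)
          = 0 := by
        rw [Function.iterate_succ_apply, Function.update_self]
        have : ∀ k, (Function.update (h.arr .par) (h.reg .cnt) (h.reg .cur))^[k] (h.reg .cur)
            = (h.arr .par)^[k] (h.reg .cur) := by
          intro k
          induction k with
          | zero => rfl
          | succ k ih =>
            rw [Function.iterate_succ_apply', Function.iterate_succ_apply', ih,
              Function.update_of_ne ((H.parent.iterate_le hlc k).trans_lt hlc).ne]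
        rw [this, hD]
      refine ⟨K * (∑ x ∈ Finset.range n,
        (Function.update rem (h.arr .ord (h.reg .cur)) t x).length + (n - (h.reg .cnt + 1)) +
          (D + 1) + 1), ⟨Function.update rem (h.arr .ord (h.reg .cur)) t, D + 1, ?_⟩,
          hpay _ _ (by omega)⟩
      have HV := (H.visit sym hsrc haN hsa hp hdn).scan (x := h.arr .ord (h.reg .cur)) hr
        (by rw [Function.update_self]; omega)
      simpa [Cmd.dfsStep, Cmd.block, Cmd.den, Cond.Holds, Expr.eval, h0, hgo1, hnext, hdst, hp,
        -Function.iterate_succ] using ⟨HV, hch', hDn⟩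
    · refine ⟨K * (∑ x ∈ Finset.range n,
        (Function.update rem (h.arr .ord (h.reg .cur)) t x).length + (n - h.reg .cnt) + D + 1),
        ⟨Function.update rem (h.arr .ord (h.reg .cur)) t, D, ?_⟩, hpay _ _ (by omega)⟩
      simpa [Cmd.dfsStep, Cmd.block, Cmd.den, Cond.Holds, Expr.eval, h0, hgo1, hnext, hdst, hp,
        hD] using ⟨H.scan hr hp, hch'⟩

/-- Depth-first search finds a spanning tree in time `O(n + N)`. -/
theorem dfs_run {n N : ℕ} {src dst : ℕ → ℕ} (hn : 0 < n)
    (sym : ∀ a < N, ∃ b < N, src b = dst a ∧ dst b = src a) (hsrc : ∀ a < N, src a < n)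
    (conn : ∀ S : ℕ → Prop, S 0 → (∀ a < N, S (src a) → S (dst a)) → ∀ w < n, S w)
    (h : Store) (hdst : h.arr .dst = dst) (hpos : h.arr .pos = fun _ => 0)
    (hord : h.arr .ord = fun _ => 0) (hpar : h.arr .par = fun _ => 0) (hcur : h.reg .cur = 0)
    (hch : ∀ x, IsChain (h.arr .next) (h.arr .head x) (bucket src N x)) :
    ∃ t h', Cmd.dfs.Run h t h' ∧
      DfsTree n N src dst (h'.arr .pos) (h'.arr .ord) (h'.arr .par) ∧
      t ≤ (Cmd.dfsStep.time + 3) * (N + n) + 10 := by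
  set h₁ := ((h.setCell .pos 0 1).setVar .cnt 1).setVar .go 1 with hh₁
  have r0 : (Cmd.put .pos (.const 0) (.const 1)).Run h _ _ := .put .pos (.const 0) (.const 1) h
  have r1 : (Cmd.set .cnt (.const 1)).Run (h.setCell .pos 0 1) _ _ := .set .cnt (.const 1) _
  have r2 : (Cmd.set .go (.const 1)).Run ((h.setCell .pos 0 1).setVar .cnt 1) _ _ :=
    .set .go (.const 1) _
  have hanc : ∀ u w, Anc (fun _ => 0) u w ↔ u = w ∨ u = 0 := by
    intro u w
    constructor
    · rintro ⟨k, rfl⟩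
      cases k with
      | zero => exact .inl rfl
      | succ k =>
        right
        rw [Function.iterate_succ_apply']
    · rintro (rfl | rfl)
      · exact Anc.refl _ _
      · exact ⟨1, rfl⟩
  have hupd : ∀ w, Function.update (fun _ => 0) 0 1 w ≠ 0 ↔ w = 0 := by
    intro w
    by_cases e : w = 0 <;> simp [e]
  have init : DfsInv n N src dst (Function.update (fun _ => 0) 0 1) (fun _ => 0) (fun _ => 0)
      (bucket src N) 1 0 := by
    refine { l_lt := one_pos, c_le := hn, ord_lt := fun _ _ => hn, pos_ord := fun k hk => ?_,
             pos_le := fun x hx => ?_, ord_pos := fun x hx h => ?_, parent := ⟨rfl, ?_⟩,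
             par_arc := fun k hk hk' => ?_, pos_zero := by simp, mem_rem := fun x a ha => ?_,
             scanned := fun b hb => ?_, closed := fun k hk h => ?_, anc := fun b hb h1 h2 => ?_,
             open_anc := fun u x h1 h2 h3 => ?_, interval := fun u x y h1 h2 h3 h4 => ?_ }
    · have : k = 0 := by omega
      simp [this]
    · by_cases e : x = 0 <;> simp [e]
    · exact ((hupd x).1 h).symm
    · intro k h1 h2; omega
    · omega
    · exact mem_bucket.1 ha
    · exact .inl (mem_bucket.2 ⟨hb, rfl⟩)
    · exact absurd ((hanc _ _).2 (by omega)) h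
    · rw [hupd] at h1 h2
      rw [h1, h2]
      exact .inl (Anc.refl _ _)
    · exact (hanc _ _).2 (by omega)
    · exact (hanc _ _).2 (by omega)
  obtain ⟨t, h', φ', r3, ⟨rem, D, H, -, -, hfin, -⟩, hb, ht⟩ := Cmd.loop_run
    (b := .lt (.const 0) (.var .go)) (p := Cmd.dfsStep) (DfsLoop (Cmd.dfsStep.time + 3) n N src dst (h.arr .next))
    (h₀ := h₁) (φ₀ := (Cmd.dfsStep.time + 3) * (N + n)) (by
      intro φ h₂ hf hI hb
      obtain ⟨t, r, ht⟩ := Cmd.dfsStep.run_den rfl h₂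
      have e1 : h₂.arr .next = h.arr .next := by rw [hf.arr .next rfl]; rfl
      have e2 : h₂.arr .dst = dst := by rw [hf.arr .dst rfl]; exact hdst
      obtain ⟨φ', hI', hφ⟩ := dfsLoop_step sym hsrc e1 e2 hI hb
      refine ⟨t, _, φ', r, hI', ?_⟩
      simp only [Cond.size, Expr.size]
      omega) (by
      refine ⟨bucket src N, 0, ?_⟩
      have hsum := sum_length_bucket hsrc
      have e : n = n - 1 + 1 := by omega
      simp only [hh₁, Store.setVar_arr, Store.setCell_arr, Store.setVar_reg, Store.setCell_reg,
        hpos, hord, hpar, hcur, hsum]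
      simp only [reduceCtorEq, if_true, if_false, Function.iterate_zero, id]
      refine ⟨init, hch, trivial, by simp, le_rfl, ?_⟩
      congr 1
      omega)
  have hgo : h'.reg .go = 0 := by
    simp only [Cond.Holds, Expr.eval] at hb
    omega
  obtain ⟨hc0, hr0⟩ := hfin hgo
  rw [hc0] at H
  refine ⟨_, h', .seq r0 (.seq r1 (.seq r2 (.seq r3 (.skip _)))), H.finish hsrc hr0 conn, ?_⟩
  simp only [Cond.size, Expr.size] at ht ⊢
  omega

/-! ### Relabelling the graph along the search tree -/

/-- The edges `{eu i, ev i}` with `i < m` are those of a connected simple graph on the vertices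
`0, …, n - 1`, each listed once. -/
structure IsInput (n m : ℕ) (eu ev : ℕ → ℕ) : Prop where
  pos : 0 < n
  eu_lt : ∀ i < m, eu i < n
  ev_lt : ∀ i < m, ev i < n
  ne : ∀ i < m, eu i ≠ ev i
  inj : ∀ i < m, ∀ j < m, eu i = eu j ∧ ev i = ev j ∨ eu i = ev j ∧ ev i = eu j → i = j
  conn : ∀ S : ℕ → Prop, S 0 → (∀ i < m, S (eu i) ↔ S (ev i)) → ∀ w < n, S w

/-- The edges `{up i, lo i}` with `i < m` are those of a simple graph on the labels `0, …, n - 1`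
that has the spanning tree `par`, where `up i` is a proper ancestor of `lo i` and where the
descendants of every label form an interval. -/
structure IsSearchTree (n m : ℕ) (par up lo : ℕ → ℕ) : Prop where
  parent : IsParent par n
  up_lt : ∀ i < m, up i < lo i
  lo_lt : ∀ i < m, lo i < n
  anc : ∀ i < m, Anc par (up i) (lo i)
  interval : ∀ u w x, x < n → Anc par u x → u ≤ w → w ≤ x → Anc par u w
  tree : ∀ w, 0 < w → w < n → ∃ i < m, up i = par w ∧ lo i = w
  inj : ∀ i < m, ∀ j < m, up i = up j → lo i = lo j → i = j

/-- The edges `{up i, lo i}` arise from `{eu i, ev i}` by the relabelling `x ↦ pos x - 1`. -/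
structure IsRelabelling (n m : ℕ) (eu ev pos up lo : ℕ → ℕ) : Prop where
  lt : ∀ w < n, pos w - 1 < n
  inj : ∀ w < n, ∀ x < n, pos w - 1 = pos x - 1 → w = x
  edge : ∀ i < m, up i = pos (eu i) - 1 ∧ lo i = pos (ev i) - 1 ∨
    up i = pos (ev i) - 1 ∧ lo i = pos (eu i) - 1

namespace Cmd

open SparseMaxCut.Expr (var const get succ pred)

/-- List the edge `i` in both directions. -/
def listArcsStep : Cmd :=
  block [put .src (var .arcs) (get .eu (var .i)), put .dst (var .arcs) (get .ev (var .i)),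
    set .arcs (succ (var .arcs)),
    put .src (var .arcs) (get .ev (var .i)), put .dst (var .arcs) (get .eu (var .i)),
    set .arcs (succ (var .arcs))]

/-- List every edge in both directions. -/
def listArcs : Cmd := forUp .i .m listArcsStep

/-- Replace the ends of the edge `i` by their labels, the smaller one first. -/
def relabelStep : Cmd :=
  ite (.lt (get .pos (get .eu (var .i))) (get .pos (get .ev (var .i))))
    (block [put .up (var .i) (pred (get .pos (get .eu (var .i)))),
      put .lo (var .i) (pred (get .pos (get .ev (var .i))))])
    (block [put .up (var .i) (pred (get .pos (get .ev (var .i)))),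
      put .lo (var .i) (pred (get .pos (get .eu (var .i))))])

/-- Replace the ends of every edge by their labels, the smaller one first. -/
def relabel : Cmd := forUp .i .m relabelStep

/-- Find a depth-first search tree and relabel the graph along it. -/
def search : Cmd :=
  block [listArcs, buildLists .src .head .next .arcs, dfs, relabel]

end Cmd

theorem listArcs_run (h : Store) (ha : h.reg .arcs = 0) :
    ∃ t h', Cmd.listArcs.Run h t h' ∧
      (h'.reg .arcs = 2 * h.reg .m ∧ ∀ i < h.reg .m,
        h'.arr .src (2 * i) = h.arr .eu i ∧ h'.arr .dst (2 * i) = h.arr .ev i ∧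
        h'.arr .src (2 * i + 1) = h.arr .ev i ∧ h'.arr .dst (2 * i + 1) = h.arr .eu i) ∧
      t ≤ (Cmd.listArcsStep.time + 6) * h.reg .m + 5 := by
  refine Cmd.forUp_run (p := Cmd.listArcsStep)
    (fun k g => g.reg .arcs = 2 * k ∧ ∀ i < k,
        g.arr .src (2 * i) = h.arr .eu i ∧ g.arr .dst (2 * i) = h.arr .ev i ∧
        g.arr .src (2 * i + 1) = h.arr .ev i ∧ g.arr .dst (2 * i + 1) = h.arr .eu i)
    (h₀ := h) rfl rfl rfl (by decide) (fun k g c => by simp) ⟨ha, by simp⟩ ?_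
  · rintro k g hk hi hf ⟨hI, hI'⟩
    have e1 : g.arr .eu = h.arr .eu := hf.arr _ rfl
    have e2 : g.arr .ev = h.arr .ev := hf.arr _ rfl
    simp only [Cmd.listArcsStep, Cmd.block, Cmd.den, Expr.eval, Store.setCell_arr, Store.setVar_arr,
      Store.setVar_reg, Store.setCell_reg, hI, hi, e1, e2, reduceCtorEq, if_true, if_false,
      Function.update_apply]
    refine ⟨by omega, fun i hik => ?_⟩
    rcases Nat.lt_succ_iff_lt_or_eq.1 hik with hik | rfl
    · rw [if_neg (by omega), if_neg (by omega), if_neg (by omega), if_neg (by omega),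
        if_neg (by omega), if_neg (by omega), if_neg (by omega), if_neg (by omega)]
      exact hI' i hik
    · simp

theorem relabel_run (h : Store) :
    ∃ t h', Cmd.relabel.Run h t h' ∧
      (∀ i < h.reg .m, h'.arr .up i = min (h.arr .pos (h.arr .eu i) - 1) (h.arr .pos (h.arr .ev i) - 1)
        ∧ h'.arr .lo i = max (h.arr .pos (h.arr .eu i) - 1) (h.arr .pos (h.arr .ev i) - 1)) ∧
      t ≤ (Cmd.relabelStep.time + 6) * h.reg .m + 5 := by
  refine Cmd.forUp_run (p := Cmd.relabelStep)
    (fun k g => ∀ i < k,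
      g.arr .up i = min (h.arr .pos (h.arr .eu i) - 1) (h.arr .pos (h.arr .ev i) - 1)
        ∧ g.arr .lo i = max (h.arr .pos (h.arr .eu i) - 1) (h.arr .pos (h.arr .ev i) - 1))
    (h₀ := h) rfl rfl rfl (by decide) (fun k g c => by simp) (by simp) ?_
  · rintro k g hk hi hf hI
    have e1 : g.arr .eu = h.arr .eu := hf.arr _ rfl
    have e2 : g.arr .ev = h.arr .ev := hf.arr _ rfl
    have e3 : g.arr .pos = h.arr .pos := hf.arr _ rfl
    intro i hik
    simp only [Cmd.relabelStep, Cmd.den, Cond.Holds, Expr.eval, hi, e1, e2, e3]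
    split_ifs with hlt
    all_goals
      simp only [Cmd.block, Cmd.den, Expr.eval, Store.setCell_arr, Store.setCell_reg, hi, e1, e2,
        e3, reduceCtorEq, if_true, if_false, Function.update_apply]
      split_ifs with hc
      · subst hc
        omega
      · exact hI i (by omega)

/-- Depth-first search and relabelling, in time `O(n + m)`. -/
theorem search_run : ∃ C, ∀ {n m : ℕ} {eu ev : ℕ → ℕ}, IsInput n m eu ev → ∀ h : Store,
    h.reg .n = n → h.reg .m = m → (∀ x, x ≠ .n → x ≠ .m → h.reg x = 0) →
    h.arr .eu = eu → h.arr .ev = ev → (∀ a, a ≠ .eu → a ≠ .ev → h.arr a = fun _ => 0) →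
    ∃ t h', Cmd.search.Run h t h' ∧
      IsSearchTree n m (h'.arr .par) (h'.arr .up) (h'.arr .lo) ∧
      IsRelabelling n m eu ev (h'.arr .pos) (h'.arr .up) (h'.arr .lo) ∧
      t ≤ C * (n + m + 1) := by
  refine ⟨Cmd.listArcsStep.time + 2 * Cmd.dfsStep.time + Cmd.relabelStep.time + 80, ?_⟩
  intro n m eu ev HI h hn hm hreg heu hev harr
  obtain ⟨t1, h1, r1, ⟨ha1, hs1⟩, l1⟩ := listArcs_run h (hreg _ (by decide) (by decide))
  rw [hm] at ha1 hs1 l1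
  rw [heu, hev] at hs1
  obtain ⟨t2, h2, r2, hc2, l2⟩ := Cmd.buildLists_run (key := .src) (head := .head) (next := .next)
    (N := .arcs) (by decide) (by decide) (by decide) (by decide) h1
    (by rw [r1.frame.arr _ rfl, harr _ (by decide) (by decide)])
  rw [ha1] at hc2 l2
  have hdst : h2.arr .dst = h1.arr .dst := r2.frame.arr _ rfl
  have hz : ∀ a, Cmd.listArcs.modArr a = false →
      (Cmd.buildLists .src .head .next .arcs).modArr a = false → a ≠ .eu → a ≠ .ev →
      h2.arr a = fun _ => 0 := by
    intro a b1 b2 b3 b4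
    rw [r2.frame.arr a b2, r1.frame.arr a b1, harr a b3 b4]
  have hpar : ∀ a < 2 * m, ∃ i < m, a = 2 * i ∨ a = 2 * i + 1 := by
    intro a ha
    exact ⟨a / 2, by omega, by omega⟩
  have hsrc : ∀ a < 2 * m, h1.arr .src a < n := by
    intro a ha
    obtain ⟨i, hi, rfl | rfl⟩ := hpar a ha
    · rw [(hs1 i hi).1]; exact HI.eu_lt i hi
    · rw [(hs1 i hi).2.2.1]; exact HI.ev_lt i hi
  have hsym : ∀ a < 2 * m, ∃ b < 2 * m, h1.arr .src b = h1.arr .dst a ∧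
      h1.arr .dst b = h1.arr .src a := by
    intro a ha
    obtain ⟨i, hi, rfl | rfl⟩ := hpar a ha
    · exact ⟨2 * i + 1, by omega, by rw [(hs1 i hi).2.1, (hs1 i hi).2.2.1],
        by rw [(hs1 i hi).1, (hs1 i hi).2.2.2]⟩
    · exact ⟨2 * i, by omega, by rw [(hs1 i hi).1, (hs1 i hi).2.2.2],
        by rw [(hs1 i hi).2.1, (hs1 i hi).2.2.1]⟩
  obtain ⟨t3, h3, r3, D, l3⟩ := dfs_run (src := h1.arr .src) (dst := h1.arr .dst) HI.pos hsym hsrc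
    (fun S h0 hS => HI.conn S h0 fun i hi => ⟨fun hu => by
        have := hS (2 * i) (by omega)
        rw [(hs1 i hi).1, (hs1 i hi).2.1] at this
        exact this hu, fun hu => by
        have := hS (2 * i + 1) (by omega)
        rw [(hs1 i hi).2.2.1, (hs1 i hi).2.2.2] at this
        exact this hu⟩) h2 hdst
    (hz _ rfl rfl (by decide) (by decide)) (hz _ rfl rfl (by decide) (by decide))
    (hz _ rfl rfl (by decide) (by decide))
    (by rw [r2.frame.reg _ rfl, r1.frame.reg _ rfl, hreg _ (by decide) (by decide)]) hc2
  obtain ⟨t4, h4, r4, e4, l4⟩ := relabel_run h3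
  have hm3 : h3.reg .m = m := by
    rw [r3.frame.reg _ rfl, r2.frame.reg _ rfl, r1.frame.reg _ rfl, hm]
  have heu3 : h3.arr .eu = eu := by
    rw [r3.frame.arr _ rfl, r2.frame.arr _ rfl, r1.frame.arr _ rfl, heu]
  have hev3 : h3.arr .ev = ev := by
    rw [r3.frame.arr _ rfl, r2.frame.arr _ rfl, r1.frame.arr _ rfl, hev]
  have hpar4 : h4.arr .par = h3.arr .par := r4.frame.arr _ rfl
  have hpos4 : h4.arr .pos = h3.arr .pos := r4.frame.arr _ rfl
  rw [hm3] at e4 l4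
  rw [heu3, hev3] at e4
  set pos := h3.arr .pos
  set par := h3.arr .par
  have hlt : ∀ w < n, pos w - 1 < n := fun w hw => by
    have := D.pos_le w hw
    have := D.pos_ne w hw
    omega
  have hinj : ∀ w < n, ∀ x < n, pos w - 1 = pos x - 1 → w = x := by
    intro w hw x hx e
    rw [← D.ord_pos w hw, ← D.ord_pos x hx, e]
  have hedge : ∀ i < m, h4.arr .up i = pos (eu i) - 1 ∧ h4.arr .lo i = pos (ev i) - 1 ∨
      h4.arr .up i = pos (ev i) - 1 ∧ h4.arr .lo i = pos (eu i) - 1 := by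
    intro i hi
    have := e4 i hi
    omega
  have hup : ∀ i < m, h4.arr .up i < h4.arr .lo i := by
    intro i hi
    have := e4 i hi
    have : pos (eu i) - 1 ≠ pos (ev i) - 1 := fun e =>
      HI.ne i hi (hinj _ (HI.eu_lt i hi) _ (HI.ev_lt i hi) e)
    omega
  have hlo : ∀ i < m, h4.arr .lo i < n := by
    intro i hi
    rcases hedge i hi with ⟨-, e⟩ | ⟨-, e⟩ <;> rw [e]
    · exact hlt _ (HI.ev_lt i hi)
    · exact hlt _ (HI.eu_lt i hi)
  have hanc : ∀ i < m, Anc par (h4.arr .up i) (h4.arr .lo i) := by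
    intro i hi
    have h5 := D.anc (2 * i) (by omega)
    rw [(hs1 i hi).1, (hs1 i hi).2.1] at h5
    have h6 := hup i hi
    rcases hedge i hi with ⟨e1, e2⟩ | ⟨e1, e2⟩ <;> rw [e1, e2] at h6 ⊢ <;>
      rcases h5 with h5 | h5
    · exact h5
    · have := D.parent.anc_le (hlt _ (HI.eu_lt i hi)) h5
      omega
    · have := D.parent.anc_le (hlt _ (HI.ev_lt i hi)) h5
      omega
    · exact h5
  refine ⟨_, h4, .seq r1 (.seq r2 (.seq r3 (.seq r4 (.skip _)))), ?_, ?_, ?_⟩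
  · rw [hpar4]
    refine ⟨D.parent, hup, hlo, hanc, D.interval, fun w hw hwn => ?_, fun i hi j hj e1 e2 => ?_⟩
    · obtain ⟨a, ha, b1, b2⟩ := D.par_arc w hw hwn
      obtain ⟨i, hi, hai⟩ := hpar a ha
      refine ⟨i, hi, ?_⟩
      have c1 := D.pos_ord w hwn
      have c2 := D.pos_ord (par w) ((D.parent.le hwn).trans_lt hwn)
      have c3 := D.parent.lt w hw hwn
      have c4 := hup i hi
      have c5 := hedge i hi
      rcases hai with rfl | rfl
      · rw [(hs1 i hi).1] at b1
        rw [(hs1 i hi).2.1] at b2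
        rw [b1, b2, c1, c2] at c5
        omega
      · rw [(hs1 i hi).2.2.1] at b1
        rw [(hs1 i hi).2.2.2] at b2
        rw [b1, b2, c1, c2] at c5
        omega
    · refine HI.inj i hi j hj ?_
      have f1 := hinj _ (HI.eu_lt i hi) _ (HI.eu_lt j hj)
      have f2 := hinj _ (HI.ev_lt i hi) _ (HI.ev_lt j hj)
      have f3 := hinj _ (HI.eu_lt i hi) _ (HI.ev_lt j hj)
      have f4 := hinj _ (HI.ev_lt i hi) _ (HI.eu_lt j hj)
      rcases hedge i hi with ⟨a1, a2⟩ | ⟨a1, a2⟩ <;> rcases hedge j hj with ⟨b1, b2⟩ | ⟨b1, b2⟩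
      · exact .inl ⟨f1 (by omega), f2 (by omega)⟩
      · exact .inr ⟨f3 (by omega), f4 (by omega)⟩
      · exact .inr ⟨f3 (by omega), f4 (by omega)⟩
      · exact .inl ⟨f1 (by omega), f2 (by omega)⟩
  · rw [hpos4]
    exact ⟨hlt, hinj, hedge⟩
  · have : t1 + (t2 + (t3 + (t4 + 0))) ≤ ((Cmd.listArcsStep.time + 6) * m + 5) + ((16 * (2 * m) + 5) +
        (((Cmd.dfsStep.time + 3) * (2 * m + n) + 10) + ((Cmd.relabelStep.time + 6) * m + 5))) := by
      omega
    refine this.trans ?_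
    generalize Cmd.dfsStep.time = A
    generalize Cmd.relabelStep.time = B
    generalize Cmd.listArcsStep.time = E
    nlinarith [Nat.zero_le (A * n), Nat.zero_le (B * n), Nat.zero_le (E * n)]

/-! ### Cutting the search tree into pieces -/

/-- The edges that are not in the spanning tree. -/
def extra (m : ℕ) (par up lo : ℕ → ℕ) : Finset ℕ :=
  (Finset.range m).filter fun i => par (lo i) ≠ up i

/-- A partition of the labels into subtrees ("pieces"); `root w` is the top label of the piece of
`w`. Every piece, except possibly the one with the root of the whole tree, contains at least four
edges outside the tree, but the part of a piece below a label other than its top contains at most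
three of them. -/
structure IsCutting (n m : ℕ) (par up lo root : ℕ → ℕ) : Prop where
  le : ∀ w < n, root w ≤ w
  root_root : ∀ w < n, root (root w) = root w
  root_par : ∀ w < n, root w ≠ w → root (par w) = root w
  big : ∀ s < n, 0 < s → root s = s →
    4 ≤ ((extra m par up lo).filter fun i => root (up i) = s ∧ root (lo i) = s).card
  small : ∀ c < n, root c ≠ c → ((extra m par up lo).filter fun i =>
    Anc par c (up i) ∧ root (up i) = root c ∧ root (lo i) = root c).card ≤ 3

/-- The edges outside the tree between descendants of `x` that are still in the tree. -/
noncomputable def inner (m : ℕ) (par up lo rt : ℕ → ℕ) (x : ℕ) : Finset ℕ :=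
  (extra m par up lo).filter fun i => Anc par x (up i) ∧ rt (up i) = 0 ∧ rt (lo i) = 0

/-- The state of the cutting procedure when the labels from `v` on have been processed: `rt w` is
one more than the top of the piece of `w` if `w` has been cut off, and `0` otherwise; `kk x` counts
the edges outside the tree below `x`. -/
structure CutInv (n m : ℕ) (par up lo rt kk : ℕ → ℕ) (v : ℕ) : Prop where
  below : ∀ x < v, rt x = 0
  alive_par : ∀ y < n, v ≤ par y → rt y = 0 → rt (par y) = 0
  dead : ∀ y < n, rt y ≠ 0 → v + 1 ≤ rt y ∧ 1 < rt y ∧ rt y ≤ y + 1 ∧ rt (rt y - 1) = rt y ∧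
    (rt y ≠ y + 1 → rt (par y) = rt y)
  count : ∀ x < n, v ≤ x → rt x = 0 → kk x = (inner m par up lo rt x).card ∧ kk x ≤ 3
  big : ∀ r < n, rt r = r + 1 →
    4 ≤ ((extra m par up lo).filter fun i => rt (up i) = r + 1 ∧ rt (lo i) = r + 1).card
  small : ∀ c < n, rt c ≠ 0 → rt c ≠ c + 1 → ((extra m par up lo).filter fun i =>
    Anc par c (up i) ∧ rt (up i) = rt c ∧ rt (lo i) = rt c).card ≤ 3

/-- The contribution of the edge `i` to the count at its upper end: a tree edge contributes the
count of its lower end. -/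
def weight (par up lo rt kk : ℕ → ℕ) (i : ℕ) : ℕ :=
  if rt (lo i) = 0 then (if par (lo i) = up i then kk (lo i) else 1) else 0

section

variable {n m : ℕ} {par up lo rt kk : ℕ → ℕ} {v : ℕ}

theorem Anc.exists_child {u w : ℕ} (h : Anc par u w) (hne : u ≠ w) :
    ∃ c, par c = u ∧ Anc par c w := by
  obtain ⟨k, rfl⟩ := h
  cases k with
  | zero => exact absurd rfl hne
  | succ k => exact ⟨par^[k] w, by rw [Function.iterate_succ_apply'], k, rfl⟩

namespace IsSearchTree

theorem up_lt_n (T : IsSearchTree n m par up lo) {i : ℕ} (hi : i < m) : up i < n :=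
  (T.up_lt i hi).trans (T.lo_lt i hi)

theorem lt_of_par_eq (T : IsSearchTree n m par up lo) {c : ℕ} (hc : c < n) (hv : 0 < v)
    (h : par c = v) : v < c := by
  subst h
  refine T.parent.lt c ?_ hc
  rcases Nat.eq_zero_or_pos c with rfl | h
  · rw [T.parent.zero] at hv
    exact absurd hv (lt_irrefl _)
  · exact h

theorem child_unique (T : IsSearchTree n m par up lo) {c d w : ℕ} (hv : 0 < v) (hw : w < n)
    (hc : par c = v) (hd : par d = v) (h1 : Anc par c w) (h2 : Anc par d w) : c = d := by
  have hcn := (T.parent.anc_le hw h1).trans_lt hw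
  have hdn := (T.parent.anc_le hw h2).trans_lt hw
  have hcv := T.lt_of_par_eq hcn hv hc
  have hdv := T.lt_of_par_eq hdn hv hd
  by_contra hne
  rcases h1.total h2 with h | h
  · have := T.parent.anc_le (hdv.trans hdn) (hd ▸ h.par_of_ne hne)
    omega
  · have := T.parent.anc_le (hdv.trans hdn) (hc ▸ h.par_of_ne (Ne.symm hne))
    omega

end IsSearchTree

theorem CutInv.alive_anc (T : IsSearchTree n m par up lo) (H : CutInv n m par up lo rt kk v)
    {c y : ℕ} (hy : y < n) (h : Anc par c y) (hc : v ≤ c) (ha : rt y = 0) : rt c = 0 := by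
  obtain ⟨k, rfl⟩ := h
  induction k with
  | zero => exact ha
  | succ k ih =>
    rw [Function.iterate_succ_apply'] at hc ⊢
    have hlt := (T.parent.iterate_le hy k).trans_lt hy
    exact H.alive_par _ hlt hc (ih (hc.trans (T.parent.le hlt)))

/-- The count of a label is the sum of the contributions of the edges that go down from it. -/
theorem CutInv.card_inner (T : IsSearchTree n m par up lo)
    (H : CutInv n m par up lo rt kk (v + 1)) (hv : 0 < v) :
    (inner m par up lo rt v).card
      = ∑ i ∈ (Finset.range m).filter (fun i => up i = v), weight par up lo rt kk i := by
  set F : ℕ → Finset ℕ := fun i => if rt (lo i) = 0 then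
    (if par (lo i) = up i then inner m par up lo rt (lo i) else {i}) else ∅ with hF
  have hv0 : rt v = 0 := H.below v (by omega)
  have hdisj : ∀ i ∈ (Finset.range m).filter (fun i => up i = v), ∀ e ∈ F i,
      (e = i ∧ par (lo i) ≠ v ∧ up e = v) ∨ (par (lo i) = v ∧ Anc par (lo i) (up e) ∧ v < up e
        ∧ e < m) := by
    intro i hi e he
    simp only [Finset.mem_filter, Finset.mem_range] at hi
    simp only [hF, hi.2] at he
    split_ifs at he with h1 h2
    · simp only [inner, extra, Finset.mem_filter, Finset.mem_range] at he
      refine .inr ⟨h2, he.2.1, ?_, he.1.1⟩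
      exact (T.lt_of_par_eq (T.lo_lt i hi.1) hv h2).trans_le
        (T.parent.anc_le (T.up_lt_n he.1.1) he.2.1)
    · simp only [Finset.mem_singleton] at he
      subst he
      exact .inl ⟨rfl, h2, hi.2⟩
    · simp at he
  have hunion : inner m par up lo rt v
      = ((Finset.range m).filter (fun i => up i = v)).biUnion F := by
    ext e
    simp only [Finset.mem_biUnion]
    constructor
    · intro he
      have he' := he
      simp only [inner, extra, Finset.mem_filter, Finset.mem_range] at he
      obtain ⟨⟨hem, hex⟩, hanc, h1, h2⟩ := he
      by_cases hup : up e = v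
      · refine ⟨e, by simp [hem, hup], ?_⟩
        simp only [hF, h2, if_true, if_neg hex, Finset.mem_singleton]
      · obtain ⟨c, hc, hca⟩ := hanc.exists_child (Ne.symm hup)
        have hupn := T.up_lt_n hem
        have hcn := (T.parent.anc_le hupn hca).trans_lt hupn
        have hvc := T.lt_of_par_eq hcn hv hc
        obtain ⟨j, hj, hj1, hj2⟩ := T.tree c (by omega) hcn
        have hcal := H.alive_anc T hupn hca hvc h1
        refine ⟨j, by simp [hj, hj1, hc], ?_⟩
        simp only [hF, hj2, hj1, hcal, if_true]
        simp only [inner, extra, Finset.mem_filter, Finset.mem_range]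
        exact ⟨⟨hem, hex⟩, hca, h1, h2⟩
    · rintro ⟨i, hi, he⟩
      simp only [Finset.mem_filter, Finset.mem_range] at hi
      simp only [hF, hi.2] at he
      split_ifs at he with h1 h2
      · simp only [inner, extra, Finset.mem_filter, Finset.mem_range] at he ⊢
        refine ⟨he.1, Anc.trans ?_ he.2.1, he.2.2⟩
        rw [← h2]
        exact (Anc.refl _ _).of_par
      · simp only [Finset.mem_singleton] at he
        subst he
        simp only [inner, extra, Finset.mem_filter, Finset.mem_range]
        exact ⟨⟨hi.1, hi.2 ▸ h2⟩, hi.2 ▸ Anc.refl _ _, hi.2 ▸ hv0, h1⟩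
      · simp at he
  rw [hunion, Finset.card_biUnion]
  · refine Finset.sum_congr rfl fun i hi => ?_
    simp only [Finset.mem_filter, Finset.mem_range] at hi
    simp only [hF, weight]
    split_ifs with h1 h2
    · have hlt := T.up_lt i hi.1
      exact (H.count _ (T.lo_lt i hi.1) (by omega) h1).1.symm
    · simp
    · simp
  · intro i hi j hj hij
    refine Finset.disjoint_left.2 fun e he he' => ?_
    have hi' := (Finset.mem_filter.1 hi)
    have hj' := (Finset.mem_filter.1 hj)
    rw [Finset.mem_range] at hi' hj'
    rcases hdisj i hi e he with ⟨h1, h2, h3⟩ | ⟨h1, h2, h3, h4⟩ <;>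
      rcases hdisj j hj e he' with ⟨g1, g2, g3⟩ | ⟨g1, g2, g3, g4⟩
    · exact hij (h1.symm.trans g1)
    · omega
    · omega
    · exact hij (T.inj i hi'.1 j hj'.1 (hi'.2.trans hj'.2.symm)
        (T.child_unique hv (T.up_lt_n h4) h1 g1 h2 g2))

/-- A label with a small count stays in the tree. -/
theorem CutInv.keep (H : CutInv n m par up lo rt kk (v + 1)) (hv : 0 < v) {acc : ℕ}
    (hacc : acc = (inner m par up lo rt v).card) (h3 : acc ≤ 3) :
    CutInv n m par up lo rt (Function.update kk v acc) v := by
  refine ⟨fun x hx => H.below x (by omega), fun y hy h1 h2 => ?_, fun y hy h1 => ?_,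
    fun x hx h1 h2 => ?_, H.big, H.small⟩
  · by_cases e : par y = v
    · rw [e]; exact H.below v (by omega)
    · exact H.alive_par y hy (by omega) h2
  · have := H.dead y hy h1
    exact ⟨by omega, this.2⟩
  · by_cases e : x = v
    · subst e
      simpa using ⟨hacc, h3⟩
    · rw [Function.update_of_ne e]
      exact H.count x hx (by omega) h2

/-- A label with a large count is cut off together with the labels below it. -/
theorem CutInv.cut (T : IsSearchTree n m par up lo)
    (H : CutInv n m par up lo rt kk (v + 1)) (hv : 0 < v) (hvn : v < n)
    (h4 : 4 ≤ (inner m par up lo rt v).card) {rt' kk' : ℕ → ℕ}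
    (hrt : ∀ y < n, rt' y = if rt y = 0 ∧ Anc par v y then v + 1 else rt y)
    (hkk : ∀ x, x ≠ v → kk' x = kk x) :
    CutInv n m par up lo rt' kk' v := by
  have hold : ∀ y < n, rt y ≠ 0 → rt' y = rt y := fun y hy h => by
    rw [hrt y hy, if_neg (fun h' => h h'.1)]
  have hnew : ∀ y < n, rt y = 0 → Anc par v y → rt' y = v + 1 := fun y hy h1 h2 => by
    rw [hrt y hy, if_pos ⟨h1, h2⟩]
  have hkeep : ∀ y < n, ¬ Anc par v y → rt' y = rt y := fun y hy h => by
    rw [hrt y hy, if_neg (fun h' => h h'.2)]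
  have hzero : ∀ y < n, rt' y = 0 ↔ rt y = 0 ∧ ¬ Anc par v y := by
    intro y hy
    rw [hrt y hy]
    split_ifs with h
    · simp [h.2]
    · simp only [not_and] at h
      exact ⟨fun h' => ⟨h', h h'⟩, fun h' => h'.1⟩
  have hge : ∀ y < n, rt y ≠ 0 → v + 2 ≤ rt y := fun y hy h => (H.dead y hy h).1
  have hfin : ∀ y < n, rt' y = v + 1 → rt y = 0 ∧ Anc par v y := by
    intro y hy h
    rw [hrt y hy] at h
    split_ifs at h with h'
    · exact h'
    · have := hge y hy (by omega)
      omega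
  have hv0 : rt v = 0 := H.below v (by omega)
  have hex : ∀ i ∈ extra m par up lo, up i < n ∧ lo i < n ∧ Anc par (up i) (lo i) := by
    intro i hi
    have hi : i < m := by simpa using (Finset.mem_filter.1 hi).1
    exact ⟨T.up_lt_n hi, T.lo_lt i hi, T.anc i hi⟩
  refine ⟨fun x hx => ?_, fun y hy h1 h2 => ?_, fun y hy h1 => ?_,
    fun x hx h1 h2 => ?_, fun r hr h1 => ?_, fun c hc h1 h2 => ?_⟩
  · rw [hkeep x (by omega) fun h => ?_]
    · exact H.below x (by omega)
    · have := T.parent.anc_le (by omega) h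
      omega
  · obtain ⟨h2, h3⟩ := (hzero y hy).1 h2
    have hpn := (T.parent.le hy).trans_lt hy
    refine (hzero _ hpn).2 ⟨H.alive_par y hy ?_ h2, fun h => h3 h.of_par⟩
    rcases Nat.lt_or_eq_of_le h1 with h | h
    · exact h
    · exact absurd (Anc.of_par (h ▸ Anc.refl _ _)) h3
  · by_cases h0 : rt y = 0
    · have hva : Anc par v y := by
        by_contra h
        exact h1 ((hzero y hy).2 ⟨h0, h⟩)
      rw [hnew y hy h0 hva]
      have := T.parent.anc_le hy hva
      refine ⟨le_rfl, by omega, by omega, ?_, fun hne => ?_⟩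
      · rw [Nat.add_sub_cancel]
        exact hnew v hvn hv0 (Anc.refl _ _)
      · have hpa : Anc par v (par y) := hva.par_of_ne (by omega)
        have hpn := (T.parent.le hy).trans_lt hy
        refine hnew _ hpn ?_ hpa
        by_cases e : par y = v
        · rw [e, hv0]
        · have := T.parent.anc_le hpn hpa
          exact H.alive_par y hy (by omega) h0
    · obtain ⟨a1, a2, a3, a4, a5⟩ := H.dead y hy h0
      rw [hold y hy h0]
      refine ⟨by omega, a2, a3, ?_, fun hne => ?_⟩
      · rw [hold _ (by omega) (by rw [a4]; exact h0), a4]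
      · have := a5 hne
        rw [hold _ ((T.parent.le hy).trans_lt hy) (by rw [this]; exact h0), this]
  · obtain ⟨h2, h3⟩ := (hzero x hx).1 h2
    have hxv : x ≠ v := fun e => h3 (e ▸ Anc.refl _ _)
    have key : ∀ y < n, Anc par x y → ¬ Anc par v y := by
      intro y hy hxy hvy
      rcases hxy.total hvy with h | h
      · have := T.parent.anc_le hvn h
        omega
      · exact h3 h
    have : inner m par up lo rt' x = inner m par up lo rt x := by
      refine Finset.filter_congr fun i hi => ?_
      obtain ⟨b1, b2, b3⟩ := hex i hi
      refine and_congr_right fun ha => ?_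
      rw [hkeep _ b1 (key _ b1 ha), hkeep _ b2 (key _ b2 (ha.trans b3))]
    rw [this, hkk x hxv]
    exact H.count x hx (by omega) h2
  · by_cases e : r = v
    · subst e
      refine h4.trans (Finset.card_le_card fun i hi => ?_)
      simp only [inner, Finset.mem_filter] at hi ⊢
      obtain ⟨b1, b2, b3⟩ := hex i hi.1
      exact ⟨hi.1, hnew _ b1 hi.2.2.1 hi.2.1, hnew _ b2 hi.2.2.2 (hi.2.1.trans b3)⟩
    · have hr' : rt r = r + 1 := by
        rw [hrt r hr] at h1
        split_ifs at h1 with h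
        · omega
        · exact h1
      refine (H.big r hr hr').trans (Finset.card_le_card fun i hi => ?_)
      simp only [Finset.mem_filter] at hi ⊢
      obtain ⟨b1, b2, b3⟩ := hex i hi.1
      exact ⟨hi.1, by rw [hold _ b1 (by omega)]; exact hi.2.1,
        by rw [hold _ b2 (by omega)]; exact hi.2.2⟩
  · by_cases h0 : rt c = 0
    · have hva : Anc par v c := by
        by_contra h
        exact h1 ((hzero c hc).2 ⟨h0, h⟩)
      have hcv := T.parent.anc_le hc hva
      have hc' := hnew c hc h0 hva
      have := H.count c hc (by omega) h0
      refine le_trans (Finset.card_le_card fun i hi => ?_) (this.1 ▸ this.2)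
      simp only [inner, Finset.mem_filter, hc'] at hi ⊢
      obtain ⟨b1, b2, b3⟩ := hex i hi.1
      exact ⟨hi.1, hi.2.1, (hfin _ b1 hi.2.2.1).1, (hfin _ b2 hi.2.2.2).1⟩
    · have hc' := hold c hc h0
      have hcge := hge c hc h0
      have hback : ∀ y < n, rt' y = rt c → rt y = rt c := by
        intro y hy h
        rw [hrt y hy] at h
        split_ifs at h with h'
        · omega
        · exact h
      refine le_trans (Finset.card_le_card fun i hi => ?_) (H.small c hc h0 (hc' ▸ h2))
      simp only [Finset.mem_filter, hc'] at hi ⊢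
      obtain ⟨b1, b2, b3⟩ := hex i hi.1
      exact ⟨hi.1, hi.2.1, hback _ b1 hi.2.2.1, hback _ b2 hi.2.2.2⟩

theorem CutInv.isCutting (T : IsSearchTree n m par up lo)
    (H : CutInv n m par up lo rt kk 1) :
    IsCutting n m par up lo fun w => rt w - 1 := by
  have hr0 : rt 0 = 0 := H.below 0 one_pos
  have hone : ∀ y < n, rt y - 1 = 0 → rt y = 0 := by
    intro y hy h
    by_contra h0
    have := (H.dead y hy h0).2.1
    omega
  have hex : ∀ i ∈ extra m par up lo, up i < n ∧ lo i < n := by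
    intro i hi
    have hi : i < m := by simpa using (Finset.mem_filter.1 hi).1
    exact ⟨T.up_lt_n hi, T.lo_lt i hi⟩
  have hinj : ∀ y < n, ∀ z < n, rt y ≠ 0 → rt z - 1 = rt y - 1 → rt z = rt y := by
    intro y hy z hz h h'
    have h1 := (H.dead y hy h).2.1
    omega
  refine ⟨fun w hw => ?_, fun w hw => ?_, fun w hw h => ?_, fun s hs h1 h2 => ?_,
    fun c hc h => ?_⟩
  · by_cases h0 : rt w = 0
    · simp [h0]
    · have := (H.dead w hw h0).2.2.1
      omega
  · by_cases h0 : rt w = 0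
    · simp [h0, hr0]
    · simp only [(H.dead w hw h0).2.2.2.1]
  · by_cases h0 : rt w = 0
    · by_cases e : par w = 0
      · simp [e, hr0, h0]
      · simp [H.alive_par w hw (Nat.one_le_iff_ne_zero.2 e) h0, h0]
    · simp only [(H.dead w hw h0).2.2.2.2 (by omega)]
  · have h3 : rt s = s + 1 := by omega
    refine (H.big s hs h3).trans (Finset.card_le_card fun i hi => ?_)
    simp only [Finset.mem_filter] at hi ⊢
    exact ⟨hi.1, by omega, by omega⟩
  · by_cases h0 : rt c = 0
    · have := H.count c hc (by omega) h0
      refine le_trans (Finset.card_le_card fun i hi => ?_) (this.1 ▸ this.2)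
      simp only [inner, Finset.mem_filter, h0, Nat.zero_sub] at hi ⊢
      obtain ⟨b1, b2⟩ := hex i hi.1
      exact ⟨hi.1, hi.2.1, hone _ b1 hi.2.2.1, hone _ b2 hi.2.2.2⟩
    · refine le_trans (Finset.card_le_card fun i hi => ?_) (H.small c hc h0 (by omega))
      simp only [Finset.mem_filter] at hi ⊢
      obtain ⟨b1, b2⟩ := hex i hi.1
      exact ⟨hi.1, hi.2.1, hinj c hc _ b1 h0 hi.2.2.1, hinj c hc _ b2 h0 hi.2.2.2⟩

end

namespace Cmd

open SparseMaxCut.Expr (var const get succ pred)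

/-- Add the contribution of the edge `i` to `acc`. Counts of labels that are still in the tree are
at most `3`. -/
def countStep : Cmd :=
  block [set .w (get .lo (var .i)), ite (.eq (get .rt (var .w)) (const 0))
    (ite (.eq (get .par (var .w)) (var .v))
      (block [set .aux (get .kk (var .w)),
        ite (.lt (const 0) (var .aux)) (set .acc (succ (var .acc))) skip,
        ite (.lt (const 1) (var .aux)) (set .acc (succ (var .acc))) skip,
        ite (.lt (const 2) (var .aux)) (set .acc (succ (var .acc))) skip])
      (set .acc (succ (var .acc))))
    skip]

/-- Add the label on top of the stack to the piece of `v`. -/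
def popStep : Cmd :=
  block [put .rt (get .stack (var .top)) (succ (var .v)), set .top (pred (var .top))]

/-- Cut off the piece with the top `v`. The labels that are still in the tree are on the stack in
increasing order, so that those below `v` come first; they are recognized by their parents. -/
def cutOff : Cmd :=
  block [put .rt (var .v) (succ (var .v)),
    loop (.eq (get .rt (get .par (get .stack (var .top)))) (succ (var .v))) popStep]

/-- Push `v` on the stack. -/
def push : Cmd :=
  block [set .top (succ (var .top)), put .stack (var .top) (var .v)]

/-- Process the label `v`. -/
def cutStep : Cmd :=
  ite (.lt (const 0) (var .v))
    (block [set .acc (const 0), walk .i .j (get .uhead (var .v)) .unext countStep,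
      put .kk (var .v) (var .acc),
      ite (.lt (var .acc) (const 4)) push cutOff])
    skip

/-- Cut the search tree into pieces. -/
def cutting : Cmd :=
  block [buildLists .up .uhead .unext .m, forDown .v .n cutStep]

end Cmd

/-- The cells `1, …, top` of the stack hold the labels from `v` on that are still in the tree, the
smallest one on top. -/
structure StackInv (n : ℕ) (rt st : ℕ → ℕ) (top v : ℕ) : Prop where
  zero : st 0 = 0
  mem : ∀ j, 1 ≤ j → j ≤ top → st j < n ∧ v ≤ st j ∧ rt (st j) = 0
  exists_mem : ∀ x < n, v ≤ x → rt x = 0 → ∃ j, 1 ≤ j ∧ j ≤ top ∧ st j = x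
  anti : ∀ i j, 1 ≤ i → i < j → j ≤ top → st j < st i

section

variable {n m : ℕ} {par up lo : ℕ → ℕ}

theorem StackInv.push {rt st : ℕ → ℕ} {top v : ℕ} (S : StackInv n rt st top (v + 1)) (hvn : v < n)
    (hv : rt v = 0) : StackInv n rt (Function.update st (top + 1) v) (top + 1) v := by
  refine ⟨?_, fun j h1 h2 => ?_, fun x hx h1 h2 => ?_, fun i j h1 h2 h3 => ?_⟩
  · rw [Function.update_of_ne (by omega)]
    exact S.zero
  · by_cases e : j = top + 1
    · subst e
      simpa using ⟨hvn, hv⟩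
    · rw [Function.update_of_ne e]
      have := S.mem j h1 (by omega)
      exact ⟨this.1, by omega, this.2.2⟩
  · by_cases e : x = v
    · exact ⟨top + 1, by omega, le_rfl, by simp [e]⟩
    · obtain ⟨j, h3, h4, h5⟩ := S.exists_mem x hx (by omega) h2
      exact ⟨j, h3, by omega, by rw [Function.update_of_ne (by omega), h5]⟩
  · rw [Function.update_of_ne (show i ≠ top + 1 by omega)]
    by_cases e : j = top + 1
    · subst e
      have := (S.mem i h1 (by omega)).2.1
      rw [Function.update_self]
      omega
    · rw [Function.update_of_ne e]
      exact S.anti i j h1 h2 (by omega)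

/-- The invariant of the loop that cuts off the piece of `v`: the labels in the stack cells
`top + 1, …, top₀` have been added to the piece. -/
structure PopInv (n : ℕ) (par rt st : ℕ → ℕ) (top₀ v : ℕ) (rt' : ℕ → ℕ) (top : ℕ) : Prop where
  le : top ≤ top₀
  desc : ∀ j, top < j → j ≤ top₀ → Anc par v (st j)
  top_eq : rt' v = v + 1
  popped : ∀ j, top < j → j ≤ top₀ → rt' (st j) = v + 1
  other : ∀ y, y ≠ v → (∀ j, top < j → j ≤ top₀ → st j ≠ y) → rt' y = rt y

variable {rt kk st rt' : ℕ → ℕ} {top₀ top v : ℕ}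

theorem PopInv.eq_of_val (P : PopInv n par rt st top₀ v rt' top) {y : ℕ} (hy : rt' y ≠ rt y) :
    y = v ∨ ∃ j, top < j ∧ j ≤ top₀ ∧ st j = y := by
  by_contra h
  push Not at h
  exact hy (P.other y h.1 h.2)

theorem PopInv.step (T : IsSearchTree n m par up lo) (H : CutInv n m par up lo rt kk (v + 1))
    (S : StackInv n rt st top₀ (v + 1)) (hv : 0 < v)
    (P : PopInv n par rt st top₀ v rt' top) (hb : rt' (par (st top)) = v + 1) :
    0 < top ∧ PopInv n par rt st top₀ v (Function.update rt' (st top) (v + 1)) (top - 1) := by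
  have htop : 0 < top := by
    by_contra h0
    have h0 : top = 0 := by omega
    rw [h0, S.zero, T.parent.zero, P.other 0 (by omega), H.below 0 (by omega)] at hb
    · omega
    · intro j h1 h2 h3
      have := (S.mem j (by omega) h2).2.1
      omega
  have hle := P.le
  obtain ⟨m1, m2, m3⟩ := S.mem top htop hle
  have hpn : par (st top) < n := (T.parent.le m1).trans_lt m1
  have hanc : Anc par v (st top) := by
    apply Anc.of_par
    by_cases e : rt' (par (st top)) = rt (par (st top))
    · rw [e] at hb
      have := (H.dead _ hpn (by omega)).1
      omega
    · rcases P.eq_of_val e with e | ⟨j, h1, h2, h3⟩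
      · rw [e]; exact Anc.refl _ _
      · rw [← h3]; exact P.desc j h1 h2
  refine ⟨htop, by omega, fun j h1 h2 => ?_, ?_, fun j h1 h2 => ?_, fun y h1 h2 => ?_⟩
  · by_cases e : j = top
    · rw [e]; exact hanc
    · exact P.desc j (by omega) h2
  · rw [Function.update_of_ne (by omega)]
    exact P.top_eq
  · by_cases e : j = top
    · rw [e, Function.update_self]
    · have := S.anti top j htop (by omega) h2
      rw [Function.update_of_ne (by omega)]
      exact P.popped j (by omega) h2
  · rw [Function.update_of_ne (Ne.symm (h2 top (by omega) hle))]
    exact P.other y h1 fun j h3 h4 => h2 j (by omega) h4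

theorem PopInv.finish (T : IsSearchTree n m par up lo) (H : CutInv n m par up lo rt kk (v + 1))
    (S : StackInv n rt st top₀ (v + 1)) (hv : 0 < v)
    (P : PopInv n par rt st top₀ v rt' top) (hb : rt' (par (st top)) ≠ v + 1) :
    (∀ y < n, rt' y = if rt y = 0 ∧ Anc par v y then v + 1 else rt y) ∧
      StackInv n rt' st top v := by
  have hle := P.le
  -- the smallest label left on the stack is not below `v`, hence no label on the stack is
  have hrest : ∀ j, 1 ≤ j → j ≤ top → ¬ Anc par v (st j) := by
    intro j h1 h2 hanc
    obtain ⟨m1, m2, m3⟩ := S.mem j h1 (by omega)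
    obtain ⟨k1, k2, k3⟩ := S.mem top (by omega) hle
    have hxy : st top ≤ st j := by
      rcases Nat.lt_or_eq_of_le h2 with h | h
      · exact (S.anti j top h1 h hle).le
      · rw [h]
    have hx : Anc par v (st top) := T.interval v _ _ m1 hanc (by omega) hxy
    have hx' := hx.par_of_ne (by omega)
    have hpn : par (st top) < n := (T.parent.le k1).trans_lt k1
    by_cases e : par (st top) = v
    · rw [e] at hb
      exact hb P.top_eq
    · have hge := T.parent.anc_le hpn hx'
      have hlt := T.parent.lt (st top) (by omega) k1
      obtain ⟨i, i1, i2, i3⟩ := S.exists_mem (par (st top)) hpn (by omega)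
        (H.alive_par _ k1 (by omega) k3)
      have : top < i := by
        by_contra h
        rcases Nat.lt_or_eq_of_le (not_lt.1 h) with h | h
        · have := S.anti i top i1 h hle
          omega
        · rw [h] at i3
          omega
      exact hb (i3 ▸ P.popped i this i2)
  have hv0 : rt v = 0 := H.below v (by omega)
  have hval : ∀ y < n, rt' y = if rt y = 0 ∧ Anc par v y then v + 1 else rt y := by
    intro y hy
    split_ifs with h
    · by_cases e : y = v
      · rw [e]; exact P.top_eq
      · have := T.parent.anc_le hy h.2
        obtain ⟨i, i1, i2, i3⟩ := S.exists_mem y hy (by omega) h.1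
        by_cases hi : top < i
        · rw [← i3]; exact P.popped i hi i2
        · exact absurd (i3 ▸ h.2) (hrest i i1 (by omega))
    · by_contra hne
      rcases P.eq_of_val hne with e | ⟨j, h1, h2, h3⟩
      · exact h ⟨by rw [e]; exact hv0, by rw [e]; exact Anc.refl _ _⟩
      · exact h (h3 ▸ ⟨(S.mem j (by omega) h2).2.2, P.desc j h1 h2⟩)
  refine ⟨hval, S.zero, fun j h1 h2 => ?_, fun x hx h1 h2 => ?_,
    fun i j h1 h2 h3 => S.anti i j h1 h2 (by omega)⟩
  · obtain ⟨m1, m2, m3⟩ := S.mem j h1 (by omega)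
    refine ⟨m1, by omega, ?_⟩
    rw [hval _ m1, if_neg (fun h => hrest j h1 h2 h.2), m3]
  · rw [hval x hx] at h2
    split_ifs at h2 with h
    simp only [not_and] at h
    have hxv : x ≠ v := fun e => h h2 (e ▸ Anc.refl _ _)
    obtain ⟨i, i1, i2, i3⟩ := S.exists_mem x hx (by omega) h2
    refine ⟨i, i1, ?_, i3⟩
    by_contra hi
    exact h h2 (i3 ▸ P.desc i (by omega) i2)

end

theorem cutOff_run {n m : ℕ} {par up lo rt kk st : ℕ → ℕ} {v top : ℕ}
    (T : IsSearchTree n m par up lo) (H : CutInv n m par up lo rt kk (v + 1))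
    (S : StackInv n rt st top (v + 1)) (hv : 0 < v) (h : Store) (hpar : h.arr .par = par)
    (hrt : h.arr .rt = rt) (hst : h.arr .stack = st) (htop : h.reg .top = top)
    (hvv : h.reg .v = v) :
    ∃ t h', Cmd.cutOff.Run h t h' ∧
      (∀ y < n, h'.arr .rt y = if rt y = 0 ∧ Anc par v y then v + 1 else rt y) ∧
      StackInv n (h'.arr .rt) st (h'.reg .top) v ∧
      t + (Cmd.popStep.time + 7) * h'.reg .top ≤ (Cmd.popStep.time + 7) * top + 11 := by
  have r0 : (Cmd.put .rt (.var .v) (.succ (.var .v))).Run h _ _ := .put _ _ _ _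
  simp only [Expr.eval, hvv] at r0
  obtain ⟨t, h', φ, r, ⟨P, hφ⟩, hb, ht⟩ := Cmd.loop_run
    (b := .eq (.get .rt (.get .par (.get .stack (.var .top)))) (.succ (.var .v)))
    (p := Cmd.popStep)
    (fun φ g => PopInv n par rt st top v (g.arr .rt) (g.reg .top) ∧
      φ = (Cmd.popStep.time + 7) * g.reg .top)
    (h₀ := h.setCell .rt v (v + 1)) (φ₀ := (Cmd.popStep.time + 7) * top) (by
      rintro φ g hf ⟨P, rfl⟩ hb
      have e1 : g.arr .par = par := by rw [hf.arr _ rfl]; simpa using hpar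
      have e2 : g.arr .stack = st := by rw [hf.arr _ rfl]; simpa using hst
      have e3 : g.reg .v = v := by rw [hf.reg _ rfl]; simpa using hvv
      simp only [Cond.Holds, Expr.eval, e1, e2, e3] at hb
      obtain ⟨hpos, P'⟩ := P.step T H S hv hb
      obtain ⟨t, r, ht⟩ := Cmd.popStep.run_den rfl g
      refine ⟨t, _, _, r, ⟨?_, rfl⟩, ?_⟩
      · simpa [Cmd.popStep, Cmd.block, Cmd.den, Expr.eval, e2, e3] using P'
      · obtain ⟨k, hk⟩ := Nat.exists_eq_add_of_lt hpos
        have : (Cmd.popStep.den g).reg .top = k := by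
          simp [Cmd.popStep, Cmd.block, Cmd.den, Expr.eval, hk]
        rw [this, hk, zero_add, Nat.mul_succ]
        simp only [Cond.size, Expr.size]
        omega)
    (by
      refine ⟨?_, by simp [htop]⟩
      simp only [Store.setCell_arr, if_true, Store.setCell_reg, htop, hrt]
      refine ⟨le_rfl, fun j h1 h2 => by omega, by simp, fun j h1 h2 => by omega,
        fun y h1 _ => by rw [Function.update_of_ne h1]⟩)
  have e1 : h'.arr .par = par := by rw [r.frame.arr _ rfl]; simpa using hpar
  have e2 : h'.arr .stack = st := by rw [r.frame.arr _ rfl]; simpa using hst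
  have e3 : h'.reg .v = v := by rw [r.frame.reg _ rfl]; simpa using hvv
  simp only [Cond.Holds, Expr.eval, e1, e2, e3] at hb
  obtain ⟨f1, f2⟩ := P.finish T H S hv hb
  refine ⟨_, h', .seq r0 (.seq r (.skip _)), f1, f2, ?_⟩
  simp only [Cond.size, Expr.size] at ht ⊢
  omega

theorem countStep_walk {n m : ℕ} {par up lo rt kk : ℕ → ℕ} {v : ℕ}
    (T : IsSearchTree n m par up lo) (H : CutInv n m par up lo rt kk (v + 1))
    (hv : 0 < v) (h : Store) (hpar : h.arr .par = par) (hlo : h.arr .lo = lo)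
    (hrt : h.arr .rt = rt) (hkk : h.arr .kk = kk) (hvv : h.reg .v = v) (hacc : h.reg .acc = 0)
    (hch : IsChain (h.arr .unext) (h.arr .uhead v) (bucket up m v)) :
    ∃ t h', (Cmd.walk .i .j (.get .uhead (.var .v)) .unext Cmd.countStep).Run h t h' ∧
      h'.reg .acc = (inner m par up lo rt v).card ∧
      t ≤ (Cmd.countStep.time + 9) * (bucket up m v).length + 7 := by
  have hW : ((bucket up m v).map (weight par up lo rt kk)).sum
      = (inner m par up lo rt v).card := by
    rw [sum_bucket, H.card_inner T hv]
  obtain ⟨t, h', r, hI, ht⟩ := Cmd.walk_run (i := .i) (j := .j) (e := .get .uhead (.var .v))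
    (next := .unext) (p := Cmd.countStep)
    (fun l g => g.reg .acc + (l.map (weight par up lo rt kk)).sum
      = (inner m par up lo rt v).card) (h₀ := h) (l₀ := bucket up m v) rfl rfl rfl
    (fun k g c => by simp) (by simpa [Expr.eval, hvv] using hch) (by simp [hacc, hW]) (by
      intro k l g hk hf hsuf hI
      have hmem : k ∈ bucket up m v := hsuf.subset (by simp)
      obtain ⟨hkm, hkv⟩ := mem_bucket.1 hmem
      have e1 : g.arr .par = par := by rw [hf.arr _ rfl, hpar]
      have e2 : g.arr .lo = lo := by rw [hf.arr _ rfl, hlo]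
      have e3 : g.arr .rt = rt := by rw [hf.arr _ rfl, hrt]
      have e4 : g.arr .kk = kk := by rw [hf.arr _ rfl, hkk]
      have e5 : g.reg .v = v := by rw [hf.reg _ rfl, hvv]
      rw [List.map_cons, List.sum_cons] at hI
      have hval : (Cmd.countStep.den g).reg .acc
          = g.reg .acc + weight par up lo rt kk k := by
        simp only [Cmd.countStep, Cmd.block, Cmd.den, Cond.Holds, Expr.eval, e1, e2, e3, e4, e5,
          hk, Store.setVar_arr, Store.setVar_reg, reduceCtorEq, if_true, if_false, weight, hkv]
        by_cases h0 : rt (lo k) = 0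
        · have hlt := T.up_lt k hkm
          have h3 := (H.count (lo k) (T.lo_lt k hkm) (by omega) h0).2
          simp only [h0, if_true]
          by_cases hp : par (lo k) = v
          · simp only [hp, if_true]
            generalize kk (lo k) = x at h3
            interval_cases x <;> simp
          · simp [hp]
        · simp [h0]
      rw [hval]
      omega)
  exact ⟨t, h', r, by simpa using hI, by simpa [Expr.size] using ht⟩

/-- The cutting procedure works in time `O(n + m)`. -/
theorem cutting_run {n m : ℕ} {par up lo : ℕ → ℕ} (T : IsSearchTree n m par up lo) (hn0 : 0 < n)
    (h : Store) (hn : h.reg .n = n) (hm : h.reg .m = m) (htop : h.reg .top = 0)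
    (hpar : h.arr .par = par) (hup : h.arr .up = up) (hlo : h.arr .lo = lo)
    (hrt : h.arr .rt = fun _ => 0) (hst : h.arr .stack = fun _ => 0)
    (huh : h.arr .uhead = fun _ => 0) :
    ∃ t h', Cmd.cutting.Run h t h' ∧
      IsCutting n m par up lo (fun w => h'.arr .rt w - 1) ∧
      t ≤ (Cmd.countStep.time + Cmd.popStep.time + 60) * (n + m + 1) := by
  obtain ⟨t1, h1, r1, hc1, l1⟩ := Cmd.buildLists_run (key := .up) (head := .uhead)
    (next := .unext) (N := .m) (by decide) (by decide) (by decide) (by decide) h huh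
  rw [hup, hm] at hc1
  rw [hm] at l1
  set A := Cmd.countStep.time + 9 with hA
  set B := Cmd.popStep.time + 7 with hB
  have hn1 : h1.reg .n = n := by rw [r1.frame.reg _ rfl, hn]
  have hpar1 : h1.arr .par = par := by rw [r1.frame.arr _ rfl, hpar]
  have hlo1 : h1.arr .lo = lo := by rw [r1.frame.arr _ rfl, hlo]
  have hrt1 : h1.arr .rt = fun _ => 0 := by rw [r1.frame.arr _ rfl, hrt]
  have hst1 : h1.arr .stack = fun _ => 0 := by rw [r1.frame.arr _ rfl, hst]
  have htop1 : h1.reg .top = 0 := by rw [r1.frame.reg _ rfl, htop]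
  have hexlt : ∀ i ∈ extra m par up lo, up i < n := by
    intro i hi
    exact T.up_lt_n (by simpa using (Finset.mem_filter.1 hi).1)
  -- the body does nothing at the root, so that the invariant for `1` holds to the end
  obtain ⟨t2, h2, φ', r2, ⟨hinv, -, -⟩, l2⟩ := Cmd.forDown_run_amortized (x := .v) (N := .n)
    (p := Cmd.cutStep)
    (fun k φ g => CutInv n m par up lo (g.arr .rt) (g.arr .kk) (max k 1) ∧
      StackInv n (g.arr .rt) (g.arr .stack) (g.reg .top) (max k 1) ∧
      φ = B * g.reg .top + A * ∑ x ∈ Finset.range k, (bucket up m x).length)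
    (B + 40) (h₀ := h1) (φ₀ := A * m) rfl
    (fun k φ g c => by simp)
    (by
      rw [hn1, hrt1, hst1, htop1, max_eq_left (by omega)]
      have hlt : ∀ i < m, up i < n := fun i hi => T.up_lt_n hi
      refine ⟨⟨fun _ _ => rfl, fun _ _ _ _ => rfl, fun y _ h => absurd rfl h,
        fun x hx hx' => by omega, fun r hr h => by simp at h, fun c hc h => absurd rfl h⟩,
        ⟨rfl, fun j h1 h2 => by omega, fun x hx hx' => by omega, fun i j a b c => by omega⟩, ?_⟩
      rw [sum_length_bucket hlt]
      simp)
    (by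
      rintro k φ g hk hgv hf ⟨H, S, rfl⟩
      rw [hn1] at hk
      have e1 : g.arr .par = par := by rw [hf.arr _ rfl, hpar1]
      have e2 : g.arr .lo = lo := by rw [hf.arr _ rfl, hlo1]
      have e3 : ∀ x, IsChain (g.arr .unext) (g.arr .uhead x) (bucket up m x) := by
        rw [hf.arr .unext rfl, hf.arr .uhead rfl]; exact hc1
      rcases Nat.eq_zero_or_pos k with rfl | hk0
      · refine ⟨_, g, B * g.reg .top + A * 0, .ite_false ?_ (.skip g),
          ⟨H, S, by simp⟩, ?_⟩
        · simp [Cond.Holds, Expr.eval, hgv]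
        · simp only [Cond.size, Expr.size]
          generalize B * g.reg .top = X
          omega
      · rw [max_eq_left (by omega)] at H S ⊢
        have q0 : (Cmd.set .acc (.const 0)).Run g _ _ := .set _ _ _
        obtain ⟨t3, g3, q3, a3, l3⟩ := countStep_walk T H hk0 (g.setVar .acc 0)
          (by simpa using e1) (by simpa using e2) rfl rfl (by simpa using hgv) (by simp)
          (by simpa using e3 k)
        have q4 : (Cmd.put .kk (.var .v) (.var .acc)).Run g3 _ _ := .put _ _ _ _
        have f1 : g3.arr .rt = g.arr .rt := q3.frame.arr _ rfl
        have f2 : g3.arr .kk = g.arr .kk := q3.frame.arr _ rfl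
        have f3 : g3.arr .stack = g.arr .stack := q3.frame.arr _ rfl
        have f4 : g3.reg .v = k := by rw [q3.frame.reg _ rfl]; simpa using hgv
        have f5 : g3.reg .top = g.reg .top := q3.frame.reg _ rfl
        have f6 : g3.arr .par = par := by rw [q3.frame.arr _ rfl]; exact e1
        have hg : (Cond.lt (.const 0) (.var .v)).Holds g := by
          simp only [Cond.Holds, Expr.eval, hgv]; omega
        simp only [Expr.eval, f4, a3] at q4
        set c := (inner m par up lo (g.arr .rt) k).card with hc
        have hsum : A * ∑ x ∈ Finset.range (k + 1), (bucket up m x).length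
            = A * ∑ x ∈ Finset.range k, (bucket up m x).length + A * (bucket up m k).length := by
          rw [Finset.sum_range_succ, Nat.mul_add]
        by_cases hc4 : c < 4
        · have q5 : Cmd.push.Run (g3.setCell .kk k c) _ _ :=
            .seq (.set _ _ _) (.seq (.put _ _ _ _) (.skip _))
          simp only [Expr.eval, Store.setCell_reg, Store.setVar_reg, f4, f5, reduceCtorEq, if_true,
            if_false] at q5
          refine ⟨_, _, B * (g.reg .top + 1) +
            A * ∑ x ∈ Finset.range k, (bucket up m x).length, .ite_true hg
            (.seq q0 (.seq q3 (.seq q4 (.seq (.ite_true ?_ q5) (.skip _))))), ⟨?_, ?_, ?_⟩, ?_⟩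
          · simp [Cond.Holds, Expr.eval, a3, hc4]
          · simpa [f1, f2] using H.keep hk0 hc (by omega)
          · simpa [f1, f3] using S.push hk (H.below k (by omega))
          · simp
          · rw [hsum, Nat.mul_succ]
            simp only [Cond.size, Expr.size]
            generalize B * g.reg .top = X
            generalize A * ∑ x ∈ Finset.range k, (bucket up m x).length = Y
            generalize A * (bucket up m k).length = Z at l3 ⊢
            omega
        · obtain ⟨t5, g5, q5, a5, s5, l5⟩ := cutOff_run T H S hk0 (g3.setCell .kk k c)
            (by simpa using f6) (by simpa using f1) (by simpa using f3) (by simpa using f5)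
            (by simpa using f4)
          have f7 : g5.arr .kk = Function.update (g.arr .kk) k c := by
            rw [q5.frame.arr _ rfl]; simp [f2]
          have f8 : g5.arr .stack = g.arr .stack := by
            rw [q5.frame.arr _ rfl]; simp [f3]
          refine ⟨_, g5, B * g5.reg .top +
            A * ∑ x ∈ Finset.range k, (bucket up m x).length, .ite_true hg
            (.seq q0 (.seq q3 (.seq q4 (.seq (.ite_false ?_ q5) (.skip _))))), ⟨?_, ?_, ?_⟩, ?_⟩
          · simp only [Cond.Holds, Expr.eval, Store.setCell_reg, a3, hc4, not_false_iff]
          · refine H.cut T hk0 hk (by omega) a5 fun x hx => ?_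
            rw [f7, Function.update_of_ne hx]
          · rw [f8]; exact s5
          · rfl
          · rw [hsum]
            simp only [Cond.size, Expr.size]
            rw [← hB] at l5
            generalize B * g.reg .top = X at l5 ⊢
            generalize A * ∑ x ∈ Finset.range k, (bucket up m x).length = Y
            generalize A * (bucket up m k).length = Z at l3 ⊢
            omega)
  refine ⟨_, h2, .seq r1 (.seq r2 (.skip _)), ?_, ?_⟩
  · exact CutInv.isCutting T (by simpa using hinv)
  · rw [hn1] at l2
    have : t1 + (t2 + 0) ≤ (16 * m + 5) + (A * m + (B + 40 + 6) * n + 5) := by omega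
    refine this.trans ?_
    rw [hA, hB]
    generalize Cmd.countStep.time = C
    generalize Cmd.popStep.time = D
    nlinarith [Nat.zero_le (C * n), Nat.zero_le (D * m)]

/-! ### Optimal colourings of the pieces -/

/-- The sign `-1` of the colour `0` and the sign `1` of all other colours. -/
def spin (a : ℕ) : ℤ := if a = 0 then -1 else 1

theorem spin_mul_spin {a b : ℕ} (ha : a ≤ 1) (hb : b ≤ 1) :
    1 + spin a * spin b = 2 * (if a = b then 1 else 0) := by
  interval_cases a <;> interval_cases b <;> simp [spin]

theorem spin_eq (a : ℕ) : spin a = 1 ∨ spin a = -1 := by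
  unfold spin
  split_ifs <;> simp

/-- A forest with external fields `N` is minimized by the following rule. Every vertex sends to its
parent the message `- sign (A w)`, where `A w` is the sum of its field and of the messages it has
received; then every vertex takes the sign of `A w`, or the sign opposite to its parent's if
`A w = 0`. Indeed each term of the energy is bounded below by an expression that is linear in the
spin of the parent, these linear expressions cancel in the sum, and the rule attains the bound. -/
theorem forest_energy_le (W : Finset ℕ) (par : ℕ → ℕ) (N A : ℕ → ℤ)
    (hA : ∀ w ∈ W, A w = N w + ∑ x ∈ W.filter (fun x => par x = w), -(A x).sign)
    (z y : ℕ → ℤ) (hy : ∀ w, y w = 1 ∨ y w = -1) (hz : ∀ w, z w = 1 ∨ z w = -1)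
    (hzA : ∀ w ∈ W, (0 < A w → z w = 1) ∧ (A w < 0 → z w = -1) ∧
      (A w = 0 → par w ∈ W → z w = -z (par w))) :
    ∑ w ∈ W, -N w * z w + ∑ w ∈ W.filter (fun w => par w ∈ W), z w * z (par w)
      ≤ ∑ w ∈ W, -N w * y w + ∑ w ∈ W.filter (fun w => par w ∈ W), y w * y (par w) := by
  have key : ∀ x : ℕ → ℤ,
      ∑ w ∈ W, -N w * x w + ∑ w ∈ W.filter (fun w => par w ∈ W), x w * x (par w)
        = ∑ w ∈ W, (-A w * x w + if par w ∈ W then x w * x (par w) - (A w).sign * x (par w)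
          else 0) := by
    intro x
    have h1 : ∑ w ∈ W, A w * x w = ∑ w ∈ W, N w * x w
        + ∑ w ∈ W.filter (fun w => par w ∈ W), -(A w).sign * x (par w) := by
      have h2 : ∑ w ∈ W.filter (fun w => par w ∈ W), -(A w).sign * x (par w)
          = ∑ v ∈ W, ∑ w ∈ W.filter (fun w => par w = v), -(A w).sign * x v := by
        rw [← Finset.sum_fiberwise_of_maps_to (s := W.filter (fun w => par w ∈ W)) (t := W)
          (g := par) (fun w hw => (Finset.mem_filter.1 hw).2)]
        refine Finset.sum_congr rfl fun v hv => ?_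
        rw [Finset.filter_filter]
        refine Finset.sum_congr ?_ fun w hw => ?_
        · refine Finset.filter_congr fun w _ => ⟨fun h => h.2, fun h => ⟨h ▸ hv, h⟩⟩
        · rw [(Finset.mem_filter.1 hw).2]
      rw [h2, ← Finset.sum_add_distrib]
      refine Finset.sum_congr rfl fun v hv => ?_
      rw [hA v hv, ← Finset.sum_mul]
      ring
    rw [Finset.sum_add_distrib, ← Finset.sum_filter, Finset.sum_sub_distrib]
    simp only [neg_mul, Finset.sum_neg_distrib] at h1 ⊢
    rw [h1]
    ring
  rw [key, key]
  refine Finset.sum_le_sum fun w hw => ?_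
  obtain ⟨h1, h2, h3⟩ := hzA w hw
  rcases lt_trichotomy (A w) 0 with h | h | h
  · rw [h2 h, Int.sign_eq_neg_one_of_neg h]
    split_ifs
    · rcases hy w with e | e <;> rcases hy (par w) with e' | e' <;>
        rcases hz (par w) with e'' | e'' <;> rw [e, e', e''] <;> omega
    · rcases hy w with e | e <;> rw [e]
      omega
  · rw [h]
    split_ifs with hp
    · rw [h3 h hp]
      rcases hy w with e | e <;> rcases hy (par w) with e' | e' <;>
        rcases hz (par w) with e'' | e'' <;> rw [e, e', e''] <;> simp
    · simp
  · rw [h1 h, Int.sign_eq_one_of_pos h]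
    split_ifs
    · rcases hy w with e | e <;> rcases hy (par w) with e' | e' <;>
        rcases hz (par w) with e'' | e'' <;> rw [e, e', e''] <;> omega
    · rcases hy w with e | e <;> rw [e]
      omega

/-- The edges inside the pieces. -/
def internal (m : ℕ) (up lo root : ℕ → ℕ) : Finset ℕ :=
  (Finset.range m).filter fun i => root (up i) = root (lo i)

/-- Every label `w` other than the top of its piece lies below a child `sub w` of the top. -/
structure IsSub (n : ℕ) (par root sub : ℕ → ℕ) : Prop where
  top : ∀ w < n, root w ≠ w → par w = root w → sub w = w
  step : ∀ w < n, root w ≠ w → par w ≠ root w → sub w = sub (par w)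

/-- The colours of the labels with `idx w ≠ 0` will be prescribed: these are the tops of the pieces,
with index `4`, and the upper ends of the edges outside the tree inside the pieces, with different
indices between `1` and `3` below each child of a top. -/
structure IsIndexing (n m : ℕ) (par up lo root sub idx : ℕ → ℕ) : Prop where
  top : ∀ w < n, root w = w → idx w = 4
  up_ne : ∀ i ∈ extra m par up lo, root (up i) = root (lo i) → idx (up i) ≠ 0
  le : ∀ w < n, root w ≠ w → idx w ≤ 3
  inj : ∀ w < n, ∀ x < n, root w ≠ w → root x ≠ x → idx w ≠ 0 → sub w = sub x → idx w = idx x → w = x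

/-- The edges inside a piece with lower end below the child `c` of the top. -/
def branch (m : ℕ) (up lo root sub : ℕ → ℕ) (c : ℕ) : Finset ℕ :=
  (internal m up lo root).filter fun i => sub (lo i) = c

/-- The number of those edges that are not in the cut given by the colouring `x`. -/
def badIn (m : ℕ) (up lo root sub x : ℕ → ℕ) (c : ℕ) : ℕ :=
  ((branch m up lo root sub c).filter fun i => x (up i) = x (lo i)).card

/-- The sum of the signs opposite to those of the neighbours of `w` in its piece with prescribed
colours. -/
def force (m : ℕ) (up lo root idx x : ℕ → ℕ) (w : ℕ) : ℤ :=
  ∑ i ∈ internal m up lo root,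
    ((if lo i = w ∧ idx (up i) ≠ 0 then -spin (x (up i)) else 0) +
      (if up i = w ∧ idx (lo i) ≠ 0 then -spin (x (lo i)) else 0))

/-- The outcome `x` of the dynamic programme with prescribed colours `mask (idx w)`. -/
structure IsPass (n m : ℕ) (par up lo root idx mask : ℕ → ℕ) (D : ℕ → ℤ) (x : ℕ → ℕ) : Prop where
  le : ∀ w < n, x w ≤ 1
  fixed : ∀ w < n, idx w ≠ 0 → x w = mask (idx w)
  balance : ∀ w < n, D w = force m up lo root idx x w
    + ∑ v ∈ (Finset.range n).filter (fun v => idx v = 0 ∧ par v = w), -(D v).sign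
  free : ∀ w < n, idx w = 0 → (0 < D w → x w = 1) ∧ (D w < 0 → x w = 0) ∧
    (D w = 0 → x w = if x (par w) = 0 then 1 else 0)

section

variable {n m : ℕ} {par up lo root sub idx mask : ℕ → ℕ} {D : ℕ → ℤ} {x : ℕ → ℕ}

theorem IsCutting.root_ne_lo (T : IsSearchTree n m par up lo) (C : IsCutting n m par up lo root)
    {i : ℕ} (hi : i < m) (h : root (up i) = root (lo i)) : root (lo i) ≠ lo i := by
  have h1 := C.le _ (T.up_lt_n hi)
  have h2 := T.up_lt i hi
  omega

theorem IsSub.eq_of_anc (T : IsSearchTree n m par up lo) (C : IsCutting n m par up lo root)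
    (S : IsSub n par root sub) {u w : ℕ} (hw : w < n) (h : Anc par u w)
    (hr : root u = root w) (hu : root u ≠ u) : sub u = sub w := by
  induction w using Nat.strong_induction_on with
  | _ w ih =>
    by_cases e : u = w
    · rw [e]
    · have hanc := h.par_of_ne e
      have hle := T.parent.anc_le hw h
      have hun : u < n := hle.trans_lt hw
      have h1 := C.le u hun
      have hw' : root w ≠ w := by omega
      have hpn : par w < n := (T.parent.le hw).trans_lt hw
      have h2 := T.parent.anc_le hpn hanc
      have hlt := T.parent.lt w (by omega) hw
      rw [S.step w hw hw' (by omega)]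
      exact ih _ hlt hpn hanc (hr.trans (C.root_par w hw hw').symm)

theorem IsSub.par_sub (T : IsSearchTree n m par up lo) (C : IsCutting n m par up lo root)
    (S : IsSub n par root sub) {w : ℕ} (hw : w < n) (hr : root w ≠ w) :
    par (sub w) = root w ∧ root (sub w) = root w ∧ Anc par (sub w) w ∧ sub w ≠ root w := by
  induction w using Nat.strong_induction_on with
  | _ w ih =>
    by_cases e : par w = root w
    · rw [S.top w hw hr e]
      exact ⟨e, rfl, Anc.refl _ _, Ne.symm hr⟩
    · have hpn : par w < n := (T.parent.le hw).trans_lt hw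
      have h0 : 0 < w := by
        rcases Nat.eq_zero_or_pos w with rfl | h
        · exact absurd (Nat.le_zero.1 (C.le 0 hw)) hr
        · exact h
      have hrp := C.root_par w hw hr
      rw [S.step w hw hr e]
      obtain ⟨h1, h2, h3, h4⟩ := ih _ (T.parent.lt w h0 hw) hpn (by rw [hrp]; exact Ne.symm e)
      exact ⟨h1.trans hrp, h2.trans hrp, h3.of_par, hrp ▸ h4⟩

/-- The lower end of an edge of a branch is in the branch, and so is the upper end unless it is the
top of the piece. -/
theorem branch_ends (T : IsSearchTree n m par up lo) (C : IsCutting n m par up lo root)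
    (S : IsSub n par root sub) {i c : ℕ} (hi : i ∈ branch m up lo root sub c) :
    i < m ∧ root (up i) = root (lo i) ∧ root (lo i) ≠ lo i ∧ sub (lo i) = c ∧
      (root (up i) ≠ up i ∧ sub (up i) = c ∨ root (up i) = up i ∧ up i = par c) := by
  simp only [branch, internal, Finset.mem_filter, Finset.mem_range] at hi
  obtain ⟨⟨hm, hr⟩, hc⟩ := hi
  have hlo := C.root_ne_lo T hm hr
  refine ⟨hm, hr, hlo, hc, ?_⟩
  by_cases e : root (up i) = up i
  · refine .inr ⟨e, ?_⟩
    rw [← hc, (S.par_sub T C (T.lo_lt i hm) hlo).1, ← hr, e]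
  · exact .inl ⟨e, (S.eq_of_anc T C (T.lo_lt i hm) (T.anc i hm) hr e).trans hc⟩

theorem two_mul_badIn (T : IsSearchTree n m par up lo) {y : ℕ → ℕ} (hy : ∀ w < n, y w ≤ 1)
    (c : ℕ) :
    2 * (badIn m up lo root sub y c : ℤ) = (branch m up lo root sub c).card
      + ∑ i ∈ branch m up lo root sub c, spin (y (up i)) * spin (y (lo i)) := by
  rw [badIn, Finset.card_filter, Finset.card_eq_sum_ones]
  push_cast
  rw [Finset.mul_sum, ← Finset.sum_add_distrib]
  refine Finset.sum_congr rfl fun i hi => ?_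
  have hi : i < m := by
    simp only [branch, internal, Finset.mem_filter, Finset.mem_range] at hi
    exact hi.1.1
  rw [spin_mul_spin (hy _ (T.up_lt_n hi)) (hy _ (T.lo_lt i hi))]

/-- The edges of a branch contribute a constant, the interaction of the labels without prescribed
colour with those with a prescribed one, and the interaction along the tree edges between the
former. -/
theorem sum_branch (T : IsSearchTree n m par up lo) (C : IsCutting n m par up lo root)
    (S : IsSub n par root sub) (I : IsIndexing n m par up lo root sub idx) {y : ℕ → ℕ} {c : ℕ}
    (hyx : ∀ w < n, idx w ≠ 0 → (root w ≠ w ∧ sub w = c ∨ root w = w ∧ w = par c) → y w = x w)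
    {W : Finset ℕ} (hW : ∀ w, w ∈ W ↔ w < n ∧ root w ≠ w ∧ idx w = 0 ∧ sub w = c) :
    ∑ i ∈ branch m up lo root sub c, spin (y (up i)) * spin (y (lo i))
      = ∑ i ∈ (branch m up lo root sub c).filter (fun i => idx (up i) ≠ 0 ∧ idx (lo i) ≠ 0),
          spin (x (up i)) * spin (x (lo i))
        + (∑ w ∈ W, -force m up lo root idx x w * spin (y w)
          + ∑ w ∈ W.filter (fun w => par w ∈ W), spin (y w) * spin (y (par w))) := by
  have hends : ∀ i ∈ branch m up lo root sub c, (lo i ∈ W ↔ idx (lo i) = 0) ∧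
      (up i ∈ W ↔ idx (up i) = 0) := by
    intro i hi
    obtain ⟨hm, hr, hlo, hc, hup⟩ := branch_ends T C S hi
    refine ⟨?_, ?_⟩
    · rw [hW]
      exact ⟨fun h => h.2.2.1, fun h => ⟨T.lo_lt i hm, hlo, h, hc⟩⟩
    · rw [hW]
      refine ⟨fun h => h.2.2.1, fun h => ⟨T.up_lt_n hm, ?_, h, ?_⟩⟩
      · intro e
        rw [I.top _ (T.up_lt_n hm) e] at h
        omega
      · rcases hup with h' | h'
        · exact h'.2
        · rw [I.top _ (T.up_lt_n hm) h'.1] at h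
          omega
  have hfield : ∑ w ∈ W, -force m up lo root idx x w * spin (y w)
      = ∑ i ∈ branch m up lo root sub c,
        ((if idx (lo i) = 0 ∧ idx (up i) ≠ 0 then spin (x (up i)) * spin (y (lo i)) else 0)
        + (if idx (up i) = 0 ∧ idx (lo i) ≠ 0 then spin (x (lo i)) * spin (y (up i)) else 0)) := by
    have h1 : ∑ w ∈ W, -force m up lo root idx x w * spin (y w)
        = ∑ i ∈ internal m up lo root,
          ((if lo i ∈ W ∧ idx (up i) ≠ 0 then spin (x (up i)) * spin (y (lo i)) else 0)
          + (if up i ∈ W ∧ idx (lo i) ≠ 0 then spin (x (lo i)) * spin (y (up i)) else 0)) := by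
      simp only [force, ← Finset.sum_neg_distrib, Finset.sum_mul]
      rw [Finset.sum_comm]
      refine Finset.sum_congr rfl fun i _ => ?_
      simp only [neg_add, add_mul, Finset.sum_add_distrib]
      congr 1
      · by_cases e : idx (up i) ≠ 0
        · simp [e, apply_ite Neg.neg, ite_mul]
        · simp [e]
      · by_cases e : idx (lo i) ≠ 0
        · simp [e, apply_ite Neg.neg, ite_mul]
        · simp [e]
    rw [h1]
    symm
    rw [branch, Finset.sum_filter]
    refine Finset.sum_congr rfl fun i hi => ?_
    by_cases hc : sub (lo i) = c
    · have hib : i ∈ branch m up lo root sub c := Finset.mem_filter.2 ⟨hi, hc⟩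
      simp only [if_pos hc, (hends i hib).1, (hends i hib).2]
    · have hm : i < m := by simpa using (Finset.mem_filter.1 hi).1
      have hr : root (up i) = root (lo i) := (Finset.mem_filter.1 hi).2
      have h2 : lo i ∉ W := fun h => hc ((hW _).1 h).2.2.2
      have h3 : up i ∉ W := fun h => hc
        ((S.eq_of_anc T C (T.lo_lt i hm) (T.anc i hm) hr ((hW _).1 h).2.1).symm.trans
          ((hW _).1 h).2.2.2)
      simp [hc, h2, h3]
  have htree : ∑ w ∈ W.filter (fun w => par w ∈ W), spin (y w) * spin (y (par w))
      = ∑ i ∈ (branch m up lo root sub c).filter (fun i => idx (up i) = 0 ∧ idx (lo i) = 0),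
        spin (y (up i)) * spin (y (lo i)) := by
    have hpar : ∀ i ∈ (branch m up lo root sub c).filter
        (fun i => idx (up i) = 0 ∧ idx (lo i) = 0), par (lo i) = up i := by
      intro i hi
      obtain ⟨hi, h1, h2⟩ := Finset.mem_filter.1 hi
      obtain ⟨hm, hr, -⟩ := branch_ends T C S hi
      by_contra hne
      exact I.up_ne i (by simp [extra, hm, hne]) hr h1
    symm
    refine Finset.sum_nbij lo ?_ ?_ ?_ ?_
    · intro i hi
      have := hpar i hi
      obtain ⟨hi, h1, h2⟩ := Finset.mem_filter.1 hi
      rw [Finset.mem_filter, this]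
      exact ⟨(hends i hi).1.2 h2, (hends i hi).2.2 h1⟩
    · intro i hi j hj hij
      have e1 := hpar i hi
      have e2 := hpar j hj
      have m1 := (branch_ends T C S (Finset.mem_filter.1 hi).1).1
      have m2 := (branch_ends T C S (Finset.mem_filter.1 hj).1).1
      exact T.inj i m1 j m2 (by rw [← e1, ← e2, hij]) hij
    · intro w hw
      obtain ⟨hw, hpw⟩ := Finset.mem_filter.1 hw
      have hw' := (hW w).1 hw
      have hpw' := (hW _).1 hpw
      have h0 : 0 < w := by
        rcases Nat.eq_zero_or_pos w with rfl | h
        · exact absurd (Nat.le_zero.1 (C.le 0 hw'.1)) hw'.2.1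
        · exact h
      obtain ⟨i, hm, e1, e2⟩ := T.tree w h0 hw'.1
      refine ⟨i, ?_, e2⟩
      simp only [branch, internal, Finset.coe_filter, Finset.mem_filter, Finset.mem_range,
        Set.mem_ofPred_eq, e1, e2]
      exact ⟨⟨⟨hm, C.root_par w hw'.1 hw'.2.1⟩, hw'.2.2.2⟩, hpw'.2.2.1, hw'.2.2.1⟩
    · intro i hi
      rw [hpar i hi, mul_comm]
  rw [hfield, htree, Finset.sum_filter, Finset.sum_filter, ← Finset.sum_add_distrib,
    ← Finset.sum_add_distrib]
  refine Finset.sum_congr rfl fun i hi => ?_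
  obtain ⟨hm, hr, hlo, hc, hup⟩ := branch_ends T C S hi
  have h1 : idx (lo i) ≠ 0 → y (lo i) = x (lo i) := fun h =>
    hyx _ (T.lo_lt i hm) h (.inl ⟨hlo, hc⟩)
  have h2 : idx (up i) ≠ 0 → y (up i) = x (up i) := fun h => hyx _ (T.up_lt_n hm) h hup
  by_cases e1 : idx (lo i) = 0 <;> by_cases e2 : idx (up i) = 0
  · simp [e1, e2]
  · simp [e1, e2, h2 e2]
  · simp [e1, e2, h1 e1, mul_comm]
  · simp [e1, e2, h1 e1, h2 e2]

/-- The dynamic programme is optimal on every branch among the colourings with the prescribed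
colours. -/
theorem IsPass.badIn_le (T : IsSearchTree n m par up lo) (C : IsCutting n m par up lo root)
    (S : IsSub n par root sub) (I : IsIndexing n m par up lo root sub idx)
    (P : IsPass n m par up lo root idx mask D x) {c : ℕ} {y : ℕ → ℕ} (hy : ∀ w < n, y w ≤ 1)
    (hyx : ∀ w < n, idx w ≠ 0 → (root w ≠ w ∧ sub w = c ∨ root w = w ∧ w = par c) → y w = x w) :
    badIn m up lo root sub x c ≤ badIn m up lo root sub y c := by
  set W := (Finset.range n).filter (fun w => root w ≠ w ∧ idx w = 0 ∧ sub w = c) with hWdef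
  have hW : ∀ w, w ∈ W ↔ w < n ∧ root w ≠ w ∧ idx w = 0 ∧ sub w = c := by
    intro w
    simp [hWdef]
  have h1 := two_mul_badIn (root := root) (sub := sub) T P.le c
  have h2 := two_mul_badIn (root := root) (sub := sub) T hy c
  rw [sum_branch T C S I (x := x) (fun _ _ _ _ => rfl) hW] at h1
  rw [sum_branch T C S I hyx hW] at h2
  have hnt : ∀ v < n, idx v = 0 → root v ≠ v := by
    intro v hv h0 e
    rw [I.top v hv e] at h0
    omega
  have h3 := forest_energy_le W par (force m up lo root idx x) D (fun w hw => by
    have hw' := (hW w).1 hw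
    rw [P.balance w hw'.1]
    congr 1
    refine Finset.sum_congr ?_ fun _ _ => rfl
    ext v
    simp only [Finset.mem_filter, Finset.mem_range, hW]
    constructor
    · rintro ⟨hv, h0, hp⟩
      have hr := hnt v hv h0
      have hrp := C.root_par v hv hr
      rw [hp] at hrp
      refine ⟨⟨hv, hr, h0, ?_⟩, hp⟩
      rw [S.step v hv hr (by rw [hp, ← hrp]; exact Ne.symm hw'.2.1), hp]
      exact hw'.2.2.2
    · rintro ⟨⟨hv, hr, h0, hc⟩, hp⟩
      exact ⟨hv, h0, hp⟩)
    (fun w => spin (x w)) (fun w => spin (y w)) (fun w => spin_eq _) (fun w => spin_eq _)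
    (fun w hw => by
      have hw' := (hW w).1 hw
      obtain ⟨f1, f2, f3⟩ := P.free w hw'.1 hw'.2.2.1
      refine ⟨fun h => by simp [f1 h, spin], fun h => by simp [f2 h, spin], fun h _ => ?_⟩
      rw [f3 h]
      by_cases e : x (par w) = 0 <;> simp [spin, e])
  have h4 : (2 : ℤ) * badIn m up lo root sub x c ≤ 2 * badIn m up lo root sub y c := by
    rw [h1, h2]
    linarith
  omega

end

/-! ### Computing the branches and the labels with prescribed colours -/

namespace Cmd

open SparseMaxCut.Expr (var const get succ pred)

/-- Compute the top of the piece of the label `w` and the branch that contains `w`. -/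
def labelStep : Cmd :=
  block [put .root (var .w) (pred (get .rt (var .w))),
    ite (.eq (get .root (var .w)) (var .w))
      (put .idx (var .w) (const 4))
      (ite (.eq (get .par (var .w)) (get .root (var .w)))
        (put .sub (var .w) (var .w))
        (put .sub (var .w) (get .sub (get .par (var .w)))))]

/-- Give the upper end of the edge `i` the next free index of its branch, if the edge lies outside
the tree and inside a piece, and if its upper end has no index yet. -/
def indexStep : Cmd :=
  block [set .u (get .up (var .i)), set .w (get .lo (var .i)),
    ite (.eq (get .par (var .w)) (var .u)) skip
      (ite (.eq (get .root (var .u)) (get .root (var .w)))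
        (ite (.eq (get .idx (var .u)) (const 0))
          (block [put .count (get .sub (var .u)) (succ (get .count (get .sub (var .u)))),
            put .idx (var .u) (get .count (get .sub (var .u)))])
          skip)
        skip)]

end Cmd

theorem IsCutting.congr {n m : ℕ} {par up lo root root' : ℕ → ℕ} (T : IsSearchTree n m par up lo)
    (C : IsCutting n m par up lo root) (h : ∀ w < n, root' w = root w) :
    IsCutting n m par up lo root' := by
  have hpar : ∀ w < n, par w < n := fun w hw => (T.parent.le hw).trans_lt hw
  have hex : ∀ i ∈ extra m par up lo, root' (up i) = root (up i) ∧ root' (lo i) = root (lo i) := by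
    intro i hi
    have hi : i < m := by simpa using (Finset.mem_filter.1 hi).1
    exact ⟨h _ (T.up_lt_n hi), h _ (T.lo_lt i hi)⟩
  refine ⟨fun w hw => ?_, fun w hw => ?_, fun w hw hr => ?_, fun s hs h1 h2 => ?_,
    fun c hc hr => ?_⟩
  · rw [h w hw]; exact C.le w hw
  · rw [h w hw, h _ ((C.le w hw).trans_lt hw)]; exact C.root_root w hw
  · rw [h w hw] at hr ⊢
    rw [h _ (hpar w hw)]
    exact C.root_par w hw hr
  · rw [h s hs] at h2
    refine (C.big s hs h1 h2).trans (Finset.card_le_card fun i hi => ?_)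
    simp only [Finset.mem_filter] at hi ⊢
    rw [(hex i hi.1).1, (hex i hi.1).2]
    exact hi
  · rw [h c hc] at hr ⊢
    refine (Finset.card_le_card fun i hi => ?_).trans (C.small c hc hr)
    simp only [Finset.mem_filter] at hi ⊢
    rw [(hex i hi.1).1, (hex i hi.1).2] at hi
    exact hi

theorem label_run {n m : ℕ} {par up lo : ℕ → ℕ} (T : IsSearchTree n m par up lo) (h : Store)
    (C : IsCutting n m par up lo (fun w => h.arr .rt w - 1)) (hn : h.reg .n = n)
    (hpar : h.arr .par = par) (hidx : h.arr .idx = fun _ => 0) :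
    ∃ t h', (Cmd.forUp .w .n Cmd.labelStep).Run h t h' ∧
      IsCutting n m par up lo (h'.arr .root) ∧ IsSub n par (h'.arr .root) (h'.arr .sub) ∧
      (∀ w < n, h'.arr .idx w = if h'.arr .root w = w then 4 else 0) ∧
      t ≤ (Cmd.labelStep.time + 6) * n + 5 := by
  obtain ⟨t, h', r, ⟨h1, h2⟩, ht⟩ := Cmd.forUp_run (x := .w) (N := .n) (p := Cmd.labelStep)
    (fun k g => (∀ w < k, g.arr .root w = h.arr .rt w - 1 ∧
      g.arr .idx w = (if g.arr .root w = w then 4 else 0) ∧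
      (g.arr .root w ≠ w → (par w = g.arr .root w → g.arr .sub w = w) ∧
        (par w ≠ g.arr .root w → g.arr .sub w = g.arr .sub (par w)))) ∧
      ∀ w, k ≤ w → g.arr .idx w = 0) (h₀ := h) rfl rfl rfl (by decide) (fun k g c hI => hI)
    ⟨fun w hw => absurd hw (Nat.not_lt_zero w), fun w _ => by rw [hidx]⟩ (by
      rintro k g hk hgw hf ⟨hI, hI'⟩
      rw [hn] at hk
      have e1 : g.arr .par = par := by rw [hf.arr _ rfl, hpar]
      have e2 : g.arr .rt = h.arr .rt := hf.arr _ rfl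
      have hk' : h.arr .rt k - 1 ≠ k → par k < k := by
        intro hne
        have := C.le k hk
        exact T.parent.lt k (by omega) hk
      have hpk : ∀ w < k, h.arr .rt w - 1 ≠ w → par w < k := fun w hw _ =>
        (T.parent.le (hw.trans hk)).trans_lt hw
      simp only [Cmd.labelStep, Cmd.block, Cmd.den, Cond.Holds, Expr.eval, e1, e2, hgw,
        Store.setCell_arr, Store.setCell_reg, reduceCtorEq, if_true, if_false,
        Function.update_self]
      by_cases c1 : h.arr .rt k - 1 = k
      · simp only [c1, if_true, Store.setCell_arr, reduceCtorEq, if_false]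
        refine ⟨fun w hw => ?_, fun w hw => ?_⟩
        · rcases Nat.lt_succ_iff_lt_or_eq.1 hw with hw | rfl
          · rw [Function.update_of_ne (by omega), Function.update_of_ne (by omega)]
            exact hI w hw
          · simp [c1]
        · rw [Function.update_of_ne (by omega)]
          exact hI' w (by omega)
      · simp only [c1, if_false]
        have hk'' := hk' c1
        by_cases c2 : par k = h.arr .rt k - 1
        · simp only [c2, if_true, Store.setCell_arr, reduceCtorEq, if_false]
          refine ⟨fun w hw => ?_, fun w hw => hI' w (by omega)⟩
          rcases Nat.lt_succ_iff_lt_or_eq.1 hw with hw | rfl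
          · obtain ⟨i1, i2, i3⟩ := hI w hw
            rw [Function.update_of_ne (by omega), Function.update_of_ne (by omega)]
            refine ⟨i1, i2, fun hne => ?_⟩
            have := hpk w hw (i1 ▸ hne)
            rw [Function.update_of_ne (by omega)]
            exact i3 hne
          · simp [c1, c2, hI' w le_rfl]
        · simp only [c2, if_false, Store.setCell_arr, reduceCtorEq, if_true]
          refine ⟨fun w hw => ?_, fun w hw => hI' w (by omega)⟩
          rcases Nat.lt_succ_iff_lt_or_eq.1 hw with hw | rfl
          · obtain ⟨i1, i2, i3⟩ := hI w hw
            rw [Function.update_of_ne (by omega), Function.update_of_ne (by omega)]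
            refine ⟨i1, i2, fun hne => ?_⟩
            have := hpk w hw (i1 ▸ hne)
            rw [Function.update_of_ne (by omega)]
            exact i3 hne
          · simp [c1, c2, hI' w le_rfl, Function.update_of_ne hk''.ne])
  rw [hn] at h1 ht
  refine ⟨t, h', r, C.congr T fun w hw => (h1 w hw).1, ⟨fun w hw hr => ((h1 w hw).2.2 hr).1,
    fun w hw hr => ((h1 w hw).2.2 hr).2⟩, fun w hw => (h1 w hw).2.1, ht⟩

/-- The state of the distribution of the indices when the edges below `k` have been processed;
`cnt c` is the number of indices in the branch `c`. -/
structure IndexInv (n m : ℕ) (par up lo root sub idx cnt : ℕ → ℕ) (k : ℕ) : Prop where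
  top : ∀ w < n, root w = w → idx w = 4
  up_ne : ∀ i ∈ extra m par up lo, i < k → root (up i) = root (lo i) → idx (up i) ≠ 0
  exists_up : ∀ w < n, root w ≠ w → idx w ≠ 0 →
    ∃ i ∈ extra m par up lo, root (up i) = root (lo i) ∧ up i = w
  le : ∀ w < n, root w ≠ w → idx w ≤ cnt (sub w)
  inj : ∀ w < n, ∀ x < n, root w ≠ w → root x ≠ x → idx w ≠ 0 → sub w = sub x → idx w = idx x → w = x
  cnt : ∀ c, cnt c = ((Finset.range n).filter fun w => root w ≠ w ∧ idx w ≠ 0 ∧ sub w = c).card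

theorem IndexInv.isIndexing {n m : ℕ} {par up lo root sub idx cnt : ℕ → ℕ}
    (T : IsSearchTree n m par up lo) (C : IsCutting n m par up lo root)
    (S : IsSub n par root sub) (H : IndexInv n m par up lo root sub idx cnt m) :
    IsIndexing n m par up lo root sub idx := by
  refine ⟨H.top, fun i hi hr => H.up_ne i hi (by simpa using (Finset.mem_filter.1 hi).1) hr,
    fun w hw hr => (H.le w hw hr).trans ?_, H.inj⟩
  obtain ⟨h1, h2, h3, h4⟩ := S.par_sub T C hw hr
  rw [H.cnt]
  have hcn : sub w < n := (T.parent.anc_le hw h3).trans_lt hw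
  refine le_trans ?_ (C.small (sub w) hcn (by rw [h2]; exact Ne.symm h4))
  refine (Finset.card_le_card fun x hx => ?_).trans (Finset.card_image_le (f := up))
  simp only [Finset.mem_filter, Finset.mem_range] at hx
  obtain ⟨hx, hxr, hx0, hxs⟩ := hx
  obtain ⟨i, hi, hri, rfl⟩ := H.exists_up x hx hxr hx0
  obtain ⟨g1, g2, g3, g4⟩ := S.par_sub T C hx hxr
  rw [hxs] at g1 g2 g3
  refine Finset.mem_image.2 ⟨i, Finset.mem_filter.2 ⟨hi, g3, ?_, ?_⟩, rfl⟩
  · rw [g2]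
  · rw [← hri, g2]

theorem IndexInv.assign {n m : ℕ} {par up lo root sub idx cnt : ℕ → ℕ} {k : ℕ}
    (T : IsSearchTree n m par up lo) (H : IndexInv n m par up lo root sub idx cnt k)
    (hk : k ∈ extra m par up lo) (hr : root (up k) = root (lo k)) (h0 : idx (up k) = 0) :
    IndexInv n m par up lo root sub
      (Function.update idx (up k) (cnt (sub (up k)) + 1))
      (Function.update cnt (sub (up k)) (cnt (sub (up k)) + 1)) (k + 1) := by
  have hkm : k < m := by simpa using (Finset.mem_filter.1 hk).1
  have hun : up k < n := T.up_lt_n hkm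
  have hur : root (up k) ≠ up k := fun e => by
    rw [H.top _ hun e] at h0
    omega
  set u := up k with hu
  refine ⟨fun w hw hwr => ?_, fun i hi hik hri => ?_, fun w hw hwr hw0 => ?_, fun w hw hwr => ?_,
    fun w hw x hx hwr hxr hw0 hs he => ?_, fun c => ?_⟩
  · rw [Function.update_of_ne (by rintro rfl; exact hur hwr)]
    exact H.top w hw hwr
  · by_cases e : up i = u
    · rw [e, Function.update_self]
      omega
    · rw [Function.update_of_ne e]
      refine H.up_ne i hi ?_ hri
      rcases Nat.lt_succ_iff_lt_or_eq.1 hik with h | rfl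
      · exact h
      · exact absurd rfl e
  · by_cases e : w = u
    · exact ⟨k, hk, hr, e.symm⟩
    · rw [Function.update_of_ne e] at hw0
      exact H.exists_up w hw hwr hw0
  · have h1 := H.le w hw hwr
    by_cases e : w = u
    · rw [e, Function.update_self, Function.update_self]
    · rw [Function.update_of_ne e]
      by_cases e' : sub w = sub u
      · rw [e', Function.update_self]
        rw [e'] at h1
        omega
      · rw [Function.update_of_ne e']
        exact h1
  · have h1 := H.le w hw hwr
    have h2 := H.le x hx hxr
    by_cases e : w = u
    · by_cases e' : x = u
      · rw [e, e']
      · rw [e, Function.update_self, Function.update_of_ne e'] at he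
        rw [← hs, e] at h2
        omega
    · rw [Function.update_of_ne e] at he hw0
      by_cases e' : x = u
      · rw [e', Function.update_self] at he
        rw [hs, e'] at h1
        omega
      · rw [Function.update_of_ne e'] at he
        exact H.inj w hw x hx hwr hxr hw0 hs he
  · have h1 := H.cnt c
    have hset : ∀ w, w ≠ u → ((root w ≠ w ∧ Function.update idx u (cnt (sub u) + 1) w ≠ 0 ∧
        sub w = c) ↔ (root w ≠ w ∧ idx w ≠ 0 ∧ sub w = c)) := by
      intro w hw
      rw [Function.update_of_ne hw]
    by_cases e : sub u = c
    · subst e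
      rw [Function.update_self, h1]
      have : ((Finset.range n).filter fun w => root w ≠ w ∧
          Function.update idx u (cnt (sub u) + 1) w ≠ 0 ∧ sub w = sub u)
          = insert u ((Finset.range n).filter fun w => root w ≠ w ∧ idx w ≠ 0 ∧ sub w = sub u) := by
        ext w
        by_cases e : w = u
        · subst e
          simp [hun, hur]
        · simp only [Finset.mem_filter, Finset.mem_insert, e, false_or, hset w e]
      rw [h1] at this
      rw [this, Finset.card_insert_of_notMem]
      simp [h0]
    · rw [Function.update_of_ne (Ne.symm e), h1]
      congr 1
      ext w
      by_cases e' : w = u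
      · subst e'
        simp [e]
      · simp only [Finset.mem_filter, hset w e']

theorem index_run {n m : ℕ} {par up lo root sub : ℕ → ℕ} (T : IsSearchTree n m par up lo)
    (C : IsCutting n m par up lo root) (S : IsSub n par root sub) (h : Store)
    (hm : h.reg .m = m) (hpar : h.arr .par = par) (hup : h.arr .up = up) (hlo : h.arr .lo = lo)
    (hroot : h.arr .root = root) (hsub : h.arr .sub = sub) (hcount : h.arr .count = fun _ => 0)
    (hidx : ∀ w < n, h.arr .idx w = if root w = w then 4 else 0) :
    ∃ t h', (Cmd.forUp .i .m Cmd.indexStep).Run h t h' ∧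
      IsIndexing n m par up lo root sub (h'.arr .idx) ∧
      t ≤ (Cmd.indexStep.time + 6) * m + 5 := by
  obtain ⟨t, h', r, h1, ht⟩ := Cmd.forUp_run (x := .i) (N := .m) (p := Cmd.indexStep)
    (fun k g => IndexInv n m par up lo root sub (g.arr .idx) (g.arr .count) k)
    (h₀ := h) rfl rfl rfl (by decide) (fun k g c => by simp)
    (by
      rw [hcount]
      have hne : ∀ w < n, root w ≠ w → h.arr .idx w = 0 := fun w hw hr => by
        rw [hidx w hw, if_neg hr]
      refine ⟨fun w hw hr => by rw [hidx w hw, if_pos hr], fun i _ hi => by omega,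
        fun w hw hr h0 => absurd (hne w hw hr) h0, fun w hw hr => by rw [hne w hw hr],
        fun w hw x hx hr _ h0 => absurd (hne w hw hr) h0, fun c => ?_⟩
      symm
      rw [Finset.card_eq_zero, Finset.filter_eq_empty_iff]
      rintro w hw ⟨hr, h0, -⟩
      exact h0 (hne w (Finset.mem_range.1 hw) hr)) (by
      rintro k g hk hgi hf hI
      rw [hm] at hk
      have e1 : g.arr .par = par := by rw [hf.arr _ rfl, hpar]
      have e2 : g.arr .up = up := by rw [hf.arr _ rfl, hup]
      have e3 : g.arr .lo = lo := by rw [hf.arr _ rfl, hlo]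
      have e4 : g.arr .root = root := by rw [hf.arr _ rfl, hroot]
      have e5 : g.arr .sub = sub := by rw [hf.arr _ rfl, hsub]
      -- nothing has to be done if the edge imposes no new condition
      have hskip : (k ∈ extra m par up lo → root (up k) = root (lo k) → g.arr .idx (up k) ≠ 0) →
          IndexInv n m par up lo root sub (g.arr .idx) (g.arr .count) (k + 1) := by
        intro hno
        refine { hI with up_ne := fun i hi hik hr => ?_ }
        rcases Nat.lt_succ_iff_lt_or_eq.1 hik with h | rfl
        · exact hI.up_ne i hi h hr
        · exact hno hi hr
      by_cases c1 : par (lo k) = up k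
      · simpa [Cmd.indexStep, Cmd.block, Cmd.den, Cond.Holds, Expr.eval, e1, e2, e3, hgi, c1]
          using hskip fun hk' => absurd c1 (Finset.mem_filter.1 hk').2
      · by_cases c2 : root (up k) = root (lo k)
        · by_cases c3 : g.arr .idx (up k) = 0
          · have := hI.assign T (by simp [extra, hk, c1]) c2 c3
            simpa [Cmd.indexStep, Cmd.block, Cmd.den, Cond.Holds, Expr.eval, e1, e2, e3, e4, e5,
              hgi, c1, c2, c3] using this
          · simpa [Cmd.indexStep, Cmd.block, Cmd.den, Cond.Holds, Expr.eval, e1, e2, e3, e4, hgi,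
              c1, c2, c3] using hskip fun _ _ => c3
        · simpa [Cmd.indexStep, Cmd.block, Cmd.den, Cond.Holds, Expr.eval, e1, e2, e3, e4, hgi,
              c1, c2] using hskip fun _ h => absurd h c2)
  rw [hm] at h1 ht
  exact ⟨t, h', r, h1.isIndexing T C S, ht⟩

/-! ### The dynamic programme -/

namespace Cmd

open SparseMaxCut.Expr (var const get succ pred)

/-- Increase the cell of `a` with the index `e` by one. -/
def incr (a : Arr) (e : Expr) : Cmd := put a e (succ (get a e))

/-- Reset the counters at `w` and prescribe its colour. -/
def resetStep : Cmd :=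
  block [put .fav0 (var .w) (const 0), put .fav1 (var .w) (const 0), put .cost (var .w) (const 0),
    put .col (var .w) (get .mask (get .idx (var .w)))]

/-- If the edge `i` lies in a piece, let every end with a prescribed colour vote for the opposite
colour at the other end. -/
def voteStep : Cmd :=
  block [set .u (get .up (var .i)), set .w (get .lo (var .i)),
    ite (.eq (get .root (var .u)) (get .root (var .w)))
      (block [
        ite (.lt (const 0) (get .idx (var .u)))
          (ite (.eq (get .col (var .u)) (const 0)) (incr .fav1 (var .w)) (incr .fav0 (var .w))) skip,
        ite (.lt (const 0) (get .idx (var .w)))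
          (ite (.eq (get .col (var .w)) (const 0)) (incr .fav1 (var .u)) (incr .fav0 (var .u)))
          skip])
      skip]

/-- Let `w`, if it has no prescribed colour, vote at its parent for the colour opposite to its own
preference. -/
def sendStep : Cmd :=
  ite (.eq (get .idx (var .w)) (const 0))
    (ite (.lt (get .fav0 (var .w)) (get .fav1 (var .w))) (incr .fav0 (get .par (var .w)))
      (ite (.lt (get .fav1 (var .w)) (get .fav0 (var .w))) (incr .fav1 (get .par (var .w))) skip))
    skip

/-- Colour `w` by its preference, or differently from its parent if it has none. -/
def colourStep : Cmd :=
  ite (.eq (get .idx (var .w)) (const 0))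
    (ite (.lt (get .fav0 (var .w)) (get .fav1 (var .w))) (put .col (var .w) (const 1))
      (ite (.lt (get .fav1 (var .w)) (get .fav0 (var .w))) (put .col (var .w) (const 0))
        (ite (.eq (get .col (get .par (var .w))) (const 0)) (put .col (var .w) (const 1))
          (put .col (var .w) (const 0)))))
    skip

end Cmd

section

variable {n m : ℕ} {par up lo root sub idx mask : ℕ → ℕ}

theorem force_succ (x : ℕ → ℕ) (k w : ℕ) :
    force (k + 1) up lo root idx x w = force k up lo root idx x w +
      (if root (up k) = root (lo k) then
        ((if lo k = w ∧ idx (up k) ≠ 0 then -spin (x (up k)) else 0) +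
          (if up k = w ∧ idx (lo k) ≠ 0 then -spin (x (lo k)) else 0)) else 0) := by
  simp only [force, internal]
  rw [Finset.sum_filter, Finset.sum_filter, Finset.sum_range_succ]

theorem force_congr {x y : ℕ → ℕ} (T : IsSearchTree n m par up lo)
    (h : ∀ w < n, idx w ≠ 0 → x w = y w) (w : ℕ) :
    force m up lo root idx x w = force m up lo root idx y w := by
  refine Finset.sum_congr rfl fun i hi => ?_
  have hi : i < m := by simpa using (Finset.mem_filter.1 hi).1
  congr 1
  · by_cases e : idx (up i) ≠ 0
    · rw [h _ (T.up_lt_n hi) e]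
    · simp [e]
  · by_cases e : idx (lo i) ≠ 0
    · rw [h _ (T.lo_lt i hi) e]
    · simp [e]

theorem reset_run (h : Store) (hn : h.reg .n = n) (hmask : h.arr .mask = mask)
    (hidx : h.arr .idx = idx) :
    ∃ t h', (Cmd.forUp .w .n Cmd.resetStep).Run h t h' ∧
      (∀ w < n, h'.arr .fav0 w = 0 ∧ h'.arr .fav1 w = 0 ∧ h'.arr .cost w = 0 ∧
        h'.arr .col w = mask (idx w)) ∧
      t ≤ (Cmd.resetStep.time + 6) * n + 5 := by
  subst hn
  refine Cmd.forUp_run (p := Cmd.resetStep)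
    (fun k g => ∀ w < k, g.arr .fav0 w = 0 ∧ g.arr .fav1 w = 0 ∧ g.arr .cost w = 0 ∧
        g.arr .col w = mask (idx w)) rfl rfl rfl (by decide) (fun k g c hI => hI) (by simp) ?_
  intro k g hk hgw hf hI w hw
  have e1 : g.arr .mask = mask := by rw [hf.arr _ rfl, hmask]
  have e2 : g.arr .idx = idx := by rw [hf.arr _ rfl, hidx]
  simp only [Cmd.resetStep, Cmd.block, Cmd.den, Expr.eval, Store.setCell_arr, Store.setCell_reg,
    hgw, e1, e2, reduceCtorEq, if_true, if_false, Function.update_apply]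
  split_ifs with hc
  · simp [hc]
  · exact hI w (by omega)

theorem vote_run (T : IsSearchTree n m par up lo) (h : Store) (hm : h.reg .m = m)
    (hup : h.arr .up = up) (hlo : h.arr .lo = lo) (hroot : h.arr .root = root)
    (hidx : h.arr .idx = idx) (h0 : ∀ w < n, h.arr .fav0 w = 0 ∧ h.arr .fav1 w = 0) :
    ∃ t h', (Cmd.forUp .i .m Cmd.voteStep).Run h t h' ∧
      (∀ w < n, (h'.arr .fav1 w : ℤ) - h'.arr .fav0 w = force m up lo root idx (h.arr .col) w) ∧
      t ≤ (Cmd.voteStep.time + 6) * m + 5 := by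
  subst hm
  refine Cmd.forUp_run (p := Cmd.voteStep)
    (fun k g => ∀ w < n, (g.arr .fav1 w : ℤ) - g.arr .fav0 w
      = force k up lo root idx (h.arr .col) w) rfl rfl rfl (by decide) (fun k g c hI => hI)
    (fun w hw => by simp [h0 w hw, force, internal]) ?_
  intro k g hk hgi hf hI w hw
  have e1 : g.arr .up = up := by rw [hf.arr _ rfl, hup]
  have e2 : g.arr .lo = lo := by rw [hf.arr _ rfl, hlo]
  have e3 : g.arr .root = root := by rw [hf.arr _ rfl, hroot]
  have e4 : g.arr .idx = idx := by rw [hf.arr _ rfl, hidx]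
  have e5 : g.arr .col = h.arr .col := hf.arr _ rfl
  have hlt := T.up_lt k hk
  have hIw := hI w hw
  rw [force_succ, ← hIw]
  simp only [Cmd.voteStep, Cmd.incr, Cmd.block, Cmd.den, Cond.Holds, Expr.eval, Store.setVar_arr,
    Store.setVar_reg, hgi, e1, e2, e3, reduceCtorEq, if_true, if_false]
  by_cases c1 : root (up k) = root (lo k)
  swap
  · simp [c1]
  by_cases c2 : idx (up k) = 0 <;> by_cases c3 : idx (lo k) = 0 <;>
    by_cases c4 : h.arr .col (up k) = 0 <;> by_cases c5 : h.arr .col (lo k) = 0 <;>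
    simp only [c1, c2, c3, c4, c5, e4, e5, Store.setVar_arr,
      Store.setVar_reg, Store.setCell_arr, Store.setCell_reg, reduceCtorEq,
      if_true, if_false, lt_irrefl, Nat.pos_of_ne_zero, ne_eq, not_false_iff, not_true, and_true,
      and_false, Function.update_apply, spin, hlt.ne, eq_comm (a := w)] <;>
    by_cases c6 : lo k = w <;> by_cases c7 : up k = w <;> simp [c6, c7] <;> omega

theorem send_run (T : IsSearchTree n m par up lo) (C : IsCutting n m par up lo root)
    (I : IsIndexing n m par up lo root sub idx) (h : Store) (hn : h.reg .n = n)
    (hpar : h.arr .par = par) (hidx : h.arr .idx = idx) :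
    ∃ t h', (Cmd.forDown .w .n Cmd.sendStep).Run h t h' ∧
      (∀ w < n, (h'.arr .fav1 w : ℤ) - h'.arr .fav0 w = ((h.arr .fav1 w : ℤ) - h.arr .fav0 w)
        + ∑ v ∈ (Finset.range n).filter (fun v => idx v = 0 ∧ par v = w),
          -((h'.arr .fav1 v : ℤ) - h'.arr .fav0 v).sign) ∧
      t ≤ (Cmd.sendStep.time + 6) * n + 5 := by
  subst hn
  obtain ⟨t, h', r, h1, ht⟩ := Cmd.forDown_run (x := .w) (N := .n) (p := Cmd.sendStep)
    (fun k g => ∀ w < h.reg .n, (g.arr .fav1 w : ℤ) - g.arr .fav0 w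
      = ((h.arr .fav1 w : ℤ) - h.arr .fav0 w)
        + ∑ v ∈ (Finset.range (h.reg .n)).filter (fun v => k ≤ v ∧ idx v = 0 ∧ par v = w),
          -((g.arr .fav1 v : ℤ) - g.arr .fav0 v).sign) (h₀ := h) rfl rfl (fun k g c hI => hI)
    (by
      intro w hw
      rw [Finset.filter_false_of_mem, Finset.sum_empty, add_zero]
      rintro v hv ⟨h1, -⟩
      have := Finset.mem_range.1 hv
      omega) (by
      intro k g hk hgw hf hI w hw
      have e1 : g.arr .par = par := by rw [hf.arr _ rfl, hpar]
      have e2 : g.arr .idx = idx := by rw [hf.arr _ rfl, hidx]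
      by_cases c1 : idx k = 0
      · have hk0 : 0 < k := by
          rcases Nat.eq_zero_or_pos k with rfl | h
          · have := I.top 0 hk (Nat.le_zero.1 (C.le 0 hk))
            omega
          · exact h
        have hpk := T.parent.lt k hk0 hk
        have hnew : ∀ v, ((Cmd.sendStep.den g).arr .fav1 v : ℤ) - (Cmd.sendStep.den g).arr .fav0 v
            = ((g.arr .fav1 v : ℤ) - g.arr .fav0 v) +
              if par k = v then -((g.arr .fav1 k : ℤ) - g.arr .fav0 k).sign else 0 := by
          intro v
          simp only [Cmd.sendStep, Cmd.incr, Cmd.den, Cond.Holds, Expr.eval, hgw, e1, e2, c1,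
            if_true]
          rcases lt_trichotomy (g.arr .fav0 k) (g.arr .fav1 k) with hc | hc | hc
          · rw [if_pos hc, Int.sign_eq_one_of_pos (by omega)]
            simp only [Store.setCell_arr, reduceCtorEq, if_true, if_false, Function.update_apply,
              eq_comm (a := v)]
            split_ifs with e
            · subst e; push_cast; ring
            · ring
          · rw [if_neg (by omega), if_neg (by omega), hc]
            simp
          · rw [if_neg (by omega), if_pos hc, Int.sign_eq_neg_one_of_neg (by omega)]
            simp only [Store.setCell_arr, reduceCtorEq, if_true, if_false, Function.update_apply,
              eq_comm (a := v)]
            split_ifs with e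
            · subst e; push_cast; ring
            · ring
        have hsum : ∑ v ∈ (Finset.range (h.reg .n)).filter
              (fun v => k ≤ v ∧ idx v = 0 ∧ par v = w),
              -(((Cmd.sendStep.den g).arr .fav1 v : ℤ) - (Cmd.sendStep.den g).arr .fav0 v).sign
            = (if par k = w then -((g.arr .fav1 k : ℤ) - g.arr .fav0 k).sign else 0)
              + ∑ v ∈ (Finset.range (h.reg .n)).filter
                (fun v => k + 1 ≤ v ∧ idx v = 0 ∧ par v = w),
                -((g.arr .fav1 v : ℤ) - g.arr .fav0 v).sign := by
          have hcongr : ∀ v, k ≤ v →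
              -(((Cmd.sendStep.den g).arr .fav1 v : ℤ) - (Cmd.sendStep.den g).arr .fav0 v).sign
                = -((g.arr .fav1 v : ℤ) - g.arr .fav0 v).sign := fun v hv => by
            rw [hnew v, if_neg (by omega), add_zero]
          rw [Finset.sum_congr rfl fun v hv => hcongr v (Finset.mem_filter.1 hv).2.1]
          rw [Finset.sum_filter, Finset.sum_filter,
            ← Finset.add_sum_erase _ _ (Finset.mem_range.2 hk),
            ← Finset.add_sum_erase (Finset.range (h.reg .n)) (fun v =>
              if k + 1 ≤ v ∧ idx v = 0 ∧ par v = w then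
                -((g.arr .fav1 v : ℤ) - g.arr .fav0 v).sign else 0) (Finset.mem_range.2 hk)]
          simp only [le_refl, c1, true_and, Nat.not_succ_le_self, false_and, if_false, zero_add]
          congr 1
          refine Finset.sum_congr rfl fun v hv => ?_
          have hne := Finset.ne_of_mem_erase hv
          have : k ≤ v ↔ k + 1 ≤ v := by omega
          simp only [this]
        rw [hnew, hI w hw, hsum]
        ring
      · have hden : Cmd.sendStep.den g = g := by
          simp [Cmd.sendStep, Cmd.den, Cond.Holds, Expr.eval, hgw, e2, c1]
        rw [hden, hI w hw]
        congr 1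
        refine Finset.sum_congr (Finset.filter_congr fun v _ => ?_) fun _ _ => rfl
        constructor
        · rintro ⟨h1, h2⟩; exact ⟨by omega, h2⟩
        · rintro ⟨h1, h2, h3⟩
          have : v ≠ k := fun e => c1 (e ▸ h2)
          exact ⟨by omega, h2, h3⟩)
  exact ⟨t, h', r, by simpa using h1, ht⟩

theorem colour_run (T : IsSearchTree n m par up lo) (C : IsCutting n m par up lo root)
    (I : IsIndexing n m par up lo root sub idx) (h : Store) (hn : h.reg .n = n)
    (hpar : h.arr .par = par) (hidx : h.arr .idx = idx) :
    ∃ t h', (Cmd.forUp .w .n Cmd.colourStep).Run h t h' ∧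
      (∀ w < n, (idx w ≠ 0 → h'.arr .col w = h.arr .col w) ∧
        (idx w = 0 → (h.arr .fav0 w < h.arr .fav1 w → h'.arr .col w = 1) ∧
          (h.arr .fav1 w < h.arr .fav0 w → h'.arr .col w = 0) ∧
          (h.arr .fav1 w = h.arr .fav0 w →
            h'.arr .col w = if h'.arr .col (par w) = 0 then 1 else 0))) ∧
      t ≤ (Cmd.colourStep.time + 6) * n + 5 := by
  subst hn
  obtain ⟨t, h', r, ⟨h1, -⟩, ht⟩ := Cmd.forUp_run (x := .w) (N := .n) (p := Cmd.colourStep)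
    (fun k g => (∀ w < k, (idx w ≠ 0 → g.arr .col w = h.arr .col w) ∧
        (idx w = 0 → (h.arr .fav0 w < h.arr .fav1 w → g.arr .col w = 1) ∧
          (h.arr .fav1 w < h.arr .fav0 w → g.arr .col w = 0) ∧
          (h.arr .fav1 w = h.arr .fav0 w →
            g.arr .col w = if g.arr .col (par w) = 0 then 1 else 0))) ∧
        ∀ w, k ≤ w → g.arr .col w = h.arr .col w) (h₀ := h) rfl rfl rfl (by decide)
    (fun k g c hI => hI) ⟨fun w hw => absurd hw (Nat.not_lt_zero w), fun w _ => rfl⟩ (by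
      rintro k g hk hgw hf ⟨hI, hI'⟩
      have e1 : g.arr .par = par := by rw [hf.arr _ rfl, hpar]
      have e2 : g.arr .idx = idx := by rw [hf.arr _ rfl, hidx]
      have e3 : g.arr .fav0 = h.arr .fav0 := hf.arr _ rfl
      have e4 : g.arr .fav1 = h.arr .fav1 := hf.arr _ rfl
      by_cases c1 : idx k = 0
      · have hk0 : 0 < k := by
          rcases Nat.eq_zero_or_pos k with rfl | h
          · have := I.top 0 hk (Nat.le_zero.1 (C.le 0 hk))
            omega
          · exact h
        have hpk := T.parent.lt k hk0 hk
        obtain ⟨c, hc, hc1, hc2, hc3⟩ : ∃ c, (Cmd.colourStep.den g).arr .col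
            = Function.update (g.arr .col) k c ∧ (h.arr .fav0 k < h.arr .fav1 k → c = 1) ∧
              (h.arr .fav1 k < h.arr .fav0 k → c = 0) ∧ (h.arr .fav1 k = h.arr .fav0 k →
                c = if g.arr .col (par k) = 0 then 1 else 0) := by
          simp only [Cmd.colourStep, Cmd.den, Cond.Holds, Expr.eval, hgw, e1, e2, e3, e4, c1,
            if_true]
          by_cases d1 : h.arr .fav0 k < h.arr .fav1 k
          · exact ⟨1, by simp [d1], fun _ => rfl, fun _ => by omega, fun _ => by omega⟩
          by_cases d2 : h.arr .fav1 k < h.arr .fav0 k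
          · exact ⟨0, by simp [d1, d2], fun _ => by omega, fun _ => rfl, fun _ => by omega⟩
          by_cases d3 : g.arr .col (par k) = 0
          · exact ⟨1, by simp [d1, d2, d3], fun _ => rfl, fun _ => by omega, fun _ => by simp [d3]⟩
          · exact ⟨0, by simp [d1, d2, d3], fun _ => by omega, fun _ => rfl, fun _ => by simp [d3]⟩
        rw [hc]
        refine ⟨fun w hw => ?_, fun w hw => ?_⟩
        · rcases Nat.lt_succ_iff_lt_or_eq.1 hw with hw | rfl
          · have hpw := (T.parent.le (hw.trans hk)).trans_lt hw
            rw [Function.update_of_ne hw.ne, Function.update_of_ne hpw.ne]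
            exact hI w hw
          · rw [Function.update_self, Function.update_of_ne hpk.ne]
            exact ⟨fun h => absurd c1 h, fun _ => ⟨hc1, hc2, hc3⟩⟩
        · rw [Function.update_of_ne (by omega)]
          exact hI' w (by omega)
      · have hden : Cmd.colourStep.den g = g := by
          simp [Cmd.colourStep, Cmd.den, Cond.Holds, Expr.eval, hgw, e2, c1]
        rw [hden]
        refine ⟨fun w hw => ?_, fun w hw => hI' w (by omega)⟩
        rcases Nat.lt_succ_iff_lt_or_eq.1 hw with hw | rfl
        · exact hI w hw
        · exact ⟨fun _ => hI' w le_rfl, fun h => absurd h c1⟩)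
  exact ⟨t, h', r, h1, ht⟩

end

/-! ### The best colouring over all prescriptions -/

namespace Cmd

open SparseMaxCut.Expr (var const get succ pred)

/-- Count the edge `i` in its branch if it lies in a piece and its ends have the same colour. -/
def costStep : Cmd :=
  block [set .u (get .up (var .i)), set .w (get .lo (var .i)),
    ite (.eq (get .root (var .u)) (get .root (var .w)))
      (ite (.eq (get .col (var .u)) (get .col (var .w))) (incr .cost (get .sub (var .w))) skip)
      skip]

/-- Keep the new colour of `w` if it belongs to a branch where the new colouring is better. -/
def adoptStep : Cmd :=
  ite (.eq (get .root (var .w)) (var .w)) skip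
    (ite (.lt (get .cost (get .sub (var .w))) (get .best (get .sub (var .w))))
      (put .bcol (var .w) (get .col (var .w))) skip)

/-- Record the new cost of the branch `w` if it is better. -/
def improveStep : Cmd :=
  ite (.lt (get .cost (var .w)) (get .best (var .w))) (put .best (var .w) (get .cost (var .w))) skip

/-- A constant for the time bound of `round`. -/
def roundTime : ℕ :=
  resetStep.time + voteStep.time + sendStep.time + colourStep.time + costStep.time +
    adoptStep.time + improveStep.time + 80

/-- Run the dynamic programme for one prescription and compare. -/
def round : Cmd :=
  block [forUp .w .n resetStep, forUp .i .m voteStep, forDown .w .n sendStep,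
    forUp .w .n colourStep, forUp .i .m costStep, forUp .w .n adoptStep, forUp .w .n improveStep]

end Cmd

section

variable {n m : ℕ} {par up lo root sub idx mask : ℕ → ℕ}

theorem badIn_succ (x : ℕ → ℕ) (k c : ℕ) :
    badIn (k + 1) up lo root sub x c = badIn k up lo root sub x c +
      (if root (up k) = root (lo k) ∧ sub (lo k) = c ∧ x (up k) = x (lo k) then 1 else 0) := by
  simp only [badIn, branch, internal, Finset.card_filter, Finset.sum_filter, Finset.sum_range_succ]
  congr 1
  by_cases h1 : root (up k) = root (lo k) <;> by_cases h2 : sub (lo k) = c <;> simp [h1, h2]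

theorem badIn_le_card (x : ℕ → ℕ) (c : ℕ) : badIn m up lo root sub x c ≤ m := by
  refine (Finset.card_le_card ((Finset.filter_subset _ _).trans ((Finset.filter_subset _ _).trans
    (Finset.filter_subset _ _)))).trans (Finset.card_range m).le

theorem badIn_congr (T : IsSearchTree n m par up lo) (C : IsCutting n m par up lo root)
    (S : IsSub n par root sub) {x y : ℕ → ℕ} {c : ℕ}
    (h : ∀ w < n, root w ≠ w ∧ sub w = c ∨ root w = w → x w = y w) :
    badIn m up lo root sub x c = badIn m up lo root sub y c := by
  rw [badIn, badIn]
  congr 1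
  refine Finset.filter_congr fun i hi => ?_
  obtain ⟨hm, hr, hlo, hc, hup⟩ := branch_ends T C S hi
  rw [h _ (T.up_lt_n hm) (hup.imp_right And.left), h _ (T.lo_lt i hm) (.inl ⟨hlo, hc⟩)]

theorem cost_run (h : Store) (hm : h.reg .m = m) (hup : h.arr .up = up)
    (hlo : h.arr .lo = lo) (hroot : h.arr .root = root) (hsub : h.arr .sub = sub)
    (h0 : ∀ w < n, h.arr .cost w = 0) :
    ∃ t h', (Cmd.forUp .i .m Cmd.costStep).Run h t h' ∧
      (∀ c < n, h'.arr .cost c = badIn m up lo root sub (h.arr .col) c) ∧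
      t ≤ (Cmd.costStep.time + 6) * m + 5 := by
  subst hm
  refine Cmd.forUp_run (p := Cmd.costStep)
    (fun k g => ∀ c < n, g.arr .cost c = badIn k up lo root sub (h.arr .col) c) rfl rfl rfl
    (by decide) (fun k g c hI => hI)
    (fun w hw => by simp [h0 w hw, badIn, branch, internal]) ?_
  intro k g hk hgi hf hI c hc
  have e1 : g.arr .up = up := by rw [hf.arr _ rfl, hup]
  have e2 : g.arr .lo = lo := by rw [hf.arr _ rfl, hlo]
  have e3 : g.arr .root = root := by rw [hf.arr _ rfl, hroot]
  have e4 : g.arr .sub = sub := by rw [hf.arr _ rfl, hsub]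
  have e5 : g.arr .col = h.arr .col := hf.arr _ rfl
  rw [badIn_succ, ← hI c hc]
  simp only [Cmd.costStep, Cmd.incr, Cmd.block, Cmd.den, Cond.Holds, Expr.eval, Store.setVar_arr,
    Store.setVar_reg, hgi, e1, e2, e3, e4, e5, reduceCtorEq, if_true, if_false]
  by_cases c1 : root (up k) = root (lo k)
  · by_cases c2 : h.arr .col (up k) = h.arr .col (lo k)
    · by_cases c3 : sub (lo k) = c
      · simp [c1, c2, c3]
      · simp [c1, c2, c3, Function.update_of_ne (Ne.symm c3)]
    · simp [c1, c2]
  · simp [c1]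

theorem adopt_run (h : Store) (hn : h.reg .n = n) (hroot : h.arr .root = root)
    (hsub : h.arr .sub = sub) :
    ∃ t h', (Cmd.forUp .w .n Cmd.adoptStep).Run h t h' ∧
      (∀ w < n, h'.arr .bcol w = if root w ≠ w ∧ h.arr .cost (sub w) < h.arr .best (sub w)
        then h.arr .col w else h.arr .bcol w) ∧
      t ≤ (Cmd.adoptStep.time + 6) * n + 5 := by
  subst hn
  obtain ⟨t, h', r, ⟨h1, -⟩, ht⟩ := Cmd.forUp_run (x := .w) (N := .n) (p := Cmd.adoptStep)
    (fun k g => (∀ w < k, g.arr .bcol w = if root w ≠ w ∧ h.arr .cost (sub w) < h.arr .best (sub w)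
        then h.arr .col w else h.arr .bcol w) ∧ ∀ w, k ≤ w → g.arr .bcol w = h.arr .bcol w)
    (h₀ := h) rfl rfl rfl (by decide) (fun k g c hI => hI)
    ⟨fun w hw => absurd hw (Nat.not_lt_zero w), fun w _ => rfl⟩ (by
      rintro k g hk hgw hf ⟨hI, hI'⟩
      have e1 : g.arr .root = root := by rw [hf.arr _ rfl, hroot]
      have e2 : g.arr .sub = sub := by rw [hf.arr _ rfl, hsub]
      have e3 : g.arr .cost = h.arr .cost := hf.arr _ rfl
      have e4 : g.arr .best = h.arr .best := hf.arr _ rfl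
      have e5 : g.arr .col = h.arr .col := hf.arr _ rfl
      have hnew : (Cmd.adoptStep.den g).arr .bcol = if root k ≠ k ∧
          h.arr .cost (sub k) < h.arr .best (sub k) then
          Function.update (g.arr .bcol) k (h.arr .col k) else g.arr .bcol := by
        simp only [Cmd.adoptStep, Cmd.den, Cond.Holds, Expr.eval, hgw, e1, e2, e3, e4, e5]
        by_cases c1 : root k = k <;>
          by_cases c2 : h.arr .cost (sub k) < h.arr .best (sub k) <;> simp [c1, c2]
      rw [hnew]
      refine ⟨fun w hw => ?_, fun w hw => ?_⟩
      · rcases Nat.lt_succ_iff_lt_or_eq.1 hw with hw | rfl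
        · rw [← hI w hw]
          split_ifs <;> simp [hw.ne]
        · split_ifs
          · simp
          · exact hI' w le_rfl
      · rw [← hI' w (by omega)]
        have : w ≠ k := by omega
        split_ifs <;> simp [this])
  exact ⟨t, h', r, h1, ht⟩

theorem improve_run (h : Store) (hn : h.reg .n = n) :
    ∃ t h', (Cmd.forUp .w .n Cmd.improveStep).Run h t h' ∧
      (∀ w < n, h'.arr .best w = min (h.arr .cost w) (h.arr .best w)) ∧
      t ≤ (Cmd.improveStep.time + 6) * n + 5 := by
  subst hn
  obtain ⟨t, h', r, ⟨h1, -⟩, ht⟩ := Cmd.forUp_run (x := .w) (N := .n) (p := Cmd.improveStep)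
    (fun k g => (∀ w < k, g.arr .best w = min (h.arr .cost w) (h.arr .best w)) ∧
      ∀ w, k ≤ w → g.arr .best w = h.arr .best w)
    (h₀ := h) rfl rfl rfl (by decide) (fun k g c hI => hI)
    ⟨fun w hw => absurd hw (Nat.not_lt_zero w), fun w _ => rfl⟩ (by
      rintro k g hk hgw hf ⟨hI, hI'⟩
      have e3 : g.arr .cost = h.arr .cost := hf.arr _ rfl
      have hnew : (Cmd.improveStep.den g).arr .best
          = Function.update (g.arr .best) k (min (h.arr .cost k) (h.arr .best k)) := by
        have hk' := hI' k le_rfl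
        simp only [Cmd.improveStep, Cmd.den, Cond.Holds, Expr.eval, hgw, e3]
        rw [hk']
        by_cases c1 : h.arr .cost k < h.arr .best k
        · simp [c1, c1.le]
        · rw [if_neg c1, min_eq_right (not_lt.1 c1), ← hk', Function.update_eq_self]
      rw [hnew]
      refine ⟨fun w hw => ?_, fun w hw => ?_⟩
      · rcases Nat.lt_succ_iff_lt_or_eq.1 hw with hw | rfl
        · rw [Function.update_of_ne hw.ne]
          exact hI w hw
        · simp
      · rw [Function.update_of_ne (by omega)]
        exact hI' w (by omega))
  exact ⟨t, h', r, h1, ht⟩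

/-- The colouring `y` has the prescribed colours in the branch `c`. -/
def Matches (n : ℕ) (par root sub idx mask : ℕ → ℕ) (y : ℕ → ℕ) (c : ℕ) : Prop :=
  ∀ w < n, idx w ≠ 0 → (root w ≠ w ∧ sub w = c ∨ root w = w ∧ w = par c) → y w = mask (idx w)

/-- The colouring `bcol` is on every branch at least as good as the colourings with the prescribed
colours of one of the masks in `L`, and `best` records its cost (or `m + 1` at the beginning). -/
structure SolveInv (n m : ℕ) (par up lo root sub idx : ℕ → ℕ) (L : List (ℕ → ℕ))
    (best bcol : ℕ → ℕ) : Prop where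
  le : ∀ w < n, bcol w ≤ 1
  top : ∀ w < n, root w = w → bcol w = 0
  best_eq : ∀ c < n, best c = badIn m up lo root sub bcol c ∨ best c = m + 1
  opt : ∀ mask ∈ L, ∀ c < n, ∀ y : ℕ → ℕ, (∀ w < n, y w ≤ 1) →
    Matches n par root sub idx mask y c → best c ≤ badIn m up lo root sub y c

theorem SolveInv.cons {L : List (ℕ → ℕ)} {best bcol best' bcol' x : ℕ → ℕ} {D : ℕ → ℤ}
    (T : IsSearchTree n m par up lo) (C : IsCutting n m par up lo root)
    (S : IsSub n par root sub) (I : IsIndexing n m par up lo root sub idx)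
    (H : SolveInv n m par up lo root sub idx L best bcol)
    (P : IsPass n m par up lo root idx mask D x) (h4 : mask 4 = 0)
    (hbest : ∀ c < n, best' c = min (badIn m up lo root sub x c) (best c))
    (hbcol : ∀ w < n, bcol' w = if root w ≠ w ∧ badIn m up lo root sub x (sub w) < best (sub w)
      then x w else bcol w) :
    SolveInv n m par up lo root sub idx (mask :: L) best' bcol' := by
  refine ⟨fun w hw => ?_, fun w hw hr => ?_, fun c hc => ?_, fun μ hμ c hc y hy hM => ?_⟩
  · rw [hbcol w hw]
    split_ifs
    · exact P.le w hw
    · exact H.le w hw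
  · rw [hbcol w hw, if_neg (fun h => h.1 hr)]
    exact H.top w hw hr
  · by_cases hlt : badIn m up lo root sub x c < best c
    · refine .inl ?_
      rw [hbest c hc, min_eq_left hlt.le]
      refine badIn_congr T C S fun w hw hwc => ?_
      rw [hbcol w hw]
      rcases hwc with ⟨h1, h2⟩ | h1
      · rw [if_pos ⟨h1, h2 ▸ hlt⟩]
      · have h5 := I.top w hw h1
        rw [if_neg (fun h => h.1 h1), H.top w hw h1, P.fixed w hw (by omega), h5, h4]
    · rw [hbest c hc, min_eq_right (not_lt.1 hlt)]
      refine (H.best_eq c hc).imp_left fun h => h.trans ?_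
      refine badIn_congr T C S fun w hw hwc => ?_
      rw [hbcol w hw, if_neg]
      rintro ⟨h1, h2⟩
      rcases hwc with ⟨-, h3⟩ | h3
      · exact hlt (h3 ▸ h2)
      · exact h1 h3
  · rw [hbest c hc]
    rcases List.mem_cons.1 hμ with rfl | hμ
    · refine (min_le_left _ _).trans (P.badIn_le T C S I hy fun w hw h0 hwc => ?_)
      rw [hM w hw h0 hwc, P.fixed w hw h0]
    · exact (min_le_right _ _).trans (H.opt μ hμ c hc y hy hM)

theorem round_run (T : IsSearchTree n m par up lo) (C : IsCutting n m par up lo root)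
    (S : IsSub n par root sub) (I : IsIndexing n m par up lo root sub idx)
    (h : Store) (L : List (ℕ → ℕ)) (hn : h.reg .n = n) (hm : h.reg .m = m)
    (hpar : h.arr .par = par) (hup : h.arr .up = up) (hlo : h.arr .lo = lo)
    (hroot : h.arr .root = root) (hsub : h.arr .sub = sub) (hidx : h.arr .idx = idx)
    (hmask : ∀ k, h.arr .mask k ≤ 1) (hmask4 : h.arr .mask 4 = 0)
    (H : SolveInv n m par up lo root sub idx L (h.arr .best) (h.arr .bcol)) :
    ∃ t h', Cmd.round.Run h t h' ∧
      SolveInv n m par up lo root sub idx (h.arr .mask :: L) (h'.arr .best) (h'.arr .bcol) ∧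
      t ≤ Cmd.roundTime * (n + m + 1) := by
  obtain ⟨t1, h1, r1, a1, l1⟩ := reset_run h hn rfl hidx
  obtain ⟨t2, h2, r2, a2, l2⟩ := vote_run T h1 (by rw [r1.frame.reg _ rfl, hm])
    (by rw [r1.frame.arr _ rfl, hup]) (by rw [r1.frame.arr _ rfl, hlo])
    (by rw [r1.frame.arr _ rfl, hroot]) (by rw [r1.frame.arr _ rfl, hidx])
    (fun w hw => ⟨(a1 w hw).1, (a1 w hw).2.1⟩)
  obtain ⟨t3, h3, r3, a3, l3⟩ := send_run T C I h2
    (by rw [r2.frame.reg _ rfl, r1.frame.reg _ rfl, hn])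
    (by rw [r2.frame.arr _ rfl, r1.frame.arr _ rfl, hpar])
    (by rw [r2.frame.arr _ rfl, r1.frame.arr _ rfl, hidx])
  have e3 : h3.arr .col = h1.arr .col := by rw [r3.frame.arr _ rfl, r2.frame.arr _ rfl]
  obtain ⟨t4, h4, r4, a4, l4⟩ := colour_run T C I h3
    (by rw [r3.frame.reg _ rfl, r2.frame.reg _ rfl, r1.frame.reg _ rfl, hn])
    (by rw [r3.frame.arr _ rfl, r2.frame.arr _ rfl, r1.frame.arr _ rfl, hpar])
    (by rw [r3.frame.arr _ rfl, r2.frame.arr _ rfl, r1.frame.arr _ rfl, hidx])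
  have hreg : ∀ x, (Cmd.forUp .w .n Cmd.resetStep).modVar x = false →
      (Cmd.forUp .i .m Cmd.voteStep).modVar x = false →
      (Cmd.forDown .w .n Cmd.sendStep).modVar x = false →
      (Cmd.forUp .w .n Cmd.colourStep).modVar x = false → h4.reg x = h.reg x := by
    intro x b1 b2 b3 b4
    rw [r4.frame.reg x b4, r3.frame.reg x b3, r2.frame.reg x b2, r1.frame.reg x b1]
  have harr : ∀ a, (Cmd.forUp .w .n Cmd.resetStep).modArr a = false →
      (Cmd.forUp .i .m Cmd.voteStep).modArr a = false →
      (Cmd.forDown .w .n Cmd.sendStep).modArr a = false →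
      (Cmd.forUp .w .n Cmd.colourStep).modArr a = false → h4.arr a = h.arr a := by
    intro a b1 b2 b3 b4
    rw [r4.frame.arr a b4, r3.frame.arr a b3, r2.frame.arr a b2, r1.frame.arr a b1]
  have P : IsPass n m par up lo root idx (h.arr .mask)
      (fun w => (h3.arr .fav1 w : ℤ) - h3.arr .fav0 w) (h4.arr .col) := by
    have hfix : ∀ w < n, idx w ≠ 0 → h4.arr .col w = h1.arr .col w := fun w hw h0 => by
      rw [(a4 w hw).1 h0, e3]
    refine ⟨fun w hw => ?_, fun w hw h0 => ?_, fun w hw => ?_, fun w hw h0 => ?_⟩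
    · by_cases h0 : idx w = 0
      · obtain ⟨b1, b2, b3⟩ := (a4 w hw).2 h0
        rcases lt_trichotomy (h3.arr .fav0 w) (h3.arr .fav1 w) with hc | hc | hc
        · exact (b1 hc).le
        · rw [b3 hc.symm]
          split_ifs <;> omega
        · rw [b2 hc]
          exact Nat.zero_le 1
      · rw [hfix w hw h0, (a1 w hw).2.2.2]
        exact hmask _
    · rw [hfix w hw h0, (a1 w hw).2.2.2]
    · rw [a3 w hw, a2 w hw, force_congr T fun w hw h0 => (hfix w hw h0).symm]
    · obtain ⟨b1, b2, b3⟩ := (a4 w hw).2 h0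
      exact ⟨fun hc => b1 (by omega), fun hc => b2 (by omega), fun hc => b3 (by omega)⟩
  obtain ⟨t5, h5, r5, a5, l5⟩ := cost_run (n := n) h4 (by rw [hreg _ rfl rfl rfl rfl, hm])
    (by rw [harr _ rfl rfl rfl rfl, hup]) (by rw [harr _ rfl rfl rfl rfl, hlo])
    (by rw [harr _ rfl rfl rfl rfl, hroot]) (by rw [harr _ rfl rfl rfl rfl, hsub])
    (fun w hw => by
      rw [r4.frame.arr _ rfl, r3.frame.arr _ rfl, r2.frame.arr _ rfl]
      exact (a1 w hw).2.2.1)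
  obtain ⟨t6, h6, r6, a6, l6⟩ := adopt_run (n := n) h5
    (by rw [r5.frame.reg _ rfl, hreg _ rfl rfl rfl rfl, hn])
    (by rw [r5.frame.arr _ rfl, harr _ rfl rfl rfl rfl, hroot])
    (by rw [r5.frame.arr _ rfl, harr _ rfl rfl rfl rfl, hsub])
  obtain ⟨t7, h7, r7, a7, l7⟩ := improve_run (n := n) h6
    (by rw [r6.frame.reg _ rfl, r5.frame.reg _ rfl, hreg _ rfl rfl rfl rfl, hn])
  have f1 : h5.arr .best = h.arr .best := by
    rw [r5.frame.arr _ rfl, harr _ rfl rfl rfl rfl]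
  have f2 : h5.arr .bcol = h.arr .bcol := by
    rw [r5.frame.arr _ rfl, harr _ rfl rfl rfl rfl]
  have f3 : h5.arr .col = h4.arr .col := r5.frame.arr _ rfl
  have f4 : h6.arr .cost = h5.arr .cost := r6.frame.arr _ rfl
  have f5 : h6.arr .best = h.arr .best := by rw [r6.frame.arr _ rfl, f1]
  have f6 : h7.arr .bcol = h6.arr .bcol := r7.frame.arr _ rfl
  refine ⟨_, h7, .seq r1 (.seq r2 (.seq r3 (.seq r4 (.seq r5 (.seq r6 (.seq r7 (.skip _))))))),
    H.cons T C S I P hmask4 (fun c hc => ?_) (fun w hw => ?_), ?_⟩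
  · rw [a7 c hc, f4, f5, a5 c hc]
  · rw [f6, a6 w hw, f1, f2, f3]
    by_cases hr : root w = w
    · rw [if_neg fun h => h.1 hr, if_neg fun h => h.1 hr]
    · obtain ⟨-, -, b3, -⟩ := S.par_sub T C hw hr
      rw [a5 _ ((T.parent.anc_le hw b3).trans_lt hw)]
  · have key : ∀ a b c d e f g : ℕ, (a + 6) * n + 5 + ((b + 6) * m + 5 + ((c + 6) * n + 5 +
        ((d + 6) * n + 5 + ((e + 6) * m + 5 + ((f + 6) * n + 5 + ((g + 6) * n + 5 + 0))))))
        ≤ (a + b + c + d + e + f + g + 80) * (n + m + 1) := by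
      intro a b c d e f g
      have e1 : (a + b + c + d + e + f + g + 80) * (n + m + 1) =
        ((a + 6) * n + 5 + ((b + 6) * m + 5 + ((c + 6) * n + 5 +
        ((d + 6) * n + 5 + ((e + 6) * m + 5 + ((f + 6) * n + 5 + ((g + 6) * n + 5 + 0)))))))
        + ((b + e + 50) * n + (a + c + d + f + g + 68) * m + (a + b + c + d + e + f + g + 45)) := by
        ring
      omega
    refine le_trans ?_ (key _ _ _ _ _ _ _)
    gcongr

end

/-! ### Running through all prescriptions -/

namespace Cmd

open SparseMaxCut.Expr (var const get succ pred)

/-- Run the dynamic programme with the colours `b` for the labels with the indices `1`, `2`, `3`.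
The cells `0` and `4` of the array `mask` always hold the colour `0`. -/
def pass (b : ℕ × ℕ × ℕ) : Cmd :=
  block [put .mask (const 1) (const b.1), put .mask (const 2) (const b.2.1),
    put .mask (const 3) (const b.2.2), round]

/-- Find the best colouring of every branch. -/
def solve : Cmd :=
  seq (forUp .w .n (put .best (var .w) (succ (var .m))))
    (block ((([0, 1] : List ℕ) ×ˢ ([0, 1] : List ℕ) ×ˢ ([0, 1] : List ℕ)).map pass))

end Cmd

/-- The mask with the entries `b` at `1`, `2`, `3` and `0` elsewhere. -/
def maskOf (b : ℕ × ℕ × ℕ) (k : ℕ) : ℕ :=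
  if k = 1 then b.1 else if k = 2 then b.2.1 else if k = 3 then b.2.2 else 0

/-- The colouring `bcol` gives the tops of the pieces the colour `0`, and it is optimal on every
branch below a top among the colourings with this property. -/
structure IsSolution (n m : ℕ) (par up lo root sub bcol : ℕ → ℕ) : Prop where
  le : ∀ w < n, bcol w ≤ 1
  top : ∀ w < n, root w = w → bcol w = 0
  opt : ∀ c < n, ∀ y : ℕ → ℕ, (∀ w < n, y w ≤ 1) → y (par c) = 0 →
    badIn m up lo root sub bcol c ≤ badIn m up lo root sub y c

section

variable {n m : ℕ} {par up lo root sub idx : ℕ → ℕ}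

theorem SolveInv.isSolution {L : List (ℕ → ℕ)} {best bcol : ℕ → ℕ}
    (I : IsIndexing n m par up lo root sub idx)
    (H : SolveInv n m par up lo root sub idx L best bcol)
    (hL : ∀ b : ℕ × ℕ × ℕ, b.1 ≤ 1 → b.2.1 ≤ 1 → b.2.2 ≤ 1 → maskOf b ∈ L) :
    IsSolution n m par up lo root sub bcol := by
  refine ⟨H.le, H.top, fun c hc y hy hy0 => ?_⟩
  classical
  -- the colour that `y` gives to the label with the index `t` in the branch `c`
  let β : ℕ → ℕ := fun t =>
    if ∃ w < n, root w ≠ w ∧ sub w = c ∧ idx w = t ∧ y w = 1 then 1 else 0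
  have hβ : ∀ t, β t ≤ 1 := fun t => by
    simp only [β]
    split_ifs <;> omega
  have h1 := H.opt _ (hL (β 1, β 2, β 3) (hβ 1) (hβ 2) (hβ 3)) c hc y hy (by
    intro w hw h0 hwc
    rcases hwc with ⟨h2, h3⟩ | ⟨h2, h3⟩
    · have hle := I.le w hw h2
      have hyw : y w = β (idx w) := by
        simp only [β]
        split_ifs with hex
        · obtain ⟨x, hx, e1, e2, e3, e4⟩ := hex
          rw [← e4, I.inj w hw x hx h2 e1 h0 (h3.trans e2.symm) e3.symm]
        · have := hy w hw
          have : y w ≠ 1 := fun e => hex ⟨w, hw, h2, h3, rfl, e⟩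
          omega
      rw [hyw]
      generalize idx w = t at h0 hle
      interval_cases t <;> simp_all [maskOf]
    · rw [I.top w hw h2, h3, hy0]
      rfl)
  rcases H.best_eq c hc with h2 | h2
  · omega
  · have := badIn_le_card (m := m) (up := up) (lo := lo) (root := root) (sub := sub) y c
    omega

theorem passes_run (T : IsSearchTree n m par up lo) (C : IsCutting n m par up lo root)
    (S : IsSub n par root sub) (I : IsIndexing n m par up lo root sub idx)
    (l : List (ℕ × ℕ × ℕ)) :
    ∀ (h : Store) (L : List (ℕ → ℕ)), (∀ b ∈ l, b.1 ≤ 1 ∧ b.2.1 ≤ 1 ∧ b.2.2 ≤ 1) → h.reg .n = n → h.reg .m = m →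
      h.arr .par = par → h.arr .up = up → h.arr .lo = lo → h.arr .root = root →
      h.arr .sub = sub → h.arr .idx = idx → (∃ b, h.arr .mask = maskOf b) →
      SolveInv n m par up lo root sub idx L (h.arr .best) (h.arr .bcol) →
      ∃ t h' L', (Cmd.block (l.map Cmd.pass)).Run h t h' ∧
        SolveInv n m par up lo root sub idx L' (h'.arr .best) (h'.arr .bcol) ∧
        (∀ μ ∈ L, μ ∈ L') ∧ (∀ b ∈ l, maskOf b ∈ L') ∧
        t ≤ l.length * ((Cmd.roundTime + 9) * (n + m + 1)) := by
  induction l with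
  | nil =>
    intro h L _ _ _ _ _ _ _ _ _ _ H
    exact ⟨0, h, L, .skip _, H, fun _ h => h, by simp, by simp⟩
  | cons b l ih =>
    intro h L hl hn hm hpar hup hlo hroot hsub hidx hmask H
    obtain ⟨b', hb'⟩ := hmask
    obtain ⟨c1, c2, c3⟩ := hl b (by simp)
    set g := ((h.setCell .mask 1 b.1).setCell .mask 2 b.2.1).setCell .mask 3 b.2.2 with hg
    have hgm : g.arr .mask = maskOf b := by
      funext k
      simp only [hg, Store.setCell_arr, if_true, hb', Function.update_apply, maskOf]
      by_cases e1 : k = 1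
      · simp [e1]
      by_cases e2 : k = 2
      · simp [e2]
      by_cases e3 : k = 3
      · simp [e3]
      simp [e1, e2, e3]
    obtain ⟨t1, h1, r1, H1, l1⟩ := round_run T C S I g L (by simp [hg, hn]) (by simp [hg, hm])
      (by simp [hg, hpar]) (by simp [hg, hup]) (by simp [hg, hlo]) (by simp [hg, hroot])
      (by simp [hg, hsub]) (by simp [hg, hidx])
      (fun k => by
        rw [hgm, maskOf]
        split_ifs <;> omega)
      (by rw [hgm]; rfl) (by simpa [hg] using H)
    rw [hgm] at H1
    have r : (Cmd.pass b).Run h _ h1 :=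
      .seq (.put _ _ _ _) (.seq (.put _ _ _ _) (.seq (.put _ _ _ _) (.seq r1 (.skip _))))
    obtain ⟨t2, h2, L', r2, H2, m1, m2, l2⟩ := ih h1 _ (fun b hb => hl b (by simp [hb]))
      (by rw [r.frame.reg _ rfl, hn]) (by rw [r.frame.reg _ rfl, hm])
      (by rw [r.frame.arr _ rfl, hpar]) (by rw [r.frame.arr _ rfl, hup])
      (by rw [r.frame.arr _ rfl, hlo]) (by rw [r.frame.arr _ rfl, hroot])
      (by rw [r.frame.arr _ rfl, hsub]) (by rw [r.frame.arr _ rfl, hidx])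
      ⟨b, by rw [r1.frame.arr _ rfl, hgm]⟩ H1
    refine ⟨_, h2, L', .seq r r2, H2, fun μ hμ => m1 μ (by simp [hμ]), fun b' hb' => ?_, ?_⟩
    · rcases List.mem_cons.1 hb' with rfl | hb'
      · exact m1 _ (by simp)
      · exact m2 _ hb'
    · rw [List.length_cons, Nat.succ_mul, Nat.add_mul Cmd.roundTime]
      simp only [Expr.size]
      rw [Nat.add_mul Cmd.roundTime] at l2
      omega

theorem solve_run (T : IsSearchTree n m par up lo) (C : IsCutting n m par up lo root)
    (S : IsSub n par root sub) (I : IsIndexing n m par up lo root sub idx) (h : Store)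
    (hn : h.reg .n = n) (hm : h.reg .m = m) (hpar : h.arr .par = par) (hup : h.arr .up = up)
    (hlo : h.arr .lo = lo) (hroot : h.arr .root = root) (hsub : h.arr .sub = sub)
    (hidx : h.arr .idx = idx) (hmask : h.arr .mask = fun _ => 0)
    (hbcol : h.arr .bcol = fun _ => 0) :
    ∃ t h', Cmd.solve.Run h t h' ∧ IsSolution n m par up lo root sub (h'.arr .bcol) ∧
      t ≤ (8 * (Cmd.roundTime + 9) + 20) * (n + m + 1) := by
  obtain ⟨t1, h1, r1, a1, l1⟩ := Cmd.forUp_run (x := .w) (N := .n)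
    (p := .put .best (.var .w) (.succ (.var .m)))
    (fun k g => ∀ w < k, g.arr .best w = m + 1) (h₀ := h) rfl rfl rfl (by decide)
    (fun k g c hI => hI) (by simp) (by
      intro k g hk hgw hf hI w hw
      have e1 : g.reg .m = m := by rw [hf.reg _ rfl, hm]
      simp only [Cmd.den, Expr.eval, hgw, e1, Store.setCell_arr, if_true, Function.update_apply]
      split_ifs
      · rfl
      · exact hI w (by omega))
  rw [hn] at a1 l1
  obtain ⟨t2, h2, L', r2, H2, -, m2, l2⟩ := passes_run T C S I ([0, 1] ×ˢ [0, 1] ×ˢ [0, 1]) h1 []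
    (by simp +contextual)
    (by rw [r1.frame.reg _ rfl, hn]) (by rw [r1.frame.reg _ rfl, hm])
    (by rw [r1.frame.arr _ rfl, hpar]) (by rw [r1.frame.arr _ rfl, hup])
    (by rw [r1.frame.arr _ rfl, hlo]) (by rw [r1.frame.arr _ rfl, hroot])
    (by rw [r1.frame.arr _ rfl, hsub]) (by rw [r1.frame.arr _ rfl, hidx])
    ⟨(0, 0, 0), by
      rw [r1.frame.arr _ rfl, hmask]
      funext k
      simp [maskOf]⟩
    (by
      rw [r1.frame.arr .bcol rfl, hbcol]
      exact ⟨fun _ _ => Nat.zero_le _, fun _ _ _ => rfl, fun c hc => .inr (a1 c hc), by simp⟩)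
  refine ⟨_, h2, .seq r1 r2, H2.isSolution I fun b b1 b2 b3 => m2 b ?_, ?_⟩
  · obtain ⟨x, y, z⟩ := b
    simp only at b1 b2 b3
    interval_cases x <;> interval_cases y <;> interval_cases z <;> decide
  · have e : ([0, 1] ×ˢ [0, 1] ×ˢ [0, 1] : List (ℕ × ℕ × ℕ)).length = 8 := rfl
    rw [e] at l2
    simp only [Cmd.time, Expr.size] at l1
    generalize Cmd.roundTime + 9 = K at *
    have : (8 * K + 20) * (n + m + 1) = 8 * (K * (n + m + 1)) + 20 * n + 20 * m + 20 := by ring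
    omega

end

/-! ### Merging the colourings of the pieces -/

namespace Cmd

open SparseMaxCut.Expr (var const get succ pred)

/-- The key of an edge is the top of the piece of its lower end. -/
def keyStep : Cmd := put .key (var .i) (get .root (get .lo (var .i)))

/-- If the edge `i` goes up from the piece `v` to another piece, compare the final colour of its
upper end with the colour of its lower end. -/
def compareStep : Cmd :=
  block [set .u (get .up (var .i)), set .aux (get .root (var .u)),
    ite (.eq (var .aux) (var .v)) skip
      (block [
        ite (.eq (get .flip (var .aux)) (get .bcol (var .u))) (set .acc (const 0))
          (set .acc (const 1)),
        ite (.eq (var .acc) (get .bcol (get .lo (var .i)))) (set .same (succ (var .same)))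
          (set .diff (succ (var .diff)))])]

/-- Exchange the colours in the piece `v` if this helps the edges that go up from it. -/
def flipStep : Cmd :=
  block [set .same (const 0), set .diff (const 0),
    walk .i .j (get .khead (var .v)) .knext compareStep,
    ite (.lt (var .diff) (var .same)) (put .flip (var .v) (const 1)) skip]

/-- Decide for every piece, from the top down, whether its colours are exchanged. -/
def merge : Cmd :=
  block [forUp .i .m keyStep, buildLists .key .khead .knext .m, forUp .v .n flipStep]

end Cmd

/-- The colouring that arises from `bcol` when the colours in the pieces with `flip s = 1` are
exchanged. -/
def flipped (root bcol flip : ℕ → ℕ) (x : ℕ) : ℕ := if flip (root x) = bcol x then 0 else 1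

/-- The edges that go up from the piece `s` to other pieces. -/
def cross (m : ℕ) (up lo root : ℕ → ℕ) (s : ℕ) : Finset ℕ :=
  (Finset.range m).filter fun i => root (lo i) = s ∧ root (up i) ≠ s

/-- At most half of the edges that go up from the piece `s` to other pieces are not in the cut. -/
def Balanced (m : ℕ) (up lo root bcol flip : ℕ → ℕ) (s : ℕ) : Prop :=
  2 * ((cross m up lo root s).filter fun i =>
    flipped root bcol flip (up i) = flipped root bcol flip (lo i)).card
      ≤ (cross m up lo root s).card

section

variable {n m : ℕ} {par up lo root bcol flip : ℕ → ℕ}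

theorem IsCutting.root_le_of_anc (T : IsSearchTree n m par up lo)
    (C : IsCutting n m par up lo root) {u w : ℕ} (hw : w < n) (h : Anc par u w) :
    root u = root w ∨ u < root w := by
  induction w using Nat.strong_induction_on with
  | _ w ih =>
    by_cases e : u = w
    · exact .inl (by rw [e])
    · have hanc := h.par_of_ne e
      have hpn : par w < n := (T.parent.le hw).trans_lt hw
      have hle := T.parent.anc_le hpn hanc
      have h0 : 0 < w := by
        rcases Nat.eq_zero_or_pos w with rfl | h0
        · rw [T.parent.zero] at hle
          omega
        · exact h0
      have hlt := T.parent.lt w h0 hw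
      by_cases hr : root w = w
      · exact .inr (by omega)
      · rw [← C.root_par w hw hr]
        exact ih _ hlt hpn hanc

theorem cross_root_lt (T : IsSearchTree n m par up lo) (C : IsCutting n m par up lo root)
    {i s : ℕ} (hi : i ∈ cross m up lo root s) : root (up i) < s := by
  simp only [cross, Finset.mem_filter, Finset.mem_range] at hi
  obtain ⟨hm, h1, h2⟩ := hi
  have h3 := C.le _ (T.up_lt_n hm)
  rcases C.root_le_of_anc T (T.lo_lt i hm) (T.anc i hm) with h | h <;> omega

theorem Balanced.congr (T : IsSearchTree n m par up lo) (C : IsCutting n m par up lo root)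
    {flip' : ℕ → ℕ} {s : ℕ} (H : Balanced m up lo root bcol flip s)
    (h : ∀ x ≤ s, flip' x = flip x) : Balanced m up lo root bcol flip' s := by
  unfold Balanced at H ⊢
  convert H using 3
  refine Finset.filter_congr fun i hi => ?_
  have h1 := cross_root_lt T C hi
  have h2 : root (lo i) = s := (Finset.mem_filter.1 hi).2.1
  rw [flipped, flipped, flipped, flipped, h _ h1.le, h _ h2.le]

/-- The number of edges from the piece `s` to other pieces that are bad (`b = true`) or good
(`b = false`) if the colours in the piece `s` are not exchanged. -/
def upCount (m : ℕ) (up lo root bcol flip : ℕ → ℕ) (s : ℕ) (b : Bool) : ℕ :=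
  ((cross m up lo root s).filter fun i =>
    decide (flipped root bcol flip (up i) = bcol (lo i)) = b).card

theorem balanced_of_upCount (T : IsSearchTree n m par up lo) (C : IsCutting n m par up lo root)
    (hb : ∀ w < n, bcol w ≤ 1) {s : ℕ} (h0 : flip s = 0) :
    Balanced m up lo root bcol (if upCount m up lo root bcol flip s false
      < upCount m up lo root bcol flip s true then Function.update flip s 1 else flip) s := by
  have hsum : upCount m up lo root bcol flip s true + upCount m up lo root bcol flip s false
      = (cross m up lo root s).card := by
    rw [upCount, upCount,
      ← Finset.card_filter_add_card_filter_not (s := cross m up lo root s)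
      (fun i => flipped root bcol flip (up i) = bcol (lo i))]
    simp
  have hup : ∀ i ∈ cross m up lo root s, ∀ c, flipped root bcol (Function.update flip s c) (up i)
      = flipped root bcol flip (up i) := by
    intro i hi c
    rw [flipped, flipped, Function.update_of_ne (cross_root_lt T C hi).ne]
  have hlo : ∀ i ∈ cross m up lo root s, root (lo i) = s ∧ bcol (lo i) ≤ 1 := by
    intro i hi
    simp only [cross, Finset.mem_filter, Finset.mem_range] at hi
    exact ⟨hi.2.1, hb _ (T.lo_lt i hi.1)⟩
  unfold Balanced
  split_ifs with hlt
  · have : ((cross m up lo root s).filter fun i =>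
        flipped root bcol (Function.update flip s 1) (up i)
          = flipped root bcol (Function.update flip s 1) (lo i)).card
        = upCount m up lo root bcol flip s false := by
      rw [upCount]
      congr 1
      refine Finset.filter_congr fun i hi => ?_
      obtain ⟨h1, h2⟩ := hlo i hi
      rw [hup i hi, decide_eq_false_iff_not]
      generalize hx : flipped root bcol flip (up i) = x
      have hx1 : x ≤ 1 := by rw [← hx, flipped]; split_ifs <;> omega
      rw [flipped, h1, Function.update_self]
      split_ifs <;> omega
    omega
  · have : ((cross m up lo root s).filter fun i =>
        flipped root bcol flip (up i) = flipped root bcol flip (lo i)).card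
        = upCount m up lo root bcol flip s true := by
      rw [upCount]
      congr 1
      refine Finset.filter_congr fun i hi => ?_
      obtain ⟨h1, h2⟩ := hlo i hi
      rw [decide_eq_true_iff]
      generalize flipped root bcol flip (up i) = x
      rw [flipped, h1, h0]
      split_ifs <;> omega
    omega

theorem compare_walk {key : ℕ → ℕ} {s : ℕ} (hkey : ∀ i < m, key i = root (lo i)) (h : Store)
    (hup : h.arr .up = up) (hlo : h.arr .lo = lo) (hroot : h.arr .root = root)
    (hbcol : h.arr .bcol = bcol) (hflip : h.arr .flip = flip) (hv : h.reg .v = s)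
    (hsame : h.reg .same = 0) (hdiff : h.reg .diff = 0)
    (hch : IsChain (h.arr .knext) (h.arr .khead s) (bucket key m s)) :
    ∃ t h', (Cmd.walk .i .j (.get .khead (.var .v)) .knext Cmd.compareStep).Run h t h' ∧
      h'.reg .same = upCount m up lo root bcol flip s true ∧
      h'.reg .diff = upCount m up lo root bcol flip s false ∧
      t ≤ (Cmd.compareStep.time + 9) * (bucket key m s).length + 7 := by
  let f : Bool → ℕ → ℕ := fun b i => if root (up i) ≠ s ∧
    decide (flipped root bcol flip (up i) = bcol (lo i)) = b then 1 else 0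
  have hf : ∀ b, ((bucket key m s).map (f b)).sum = upCount m up lo root bcol flip s b := by
    intro b
    rw [sum_bucket, upCount, cross, Finset.filter_filter, Finset.card_filter, Finset.sum_filter]
    refine Finset.sum_congr rfl fun i hi => ?_
    rw [hkey i (Finset.mem_range.1 hi)]
    by_cases h1 : root (lo i) = s <;> simp [f, h1]
  obtain ⟨t, h', r, hI, ht⟩ := Cmd.walk_run (i := .i) (j := .j) (e := .get .khead (.var .v))
    (next := .knext) (p := Cmd.compareStep)
    (fun l g => g.reg .same + (l.map (f true)).sum = upCount m up lo root bcol flip s true ∧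
      g.reg .diff + (l.map (f false)).sum = upCount m up lo root bcol flip s false)
    (h₀ := h) (l₀ := bucket key m s) rfl rfl rfl (fun k g c => by simp)
    (by simpa [Expr.eval, hv] using hch) (by simp [hsame, hdiff, hf]) (by
      intro k l g hk hfr hsuf hI
      have e1 : g.arr .up = up := by rw [hfr.arr _ rfl, hup]
      have e2 : g.arr .lo = lo := by rw [hfr.arr _ rfl, hlo]
      have e3 : g.arr .root = root := by rw [hfr.arr _ rfl, hroot]
      have e4 : g.arr .bcol = bcol := by rw [hfr.arr _ rfl, hbcol]
      have e5 : g.arr .flip = flip := by rw [hfr.arr _ rfl, hflip]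
      have e6 : g.reg .v = s := by rw [hfr.reg _ rfl, hv]
      rw [List.map_cons, List.sum_cons, List.map_cons, List.sum_cons] at hI
      have hval : (Cmd.compareStep.den g).reg .same = g.reg .same + f true k ∧
          (Cmd.compareStep.den g).reg .diff = g.reg .diff + f false k := by
        simp only [Cmd.compareStep, Cmd.block, Cmd.den, Cond.Holds, Expr.eval, e1, e3, e4, e5,
          e6, hk, Store.setVar_arr, Store.setVar_reg, reduceCtorEq, if_true, if_false, f, flipped]
        by_cases c1 : root (up k) = s
        · simp [c1]
        · by_cases c2 : flip (root (up k)) = bcol (up k)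
          · by_cases c3 : 0 = bcol (lo k) <;> simp [c1, c2, c3, e2, e4, hk]
          · by_cases c3 : 1 = bcol (lo k) <;> simp [c1, c2, c3, e2, e4, hk]
      rw [hval.1, hval.2]
      omega)
  exact ⟨t, h', r, by simpa using hI.1, by simpa using hI.2, by simpa [Expr.size] using ht⟩

theorem merge_run (T : IsSearchTree n m par up lo) (C : IsCutting n m par up lo root)
    (hb : ∀ w < n, bcol w ≤ 1) (h : Store) (hn : h.reg .n = n) (hm : h.reg .m = m)
    (hup : h.arr .up = up) (hlo : h.arr .lo = lo) (hroot : h.arr .root = root)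
    (hbcol : h.arr .bcol = bcol) (hflip : h.arr .flip = fun _ => 0)
    (hkhead : h.arr .khead = fun _ => 0) :
    ∃ t h', Cmd.merge.Run h t h' ∧ (∀ s, h'.arr .flip s ≤ 1) ∧
      (∀ s < n, Balanced m up lo root bcol (h'.arr .flip) s) ∧
      t ≤ (Cmd.compareStep.time + 89) * (n + m + 1) := by
  set A := Cmd.compareStep.time + 9 with hA
  obtain ⟨t1, h1, r1, a1, l1⟩ := Cmd.forUp_run (x := .i) (N := .m) (p := Cmd.keyStep)
    (fun k g => ∀ i < k, g.arr .key i = root (lo i)) (h₀ := h) rfl rfl rfl (by decide)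
    (fun k g c hI => hI) (by simp) (by
      intro k g hk hgi hf hI i hi
      have e1 : g.arr .lo = lo := by rw [hf.arr _ rfl, hlo]
      have e2 : g.arr .root = root := by rw [hf.arr _ rfl, hroot]
      simp only [Cmd.keyStep, Cmd.den, Expr.eval, hgi, e1, e2, Store.setCell_arr, if_true,
        Function.update_apply]
      split_ifs with e
      · rw [e]
      · exact hI i (by omega))
  rw [hm] at a1 l1
  obtain ⟨t2, h2, r2, a2, l2⟩ := Cmd.buildLists_run (key := .key) (head := .khead)
    (next := .knext) (N := .m) (by decide) (by decide) (by decide) (by decide) h1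
    (by rw [r1.frame.arr _ rfl, hkhead])
  have hm1 : h1.reg .m = m := by rw [r1.frame.reg _ rfl, hm]
  rw [hm1] at a2 l2
  set key := h1.arr .key with hkey
  have hn2 : h2.reg .n = n := by rw [r2.frame.reg _ rfl, r1.frame.reg _ rfl, hn]
  have hup2 : h2.arr .up = up := by rw [r2.frame.arr _ rfl, r1.frame.arr _ rfl, hup]
  have hlo2 : h2.arr .lo = lo := by rw [r2.frame.arr _ rfl, r1.frame.arr _ rfl, hlo]
  have hroot2 : h2.arr .root = root := by rw [r2.frame.arr _ rfl, r1.frame.arr _ rfl, hroot]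
  have hbcol2 : h2.arr .bcol = bcol := by rw [r2.frame.arr _ rfl, r1.frame.arr _ rfl, hbcol]
  have hflip2 : h2.arr .flip = fun _ => 0 := by rw [r2.frame.arr _ rfl, r1.frame.arr _ rfl, hflip]
  have hlen : ∑ x ∈ Finset.range n, (bucket key m x).length = m := sum_length_bucket fun i hi => by
    rw [a1 i hi]
    exact (C.le _ (T.lo_lt i hi)).trans_lt (T.lo_lt i hi)
  obtain ⟨t3, h3, φ', r3, ⟨b1, -, b3, -⟩, l3⟩ := Cmd.forUp_run_amortized (x := .v) (N := .n)
    (p := Cmd.flipStep)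
    (fun k φ g => (∀ s, g.arr .flip s ≤ 1) ∧ (∀ s, k ≤ s → g.arr .flip s = 0) ∧
      (∀ s < k, Balanced m up lo root bcol (g.arr .flip) s) ∧
      φ + A * ∑ x ∈ Finset.range k, (bucket key m x).length = A * m)
    30 (h₀ := h2) (φ₀ := A * m) rfl rfl (by decide) (fun k φ g c hI => hI)
    (by simp [hflip2])
    (by
      rintro k φ g hk hgv hf ⟨H1, H2, H3, H4⟩
      rw [hn2] at hk
      obtain ⟨t, g', r, w1, w2, l⟩ := compare_walk (s := k) a1
        ((g.setVar .same 0).setVar .diff 0)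
        (up := up) (bcol := bcol) (flip := g.arr .flip)
        (by simp [hf.arr .up rfl, hup2]) (by simp [hf.arr .lo rfl, hlo2])
        (by simp [hf.arr .root rfl, hroot2]) (by simp [hf.arr .bcol rfl, hbcol2]) (by simp)
        (by simp [hgv]) (by simp) (by simp)
        (by simpa [hf.arr .knext rfl, hf.arr .khead rfl] using a2 k)
      have f1 : g'.arr .flip = g.arr .flip := by rw [r.frame.arr _ rfl]; simp
      have f2 : g'.reg .v = k := by rw [r.frame.reg _ rfl]; simp [hgv]
      have q : ∃ t'' g'', (Cmd.ite (.lt (.var .diff) (.var .same))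
          (.put .flip (.var .v) (.const 1)) .skip).Run g' t'' g'' ∧ t'' ≤ 10 ∧
          g''.arr .flip = if upCount m up lo root bcol (g.arr .flip) k false
            < upCount m up lo root bcol (g.arr .flip) k true
            then Function.update (g.arr .flip) k 1 else g.arr .flip := by
        by_cases c : upCount m up lo root bcol (g.arr .flip) k false
            < upCount m up lo root bcol (g.arr .flip) k true
        · refine ⟨_, _, .ite_true (by simpa [Cond.Holds, Expr.eval, w1, w2] using c)
            (.put _ _ _ _), by simp [Cond.size, Expr.size], ?_⟩
          simp [c, Expr.eval, f1, f2]
        · refine ⟨_, _, .ite_false (by simpa [Cond.Holds, Expr.eval, w1, w2] using c)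
            (.skip _), by simp [Cond.size, Expr.size], ?_⟩
          simp [c, f1]
      obtain ⟨t'', g'', q, lq, hq⟩ := q
      have hbal := balanced_of_upCount T C hb (H2 k le_rfl)
      rw [← hq] at hbal
      have hne : ∀ s, s ≠ k → g''.arr .flip s = g.arr .flip s := by
        intro s hs
        rw [hq]
        split_ifs <;> simp [hs]
      have hsucc : A * ∑ x ∈ Finset.range (k + 1), (bucket key m x).length
          = A * ∑ x ∈ Finset.range k, (bucket key m x).length
            + A * (bucket key m k).length := by
        rw [Finset.sum_range_succ, Nat.mul_add]
      have hle : A * ∑ x ∈ Finset.range (k + 1), (bucket key m x).length ≤ A * m := by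
        refine Nat.mul_le_mul_left _ (le_trans (Finset.sum_le_sum_of_subset ?_) hlen.le)
        exact Finset.range_subset_range.2 hk
      refine ⟨_, g'', φ - A * (bucket key m k).length,
        .seq (.set _ _ _) (.seq (.set _ _ _) (.seq r (.seq q (.skip _)))),
        ⟨fun s => ?_, fun s hs => ?_, fun s hs => ?_, ?_⟩, ?_⟩
      · by_cases e : s = k
        · rw [hq, e]
          split_ifs
          · simp
          · exact H1 k
        · rw [hne s e]
          exact H1 s
      · rw [hne s (by omega)]
        exact H2 s (by omega)
      · rcases Nat.lt_succ_iff_lt_or_eq.1 hs with hs | rfl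
        · exact (H3 s hs).congr T C fun x hx => hne x (by omega)
        · exact hbal
      · rw [hsucc]
        omega
      · simp only [Expr.size]
        rw [hsucc] at hle
        generalize A * (bucket key m k).length = Z at *
        generalize A * ∑ x ∈ Finset.range k, (bucket key m x).length = Y at *
        omega)
  rw [hn2] at b3 l3
  refine ⟨_, h3, .seq r1 (.seq r2 (.seq r3 (.skip _))), b1, b3, ?_⟩
  have e : (Cmd.compareStep.time + 89) * (n + m + 1) = A * n + A * m + A + 80 * n + 80 * m + 80 := by
    rw [hA]
    ring
  simp only [Cmd.keyStep, Cmd.time, Expr.size] at l1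
  rw [e]
  generalize A * m = Y at *
  omega

end

/-! ### The quality of the merged colouring -/

/-- The edges with ends of the same colour. -/
def badEdges (m : ℕ) (up lo x : ℕ → ℕ) : Finset ℕ :=
  (Finset.range m).filter fun i => x (up i) = x (lo i)

section

variable {n m : ℕ} {par up lo root sub bcol flip : ℕ → ℕ}

/-- There is a proper colouring of the search tree. -/
theorem IsSearchTree.exists_proper (T : IsSearchTree n m par up lo) :
    ∃ p : ℕ → ℕ, (∀ w, p w ≤ 1) ∧ ∀ w, 0 < w → w < n → p (par w) ≠ p w := by
  suffices H : ∀ k ≤ n, ∃ p : ℕ → ℕ, (∀ w, p w ≤ 1) ∧ ∀ w, 0 < w → w < k → p (par w) ≠ p w from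
    H n le_rfl
  intro k
  induction k with
  | zero => exact fun _ => ⟨fun _ => 0, by simp, by simp⟩
  | succ k ih =>
    intro hk
    obtain ⟨p, hp, hq⟩ := ih (by omega)
    refine ⟨Function.update p k (1 - p (par k)), fun w => ?_, fun w h0 hw => ?_⟩
    · rw [Function.update_apply]
      split_ifs
      · omega
      · exact hp w
    · have hlt := T.parent.lt w h0 (by omega)
      rw [Function.update_of_ne (by omega)]
      by_cases e : w = k
      · subst e
        rw [Function.update_self]
        have := hp (par w)
        omega
      · rw [Function.update_of_ne e]
        exact hq w h0 (by omega)

/-- The restriction on the colour of the top is harmless, since the two colours can be exchanged. -/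
theorem IsSolution.badIn_le (H : IsSolution n m par up lo root sub bcol) {y : ℕ → ℕ}
    (hy : ∀ w, y w ≤ 1) {c : ℕ} (hc : c < n) : badIn m up lo root sub bcol c ≤ badIn m up lo root sub y c := by
  by_cases h0 : y (par c) = 0
  · exact H.opt c hc y (fun w _ => hy w) h0
  · have h1 := H.opt c hc (fun w => 1 - y w) (fun w _ => by omega) (by
      have := hy (par c)
      omega)
    refine h1.trans_eq ?_
    rw [badIn, badIn]
    congr 1
    refine Finset.filter_congr fun i _ => ?_
    have := hy (up i)
    have := hy (lo i)
    omega

theorem sum_badIn (T : IsSearchTree n m par up lo) (C : IsCutting n m par up lo root)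
    (S : IsSub n par root sub) (x : ℕ → ℕ) :
    ∑ c ∈ Finset.range n, badIn m up lo root sub x c
      = ((internal m up lo root).filter fun i => x (up i) = x (lo i)).card := by
  rw [Finset.card_eq_sum_card_fiberwise (f := fun i => sub (lo i)) (t := Finset.range n)]
  · refine Finset.sum_congr rfl fun c _ => ?_
    rw [badIn, branch, Finset.filter_filter, Finset.filter_filter]
    congr 1
    exact Finset.filter_congr fun i _ => and_comm
  · intro i hi
    have hi' := (Finset.mem_filter.1 (Finset.mem_coe.1 hi)).1
    have hm : i < m := by simpa using (Finset.mem_filter.1 hi').1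
    have hlo := T.lo_lt i hm
    have h1 := S.par_sub T C hlo (C.root_ne_lo T hm (Finset.mem_filter.1 hi').2)
    simpa using (T.parent.anc_le hlo h1.2.2.1).trans_lt hlo

theorem IsSolution.card_bad_internal_le (T : IsSearchTree n m par up lo)
    (C : IsCutting n m par up lo root) (S : IsSub n par root sub)
    (H : IsSolution n m par up lo root sub bcol) {y : ℕ → ℕ} (hy : ∀ w, y w ≤ 1) :
    ((internal m up lo root).filter fun i => bcol (up i) = bcol (lo i)).card
      ≤ ((internal m up lo root).filter fun i => y (up i) = y (lo i)).card := by
  rw [← sum_badIn T C S, ← sum_badIn T C S]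
  exact Finset.sum_le_sum fun c hc => H.badIn_le hy (Finset.mem_range.1 hc)

/-- A proper colouring of the tree shows that the cost of an optimal colouring is at most the
number of edges outside the tree. -/
theorem IsSolution.card_bad_internal_le_extra (T : IsSearchTree n m par up lo)
    (C : IsCutting n m par up lo root) (S : IsSub n par root sub)
    (H : IsSolution n m par up lo root sub bcol) :
    ((internal m up lo root).filter fun i => bcol (up i) = bcol (lo i)).card
      ≤ ((extra m par up lo).filter fun i => root (up i) = root (lo i)).card := by
  obtain ⟨p, hp, hq⟩ := T.exists_proper
  refine (H.card_bad_internal_le T C S hp).trans (Finset.card_le_card fun i hi => ?_)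
  simp only [internal, extra, Finset.mem_filter, Finset.mem_range] at hi ⊢
  refine ⟨⟨hi.1.1, fun e => ?_⟩, hi.1.2⟩
  have := T.up_lt i hi.1.1
  exact hq (lo i) (by omega) (T.lo_lt i hi.1.1) (by rw [e]; exact hi.2)

/-- Every label that is not the top of its piece contributes a tree edge inside the piece. -/
theorem card_internal_ge (T : IsSearchTree n m par up lo) (C : IsCutting n m par up lo root) :
    ((extra m par up lo).filter fun i => root (up i) = root (lo i)).card
      + ((Finset.range n).filter fun w => root w ≠ w).card ≤ (internal m up lo root).card := by
  rw [← Finset.card_filter_add_card_filter_not (s := internal m up lo root)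
    (fun i => par (lo i) ≠ up i)]
  refine Nat.add_le_add (Finset.card_le_card fun i hi => ?_) ?_
  · simp only [internal, extra, Finset.mem_filter] at hi ⊢
    exact ⟨⟨hi.1.1, hi.2⟩, hi.1.2⟩
  · refine (Finset.card_le_card fun w hw => ?_).trans (Finset.card_image_le (f := lo))
    simp only [Finset.mem_filter, Finset.mem_range] at hw
    obtain ⟨hw, hr⟩ := hw
    have h0 : 0 < w := by
      rcases Nat.eq_zero_or_pos w with rfl | h
      · exact absurd (Nat.le_zero.1 (C.le 0 hw)) hr
      · exact h
    obtain ⟨i, hm, e1, e2⟩ := T.tree w h0 hw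
    refine Finset.mem_image.2 ⟨i, ?_, e2⟩
    simp only [internal, Finset.mem_filter, Finset.mem_range, e1, e2]
    exact ⟨⟨hm, C.root_par w hw hr⟩, by simp⟩

theorem four_mul_card_tops_le (C : IsCutting n m par up lo root) :
    4 * ((Finset.range n).filter fun s => root s = s ∧ 0 < s).card
      ≤ ((extra m par up lo).filter fun i => root (up i) = root (lo i)).card := by
  set R := (Finset.range n).filter fun s => root s = s ∧ 0 < s with hR
  calc 4 * R.card = ∑ s ∈ R, 4 := by simp [mul_comm]
    _ ≤ ∑ s ∈ R, (((extra m par up lo).filter fun i => root (up i) = root (lo i)).filter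
        fun i => root (lo i) = s).card := by
      refine Finset.sum_le_sum fun s hs => ?_
      simp only [hR, Finset.mem_filter, Finset.mem_range] at hs
      refine (C.big s hs.1 hs.2.2 hs.2.1).trans (Finset.card_le_card fun i hi => ?_)
      simp only [Finset.mem_filter] at hi ⊢
      exact ⟨⟨hi.1, by rw [hi.2.1, hi.2.2]⟩, hi.2.2⟩
    _ = (((extra m par up lo).filter fun i => root (up i) = root (lo i)).filter
        fun i => root (lo i) ∈ R).card := (Finset.sum_card_fiberwise_eq_card_filter _ _ _)
    _ ≤ _ := Finset.card_le_card (Finset.filter_subset _ _)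

theorem two_mul_card_bad_cross_le (T : IsSearchTree n m par up lo)
    (C : IsCutting n m par up lo root) (hbal : ∀ s < n, Balanced m up lo root bcol flip s) :
    2 * ((badEdges m up lo (flipped root bcol flip)).filter
      fun i => ¬root (up i) = root (lo i)).card + (internal m up lo root).card ≤ m := by
  have hmaps : ∀ i < m, root (lo i) ∈ Finset.range n := fun i hi =>
    Finset.mem_range.2 ((C.le _ (T.lo_lt i hi)).trans_lt (T.lo_lt i hi))
  have h1 : ((badEdges m up lo (flipped root bcol flip)).filter
      fun i => ¬root (up i) = root (lo i)).card = ∑ s ∈ Finset.range n,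
        ((cross m up lo root s).filter fun i =>
          flipped root bcol flip (up i) = flipped root bcol flip (lo i)).card := by
    rw [Finset.card_eq_sum_card_fiberwise (f := fun i => root (lo i)) (t := Finset.range n)]
    · refine Finset.sum_congr rfl fun s _ => ?_
      congr 1
      ext i
      simp only [badEdges, cross, Finset.mem_filter, Finset.mem_range]
      constructor
      · rintro ⟨⟨⟨h1, h2⟩, h3⟩, rfl⟩
        exact ⟨⟨h1, rfl, h3⟩, h2⟩
      · rintro ⟨⟨h1, rfl, h3⟩, h2⟩
        exact ⟨⟨⟨h1, h2⟩, h3⟩, rfl⟩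
    · intro i hi
      simp only [badEdges, Finset.coe_filter, Finset.mem_filter, Finset.mem_range,
        Set.mem_ofPred_eq] at hi
      exact hmaps i hi.1.1
  have h2 : ((Finset.range m).filter fun i => ¬root (up i) = root (lo i)).card
      = ∑ s ∈ Finset.range n, (cross m up lo root s).card := by
    rw [Finset.card_eq_sum_card_fiberwise (f := fun i => root (lo i)) (t := Finset.range n)]
    · refine Finset.sum_congr rfl fun s _ => ?_
      congr 1
      ext i
      simp only [cross, Finset.mem_filter, Finset.mem_range]
      constructor
      · rintro ⟨⟨h1, h3⟩, rfl⟩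
        exact ⟨h1, rfl, h3⟩
      · rintro ⟨h1, rfl, h3⟩
        exact ⟨⟨h1, h3⟩, rfl⟩
    · intro i hi
      simp only [Finset.coe_filter, Finset.mem_range, Set.mem_ofPred_eq] at hi
      exact hmaps i hi.1
  have h3 := Finset.card_filter_add_card_filter_not (s := Finset.range m)
    (fun i => root (up i) = root (lo i))
  rw [Finset.card_range] at h3
  have h4 : 2 * ∑ s ∈ Finset.range n, ((cross m up lo root s).filter fun i =>
      flipped root bcol flip (up i) = flipped root bcol flip (lo i)).card
        ≤ ∑ s ∈ Finset.range n, (cross m up lo root s).card := by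
    rw [Finset.mul_sum]
    exact Finset.sum_le_sum fun s hs => hbal s (Finset.mem_range.1 hs)
  rw [h1, internal]
  omega

/-- If there is only one piece, the merged colouring is optimal. Otherwise its cost is at most
`(m - n) / 2` plus three quarters of the optimal cost: all bad edges inside pieces are bounded both
by the optimal cost and by the number of edges outside the tree inside pieces, which is large
because every piece but one has at least four of them. -/
theorem IsSolution.card_badEdges_le (T : IsSearchTree n m par up lo)
    (C : IsCutting n m par up lo root) (S : IsSub n par root sub)
    (H : IsSolution n m par up lo root sub bcol) (hflip : ∀ s, flip s ≤ 1)
    (hbal : ∀ s < n, Balanced m up lo root bcol flip s) (hn : 0 < n) {y : ℕ → ℕ}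
    (hy : ∀ w, y w ≤ 1) :
    (badEdges m up lo (flipped root bcol flip)).card ≤ (badEdges m up lo y).card ∨
      4 * (badEdges m up lo (flipped root bcol flip)).card + 2 * n
        ≤ 2 * m + 3 * (badEdges m up lo y).card := by
  set k := ((extra m par up lo).filter fun i => root (up i) = root (lo i)).card with hk
  have h1 := Finset.card_filter_add_card_filter_not
    (s := badEdges m up lo (flipped root bcol flip)) (fun i => root (up i) = root (lo i))
  have h2 : ((badEdges m up lo (flipped root bcol flip)).filter
      fun i => root (up i) = root (lo i)).card
      = ((internal m up lo root).filter fun i => bcol (up i) = bcol (lo i)).card := by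
    rw [badEdges, internal, Finset.filter_filter, Finset.filter_filter]
    congr 1
    refine Finset.filter_congr fun i hi => ?_
    have hi := Finset.mem_range.1 hi
    have b1 := H.le _ (T.up_lt_n hi)
    have b2 := H.le _ (T.lo_lt i hi)
    have b3 := hflip (root (lo i))
    rw [and_comm]
    refine and_congr_right fun e => ?_
    rw [flipped, flipped, e]
    generalize bcol (up i) = a at b1
    generalize bcol (lo i) = b at b2
    generalize flip (root (lo i)) = c at b3
    interval_cases a <;> interval_cases b <;> interval_cases c <;> decide
  have h3 := H.card_bad_internal_le T C S hy
  have h4 : ((internal m up lo root).filter fun i => y (up i) = y (lo i)).card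
      ≤ (badEdges m up lo y).card := by
    refine Finset.card_le_card fun i hi => ?_
    simp only [internal, badEdges, Finset.mem_filter] at hi ⊢
    exact ⟨hi.1.1, hi.2⟩
  have h5 := H.card_bad_internal_le_extra T C S
  have h6 := card_internal_ge T C
  have h7 := four_mul_card_tops_le C
  have h8 := two_mul_card_bad_cross_le T C hbal
  have h9 := Finset.card_filter_add_card_filter_not (s := Finset.range n) (fun w => root w = w)
  rw [Finset.card_range] at h9
  have h10 : ((Finset.range n).filter fun w => root w = w).card
      = ((Finset.range n).filter fun s => root s = s ∧ 0 < s).card + 1 := by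
    have : (Finset.range n).filter (fun w => root w = w)
        = insert 0 ((Finset.range n).filter fun s => root s = s ∧ 0 < s) := by
      ext w
      rcases Nat.eq_zero_or_pos w with rfl | h
      · simp [hn, Nat.le_zero.1 (C.le 0 hn)]
      · simp [h, h.ne']
    rw [this, Finset.card_insert_of_notMem (by simp)]
  by_cases hP : ((Finset.range n).filter fun s => root s = s ∧ 0 < s) = ∅
  · left
    have hroot : ∀ w < n, root w = 0 := by
      intro w hw
      by_contra h
      have : root w ∈ ((Finset.range n).filter fun s => root s = s ∧ 0 < s) := by
        simp only [Finset.mem_filter, Finset.mem_range]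
        exact ⟨(C.le w hw).trans_lt hw, C.root_root w hw, Nat.pos_of_ne_zero h⟩
      rw [hP] at this
      simp at this
    have h11 : ((badEdges m up lo (flipped root bcol flip)).filter
        fun i => ¬root (up i) = root (lo i)).card = 0 := by
      rw [Finset.card_eq_zero, Finset.filter_eq_empty_iff]
      intro i hi
      have hi : i < m := by simpa using (Finset.mem_filter.1 hi).1
      rw [hroot _ (T.up_lt_n hi), hroot _ (T.lo_lt i hi)]
      simp
    omega
  · right
    have hpos := Finset.card_pos.2 (Finset.nonempty_iff_ne_empty.2 hP)
    simp only [ne_eq] at h6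
    omega

end

/-! ### Graphs and edge lists -/

section

variable {n : ℕ} {G : SimpleGraph (Fin n)} {es : List (Fin n × Fin n)}

/-- The first end of the edge number `i`, as in the array `M 0` of the input. -/
def firstEnd (es : List (Fin n × Fin n)) (i : ℕ) : ℕ := (es.map fun e => (e.1 : ℕ)).getD i 0

/-- The second end of the edge number `i`, as in the array `M 1` of the input. -/
def secondEnd (es : List (Fin n × Fin n)) (i : ℕ) : ℕ := (es.map fun e => (e.2 : ℕ)).getD i 0

theorem firstEnd_eq {i : ℕ} (hi : i < es.length) : firstEnd es i = es[i].1 := by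
  simp [firstEnd, hi]

theorem secondEnd_eq {i : ℕ} (hi : i < es.length) : secondEnd es i = es[i].2 := by
  simp [secondEnd, hi]

theorem _root_.IsEdgeList.adj_getElem (H : IsEdgeList G es) {i : ℕ} (hi : i < es.length) :
    G.Adj es[i].1 es[i].2 := by
  rw [← SimpleGraph.mem_edgeSet, ← H.2]
  exact List.mem_map.2 ⟨es[i], List.getElem_mem hi, rfl⟩

theorem _root_.IsEdgeList.eq_of_sym2 (H : IsEdgeList G es) {i j : ℕ} (hi : i < es.length)
    (hj : j < es.length) (h : s(es[i].1, es[i].2) = s(es[j].1, es[j].2)) : i = j := by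
  refine (H.1.getElem_inj_iff (i := i) (j := j) (hi := by simpa) (hj := by simpa)).1 ?_
  simpa using h

theorem _root_.IsEdgeList.exists_getElem (H : IsEdgeList G es) {a b : Fin n} (h : G.Adj a b) :
    ∃ (i : ℕ) (hi : i < es.length), s(es[i].1, es[i].2) = s(a, b) := by
  rw [← SimpleGraph.mem_edgeSet, ← H.2] at h
  obtain ⟨e, he, h⟩ := List.mem_map.1 h
  obtain ⟨i, hi, rfl⟩ := List.getElem_of_mem he
  exact ⟨i, hi, h⟩

theorem _root_.IsEdgeList.card_edgeFinset [DecidableRel G.Adj] (H : IsEdgeList G es) :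
    G.edgeFinset.card = es.length := by
  rw [← List.length_map (as := es) (fun e => s(e.1, e.2)), ← List.toFinset_card_of_nodup H.1]
  congr 1
  ext e
  rw [SimpleGraph.mem_edgeFinset, List.mem_toFinset, H.2]

theorem _root_.IsEdgeList.isInput (H : IsEdgeList G es) (hG : G.Connected) :
    IsInput n es.length (firstEnd es) (secondEnd es) := by
  have hn : 0 < n := Fin.pos_iff_nonempty.2 hG.nonempty
  refine ⟨hn, fun i hi => ?_, fun i hi => ?_, fun i hi => ?_, fun i hi j hj h => ?_,
    fun P h0 hP w hw => ?_⟩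
  · rw [firstEnd_eq hi]
    exact es[i].1.2
  · rw [secondEnd_eq hi]
    exact es[i].2.2
  · rw [firstEnd_eq hi, secondEnd_eq hi]
    exact fun h => (H.adj_getElem hi).ne (Fin.ext h)
  · rw [firstEnd_eq hi, secondEnd_eq hi, firstEnd_eq hj, secondEnd_eq hj] at h
    refine H.eq_of_sym2 hi hj (Sym2.eq_iff.2 ?_)
    simpa [Fin.ext_iff] using h
  · obtain ⟨p⟩ := hG.preconnected ⟨0, hn⟩ ⟨w, hw⟩
    have key : ∀ {a b : Fin n}, G.Walk a b → P a → P b := by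
      intro a b p
      induction p with
      | nil => exact id
      | cons h _ ih =>
        intro ha
        refine ih ?_
        obtain ⟨i, hi, e⟩ := H.exists_getElem h
        have hPi := hP i hi
        rw [firstEnd_eq hi, secondEnd_eq hi] at hPi
        rcases Sym2.eq_iff.1 e with ⟨e1, e2⟩ | ⟨e1, e2⟩
        · rw [e1, e2] at hPi
          exact hPi.1 ha
        · rw [e1, e2] at hPi
          exact hPi.2 ha
    exact key p h0

/-- Every edge either lies in the cut or has ends with the same value of `z`. -/
theorem _root_.IsEdgeList.cutSize_add [DecidableRel G.Adj] (H : IsEdgeList G es) (A : Finset (Fin n))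
    (z : ℕ → ℕ) (hz : ∀ v : Fin n, z v = if v ∈ A then 1 else 0) :
    cutSize G A + (badEdges es.length (firstEnd es) (secondEnd es) z).card = es.length := by
  have h1 := Finset.card_filter_add_card_filter_not (s := Finset.range es.length)
    (fun i => z (firstEnd es i) = z (secondEnd es i))
  rw [Finset.card_range] at h1
  suffices h2 : cutSize G A = ((Finset.range es.length).filter
      fun i => ¬z (firstEnd es i) = z (secondEnd es i)).card by
    rw [badEdges]
    omega
  have hval : ∀ (i : ℕ) (hi : i < es.length), ¬z (firstEnd es i) = z (secondEnd es i) ↔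
      (es[i].1 ∈ A ∧ es[i].2 ∉ A ∨ es[i].2 ∈ A ∧ es[i].1 ∉ A) := by
    intro i hi
    rw [firstEnd_eq hi, secondEnd_eq hi, hz, hz]
    by_cases c1 : es[i].1 ∈ A <;> by_cases c2 : es[i].2 ∈ A <;> simp [c1, c2]
  symm
  refine Finset.card_bij (fun i hi =>
    have hi := Finset.mem_range.1 (Finset.mem_filter.1 hi).1
    if es[i].1 ∈ A then (es[i].1, es[i].2) else (es[i].2, es[i].1)) ?_ ?_ ?_
  · intro i hi
    obtain ⟨hi, hd⟩ := Finset.mem_filter.1 hi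
    have hi := Finset.mem_range.1 hi
    have hadj := H.adj_getElem hi
    rw [hval i hi] at hd
    simp only [SimpleGraph.interedges, Rel.mem_interedges_iff]
    split_ifs with c
    · simpa [c, hadj] using hd
    · simpa [c, hadj.symm] using hd
  · intro i hi j hj h
    have hi := Finset.mem_range.1 (Finset.mem_filter.1 hi).1
    have hj := Finset.mem_range.1 (Finset.mem_filter.1 hj).1
    refine H.eq_of_sym2 hi hj (Sym2.eq_iff.2 ?_)
    simp only at h
    split_ifs at h <;> simp only [Prod.mk.injEq] at h <;> tauto
  · rintro ⟨a, b⟩ hab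
    simp only [SimpleGraph.interedges, Rel.mem_interedges_iff, Finset.mem_compl] at hab
    obtain ⟨ha, hb, hadj⟩ := hab
    obtain ⟨i, hi, e⟩ := H.exists_getElem hadj
    rcases Sym2.eq_iff.1 e with ⟨e1, e2⟩ | ⟨e1, e2⟩
    · refine ⟨i, Finset.mem_filter.2 ⟨Finset.mem_range.2 hi, (hval i hi).2 ?_⟩, ?_⟩
      · exact .inl ⟨e1 ▸ ha, e2 ▸ hb⟩
      · simp [e1, e2, ha]
    · refine ⟨i, Finset.mem_filter.2 ⟨Finset.mem_range.2 hi, (hval i hi).2 ?_⟩, ?_⟩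
      · exact .inr ⟨e2 ▸ ha, e1 ▸ hb⟩
      · simp [e1, e2, hb]

end

theorem IsRelabelling.exists_inverse {n m : ℕ} {eu ev pos up lo : ℕ → ℕ}
    (R : IsRelabelling n m eu ev pos up lo) (z : ℕ → ℕ) (hz : ∀ v, z v ≤ 1) :
    ∃ y : ℕ → ℕ, (∀ w, y w ≤ 1) ∧ ∀ v < n, y (pos v - 1) = z v := by
  classical
  refine ⟨fun l => if ∃ v < n, pos v - 1 = l ∧ z v = 1 then 1 else 0, fun w => ?_, fun v hv => ?_⟩
  · dsimp only
    split_ifs <;> omega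
  · have := hz v
    dsimp only
    split_ifs with h
    · obtain ⟨x, hx, e1, e2⟩ := h
      rw [← R.inj x hx v hv e1, e2]
    · have : z v ≠ 1 := fun e => h ⟨v, hv, rfl, e⟩
      omega

theorem IsRelabelling.badEdges_eq {n m : ℕ} {eu ev pos up lo x z : ℕ → ℕ}
    (R : IsRelabelling n m eu ev pos up lo) (hu : ∀ i < m, eu i < n) (hv : ∀ i < m, ev i < n)
    (h : ∀ v < n, x (pos v - 1) = z v) : badEdges m up lo x = badEdges m eu ev z := by
  refine Finset.filter_congr fun i hi => ?_
  have hi := Finset.mem_range.1 hi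
  rw [← h _ (hu i hi), ← h _ (hv i hi)]
  rcases R.edge i hi with ⟨e1, e2⟩ | ⟨e1, e2⟩ <;> rw [e1, e2]
  exact eq_comm

/-! ### The algorithm -/

namespace Cmd

open SparseMaxCut.Expr (var const get succ pred)

/-- Write the final colour of the vertex `v` to the output. -/
def outStep : Cmd :=
  block [set .u (pred (get .pos (var .v))),
    ite (.eq (get .flip (get .root (var .u))) (get .bcol (var .u)))
      (put .out (var .v) (const 0)) (put .out (var .v) (const 1))]

/-- The approximation algorithm. -/
def sparseMaxCut : Cmd :=
  block [search, cutting, forUp .w .n labelStep, forUp .i .m indexStep, solve, merge,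
    forUp .v .n outStep]

end Cmd

theorem out_run {n : ℕ} (h : Store) (hn : h.reg .n = n) :
    ∃ t h', (Cmd.forUp .v .n Cmd.outStep).Run h t h' ∧
      (∀ v < n, h'.arr .out v
        = flipped (h.arr .root) (h.arr .bcol) (h.arr .flip) (h.arr .pos v - 1)) ∧
      t ≤ (Cmd.outStep.time + 6) * n + 5 := by
  subst hn
  refine Cmd.forUp_run (p := Cmd.outStep) (fun k g => ∀ v < k, g.arr .out v
    = flipped (h.arr .root) (h.arr .bcol) (h.arr .flip) (h.arr .pos v - 1)) rfl rfl rfl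
    (by decide) (fun k g c hI => hI) (by simp) ?_
  intro k g hk hgv hf hI v hv
  have hnew : (Cmd.outStep.den g).arr .out = Function.update (g.arr .out) k
      (flipped (h.arr .root) (h.arr .bcol) (h.arr .flip) (h.arr .pos k - 1)) := by
    have e1 : g.arr .root = h.arr .root := hf.arr _ rfl
    have e2 : g.arr .bcol = h.arr .bcol := hf.arr _ rfl
    have e3 : g.arr .flip = h.arr .flip := hf.arr _ rfl
    have e4 : g.arr .pos = h.arr .pos := hf.arr _ rfl
    simp only [Cmd.outStep, Cmd.block, Cmd.den, Cond.Holds, Expr.eval, Store.setVar_arr,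
      Store.setVar_reg, reduceCtorEq, if_true, if_false, hgv, e1, e2, e3, e4, flipped]
    split_ifs <;> simp
  rw [hnew]
  rcases Nat.lt_succ_iff_lt_or_eq.1 hv with hv | rfl
  · rw [Function.update_of_ne hv.ne]
    exact hI v hv
  · rw [Function.update_self]

/-- The algorithm works in time `O(n + m)`, and the number of edges that are not in its cut is
optimal, or at most `(m - n) / 2` plus three quarters of the optimum. -/
theorem sparseMaxCut_run : ∃ K, ∀ {n m : ℕ} {eu ev : ℕ → ℕ}, IsInput n m eu ev → ∀ h : Store,
    h.reg .n = n → h.reg .m = m → (∀ x, x ≠ .n → x ≠ .m → h.reg x = 0) →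
    h.arr .eu = eu → h.arr .ev = ev → (∀ a, a ≠ .eu → a ≠ .ev → h.arr a = fun _ => 0) →
    ∃ t h', Cmd.sparseMaxCut.Run h t h' ∧ (∀ v < n, h'.arr .out v ≤ 1) ∧
      (∀ z : ℕ → ℕ, (∀ v, z v ≤ 1) →
        (badEdges m eu ev (h'.arr .out)).card ≤ (badEdges m eu ev z).card ∨
        4 * (badEdges m eu ev (h'.arr .out)).card + 2 * n
          ≤ 2 * m + 3 * (badEdges m eu ev z).card) ∧
      t ≤ K * (n + m + 1) := by
  obtain ⟨K, hK⟩ := search_run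
  refine ⟨K + Cmd.countStep.time + Cmd.popStep.time + Cmd.labelStep.time + Cmd.indexStep.time +
    (8 * (Cmd.roundTime + 9) + 20) + Cmd.compareStep.time + Cmd.outStep.time + 200, ?_⟩
  intro n m eu ev HI h hn hm hreg heu hev harr
  obtain ⟨t1, h1, r1, T, R, l1⟩ := hK HI h hn hm hreg heu hev harr
  have f1 : ∀ a, Cmd.search.modArr a = false → a ≠ .eu → a ≠ .ev → h1.arr a = fun _ => 0 :=
    fun a ha b1 b2 => by rw [r1.frame.arr a ha, harr a b1 b2]
  have n1 : h1.reg .n = n := by rw [r1.frame.reg _ rfl, hn]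
  have m1 : h1.reg .m = m := by rw [r1.frame.reg _ rfl, hm]
  obtain ⟨t2, h2, r2, C2, l2⟩ := cutting_run T HI.pos h1 n1 m1
    (by rw [r1.frame.reg _ rfl, hreg _ (by decide) (by decide)]) rfl rfl rfl
    (f1 _ rfl (by decide) (by decide)) (f1 _ rfl (by decide) (by decide))
    (f1 _ rfl (by decide) (by decide))
  have f2 : ∀ a, Cmd.search.modArr a = false → Cmd.cutting.modArr a = false → a ≠ .eu →
      a ≠ .ev → h2.arr a = fun _ => 0 :=
    fun a ha hb b1 b2 => by rw [r2.frame.arr a hb, f1 a ha b1 b2]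
  have n2 : h2.reg .n = n := by rw [r2.frame.reg _ rfl, n1]
  have m2 : h2.reg .m = m := by rw [r2.frame.reg _ rfl, m1]
  obtain ⟨t3, h3, r3, C, S, hidx, l3⟩ := label_run T h2 C2 n2 (r2.frame.arr _ rfl)
    (f2 _ rfl rfl (by decide) (by decide))
  have f3 : ∀ a, Cmd.search.modArr a = false → Cmd.cutting.modArr a = false →
      Cmd.labelStep.modArr a = false → a ≠ .eu → a ≠ .ev → h3.arr a = fun _ => 0 :=
    fun a ha hb hc b1 b2 => by
      rw [r3.frame.arr a (by simp [Cmd.forUp, Cmd.modArr, hc]), f2 a ha hb b1 b2]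
  have n3 : h3.reg .n = n := by rw [r3.frame.reg _ rfl, n2]
  have m3 : h3.reg .m = m := by rw [r3.frame.reg _ rfl, m2]
  have par3 : h3.arr .par = h1.arr .par := by rw [r3.frame.arr _ rfl, r2.frame.arr _ rfl]
  have up3 : h3.arr .up = h1.arr .up := by rw [r3.frame.arr _ rfl, r2.frame.arr _ rfl]
  have lo3 : h3.arr .lo = h1.arr .lo := by rw [r3.frame.arr _ rfl, r2.frame.arr _ rfl]
  have pos3 : h3.arr .pos = h1.arr .pos := by rw [r3.frame.arr _ rfl, r2.frame.arr _ rfl]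
  obtain ⟨t4, h4, r4, I, l4⟩ := index_run T C S h3 m3 par3 up3 lo3 rfl rfl
    (f3 _ rfl rfl rfl (by decide) (by decide)) hidx
  obtain ⟨t5, h5, r5, H, l5⟩ := solve_run T C S I h4 (by rw [r4.frame.reg _ rfl, n3])
    (by rw [r4.frame.reg _ rfl, m3]) (by rw [r4.frame.arr _ rfl, par3])
    (by rw [r4.frame.arr _ rfl, up3]) (by rw [r4.frame.arr _ rfl, lo3]) (r4.frame.arr _ rfl)
    (r4.frame.arr _ rfl) rfl
    (by rw [r4.frame.arr _ rfl, f3 _ rfl rfl rfl (by decide) (by decide)])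
    (by rw [r4.frame.arr _ rfl, f3 _ rfl rfl rfl (by decide) (by decide)])
  have n5 : h5.reg .n = n := by rw [r5.frame.reg _ rfl, r4.frame.reg _ rfl, n3]
  have root5 : h5.arr .root = h3.arr .root := by rw [r5.frame.arr _ rfl, r4.frame.arr _ rfl]
  obtain ⟨t6, h6, r6, hflip, hbal, l6⟩ := merge_run T C H.le h5 n5
    (by rw [r5.frame.reg _ rfl, r4.frame.reg _ rfl, m3])
    (by rw [r5.frame.arr _ rfl, r4.frame.arr _ rfl, up3])
    (by rw [r5.frame.arr _ rfl, r4.frame.arr _ rfl, lo3]) root5 rfl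
    (by rw [r5.frame.arr _ rfl, r4.frame.arr _ rfl, f3 _ rfl rfl rfl (by decide) (by decide)])
    (by rw [r5.frame.arr _ rfl, r4.frame.arr _ rfl, f3 _ rfl rfl rfl (by decide) (by decide)])
  obtain ⟨t7, h7, r7, hout, l7⟩ := out_run h6 (by rw [r6.frame.reg _ rfl, n5])
  rw [r6.frame.arr .root rfl, root5, r6.frame.arr .bcol rfl, r6.frame.arr .pos rfl,
    r5.frame.arr .pos rfl, r4.frame.arr .pos rfl, pos3] at hout
  refine ⟨_, h7, .seq r1 (.seq r2 (.seq r3 (.seq r4 (.seq r5 (.seq r6 (.seq r7 (.skip _))))))),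
    fun v hv => ?_, fun z hz => ?_, ?_⟩
  · rw [hout v hv, flipped]
    split_ifs <;> omega
  · obtain ⟨y, hy, hyz⟩ := R.exists_inverse z hz
    have := H.card_badEdges_le T C S hflip hbal HI.pos hy
    rwa [R.badEdges_eq HI.eu_lt HI.ev_lt hyz,
      R.badEdges_eq HI.eu_lt HI.ev_lt fun v hv => (hout v hv).symm] at this
  · have key : ∀ a b c d e f k : ℕ, K * (n + m + 1) + ((a + b + 60) * (n + m + 1) +
        ((c + 6) * n + 5 + ((d + 6) * m + 5 + (k * (n + m + 1) + ((e + 89) * (n + m + 1) +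
        ((f + 6) * n + 5 + 0)))))) ≤ (K + a + b + c + d + k + e + f + 200) * (n + m + 1) := by
      intro a b c d e f k
      have : (K + a + b + c + d + k + e + f + 200) * (n + m + 1)
        = K * (n + m + 1) + ((a + b + 60) * (n + m + 1) + ((c + 6) * n + 5 + ((d + 6) * m + 5
          + (k * (n + m + 1) + ((e + 89) * (n + m + 1) + ((f + 6) * n + 5 + 0))))))
          + (d * n + c * m + f * m + 39 * n + 45 * m + c + d + f + 36) := by
        ring
      omega
    refine le_trans ?_ (key _ _ _ _ _ _ _)
    gcongr

/-- The bounds on the numbers of edges outside the cuts give the approximation ratio. -/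
theorem ratio_le {n m c c' b b' : ℕ} (hmn : m ≤ 2 * n) (hc : c + b = m) (hc' : c' + b' = m)
    (h : b ≤ b' ∨ 4 * b + 2 * n ≤ 2 * m + 3 * b') :
    min 1 ((1 : ℝ) / 2 + (n : ℝ) / (2 * (m : ℝ))) * (c' : ℝ) ≤ (c : ℝ) := by
  rcases h with h | h
  · have h1 : (c' : ℝ) ≤ c := by
      norm_cast
      omega
    calc _ ≤ 1 * (c' : ℝ) := by gcongr; exact min_le_left _ _
      _ ≤ c := by rwa [one_mul]
  · rcases Nat.eq_zero_or_pos m with rfl | hm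
    · have : c' = 0 := by omega
      simp [this]
    · have hm' : (0 : ℝ) < m := by exact_mod_cast hm
      have hmn' : (m : ℝ) ≤ 2 * n := by exact_mod_cast hmn
      have hc1 : (c : ℝ) + b = m := by exact_mod_cast hc
      have hc2 : (c' : ℝ) + b' = m := by exact_mod_cast hc'
      have h' : 4 * (b : ℝ) + 2 * n ≤ 2 * m + 3 * b' := by exact_mod_cast h
      have hb' : (0 : ℝ) ≤ b' := Nat.cast_nonneg _
      have hr : (1 : ℝ) / 4 ≤ (n : ℝ) / (2 * m) := by
        rw [div_le_div_iff₀ (by norm_num) (by positivity)]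
        linarith
      have hrm : (n : ℝ) / (2 * m) * m = n / 2 := by
        field_simp
      calc _ ≤ ((1 : ℝ) / 2 + (n : ℝ) / (2 * (m : ℝ))) * c' := by
            gcongr
            exact min_le_right _ _
        _ = m / 2 + n / 2 - (1 / 2 + (n : ℝ) / (2 * m)) * b' := by
            rw [← hrm, show (c' : ℝ) = m - b' by linarith]
            ring
        _ ≤ c := by nlinarith [mul_le_mul_of_nonneg_right hr hb']

end SparseMaxCut

/-- There are one program and one constant `C` such that, on every edge list of every connected graph
with `n` vertices and `m ≤ 2 n` edges, the program halts after at most `C * n` steps with a cut of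
size at least `min (1, 1/2 + n / (2 m))` times the maximum. -/
theorem theorem3 :
    ∃ (P : RAM.Program) (C : ℕ),
      ∀ (n : ℕ) (G : SimpleGraph (Fin n)) [DecidableRel G.Adj] (es : List (Fin n × Fin n)),
        G.Connected → G.edgeFinset.card ≤ 2 * n → IsEdgeList G es →
          ∃ (t : ℕ) (s : RAM.State),
            RAM.Exec P (inputState n es) t s ∧
            t ≤ C * n ∧
            min 1 ((1 : ℝ) / 2 + (n : ℝ) / (2 * (G.edgeFinset.card : ℝ))) * (maxCut G : ℝ)
              ≤ (cutSize G (outputSide n s) : ℝ) := by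
  obtain ⟨K, hK⟩ := SparseMaxCut.sparseMaxCut_run
  refine ⟨SparseMaxCut.Cmd.sparseMaxCut.compile, 4 * K, fun n G _ es hG hm hes => ?_⟩
  have HI := hes.isInput hG
  rw [hes.card_edgeFinset] at hm ⊢
  obtain ⟨t, h', r, hle, hbad, ht⟩ := hK HI (SparseMaxCut.view (inputState n es)) rfl rfl
    (fun x h1 h2 => by cases x <;> first | rfl | contradiction) rfl rfl
    (fun a h1 h2 => by cases a <;> first | rfl | contradiction)
  obtain ⟨s, hs, rfl⟩ := r.exec _ rfl
  refine ⟨t, s, hs, ht.trans ?_, ?_⟩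
  · have := HI.pos
    calc K * (n + es.length + 1) ≤ K * (4 * n) := Nat.mul_le_mul_left _ (by omega)
      _ = 4 * K * n := by ring
  · have hout := hes.cutSize_add (outputSide n s) ((SparseMaxCut.view s).arr .out) fun v => by
      have h1 := hle v v.2
      have h2 : v ∈ outputSide n s ↔ (SparseMaxCut.view s).arr .out v ≠ 0 := by
        simp only [outputSide, Finset.mem_filter, Finset.mem_univ, true_and]
        rfl
      split_ifs with c <;> rw [h2] at c <;> omega
    obtain ⟨A, -, hA⟩ := Finset.exists_mem_eq_sup (Finset.univ : Finset (Finset (Fin n)))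
      Finset.univ_nonempty (cutSize G)
    have hmax := hes.cutSize_add A (fun v => if h : v < n then if ⟨v, h⟩ ∈ A then 1 else 0 else 0)
      fun v => by simp
    rw [maxCut, hA]
    exact SparseMaxCut.ratio_le hm hout hmax (hbad _ fun v => by split_ifs <;> omega)
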